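/- **Setting.** A market consists of a finite set $\mathcal S$ of sponsored products, a finite set $\mathcal O$ of organic products, and $k$ positions, split into reserved positions $\mathcal R$ with $|\mathcal R|=|\mathcal S|$ and organic positions $\mathcal P$; each $i\in\mathcal S$ has a set $\mathcal R_i\subseteq\mathcal R$ of valid positions; products have revenues $r_i\ge 0$ and weights $w(i,t)\ge 0$ in position $t$, and $w_0>0$ is the weight of not buying. A plan $\pi$ puts at most one product in each position and each product in at most one position $\pi^{-1}(i)$. For $v>0$ put $f_v(\pi)=\sum_{i\in\pi}\frac{r_i\,w(i,\pi^{-1}(i))}{v+\sum_{j\in\pi}w(j,\pi^{-1}(j))}$. Let $\mathcal I\subseteq 2^{\mathcal O}$ be a family of feasible sets. * **P.2**: maximize $f_{w_0}(\pi)$ over plans $\pi$ with $\pi^{-1}(i)\in\mathcal R_i$ for all $i\in\mathcal S$ and $\pi\cap\mathcal O\in\mathcal I$. * **P.4**: minimize $\sum_{j\in\sigma}w(j,\sigma^{-1}(j))$ over plans $\sigma$ of sponsored products only with $\sigma^{-1}(i)\in\mathcal R_i$ for all $i\in\mathcal S$. For an optimal $\sigma$ let $w_0'=w_0+\sum_{j\in\sigma}w(j,\sigma^{-1}(j))$.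 * **P.5** (given $w_0'$): maximize $f_{w_0'}(\pi)$ over plans $\pi$ of organic products in organic positions whose set of products is in $\mathcal I$. * **P.6** (given $w_0'$ and $r'_{\min}$): let $\pi'$ be a nonempty optimal solution of P.5, $r'_{\min}=\min_{i\in\pi'}r_i$, and $\mathcal U'=\{(i,t)\in\mathcal O\times\mathcal P: r_i\ge r'_{\min}\}$. For $U\subseteq\mathcal U'$ let $\mathcal O(U)$ be the set of products occurring in $U$, $\omega(U,i)=\max_{t:(i,t)\in U}w(i,t)$, $l(U)=\sum_{i\in\mathcal O(U)}\frac{r_i\,\omega(U,i)}{w_0'+\sum_{j\in\mathcal O(U)}\omega(U,j)}$ and $h(U)=\max_{X\subseteq U}l(X)$. Maximize $g(U)=\min\{h(U),r'_{\min}\}$ over $U\subseteq\mathcal U'$ that contain at most one pair $(i,t)$ for each $t\in\mathcal P$ and satisfy $\mathcal O(U)\in\mathcal I$. An *$\alpha$-approximation algorithm* is a single real-RAM program (unit-cost arithmetic and comparison of reals, rational constants, no rounding) that, on every instance having a feasible solution, outputs within a number of steps polynomial in the size of the instance a feasible solution of value at least $\alpha$ times the optimum. The size is $|\mathcal S|+|\mathcal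 O|+k$ (plus the number $m$ of groups in the second case). **Theorem.** Let $\varepsilon>0$. 1. *Knapsack.* Let $\mathcal I=\{A\subseteq\mathcal O:\sum_{i\in A}c_i\le C\}$ with $c_i\ge0$, $C\ge0$. Replace the constraint $\mathcal O(U)\in\mathcal I$ of P.6 by $\sum_{(i,t)\in U}c_i\le C$. The resulting problem is the maximization of a function $g$ that is monotone and submodular on subsets of $\mathcal U'$, subject to a partition matroid (at most one pair per position) and a knapsack constraint; each of its feasible sets is feasible for P.6, and each feasible set of P.6 contains a feasible set of the new problem with the same value of $g$. The new problem, P.6 and P.5 have $\alpha$-approximation algorithms with $\alpha=\frac1{(1+\varepsilon)3}$, and P.2 has an $\frac{\alpha}{\alpha+1}$-approximation algorithm. 2. *Groups.* Let $\mathcal O$ be partitioned into groups $\mathcal G_1,\dots,\mathcal G_m$ and $\mathcal I=\{A\subseteq\mathcal O:|A\cap\mathcal G_q|\le\gamma_q\ \forall q\}$ with $\gamma_q\in\mathbb N$. Replace the constraint $\mathcal O(U)\in\mathcal I$ of P.6 by $|\{(i,t)\in U:i\in\mathcal G_q\}|\le\gamma_q$ for all $q$. The resulting problem is the maximization of a function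 $g$ that is monotone and submodular on subsets of $\mathcal U'$, subject to two partition matroids; each of its feasible sets is feasible for P.6, and each feasible set of P.6 contains a feasible set of the new problem with the same value of $g$. The new problem, P.6 and P.5 have $\beta$-approximation algorithms with $\beta=\frac1{2+\varepsilon}$, and P.2 has a $\frac{\beta}{\beta+1}$-approximation algorithm. -/

import Mathlib

/-! ### A real RAM: uniform programs with rational constants and a step count -/

/-- Memory: countably many two-dimensional arrays of natural numbers (used for counting, indexing
and pointers) and countably many two-dimensional arrays of real numbers. -/
structure Mem where
  nat : ℕ → ℕ → ℕ → ℕ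
  real : ℕ → ℕ → ℕ → ℝ

/-- Overwrite the cell `(i, j)` of array `a`. -/
def setCell {α : Type} (m : ℕ → ℕ → ℕ → α) (a i j : ℕ) (v : α) : ℕ → ℕ → ℕ → α :=
  fun a' i' j' => if a' = a ∧ i' = i ∧ j' = j then v else m a' i' j'

/-- Integer expressions. The name of an array is fixed in the program; its two indices are computed.
There is no multiplication, so the bit length of an integer grows by `O(1)` per step. -/
inductive NExpr where
  | const (n : ℕ)
  | read (a : ℕ) (i j : NExpr)
  | add (x y : NExpr)
  | sub (x y : NExpr)

def NExpr.eval (m : Mem) : NExpr → ℕ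
  | .const n => n
  | .read a i j => m.nat a (i.eval m) (j.eval m)
  | .add x y => x.eval m + y.eval m
  | .sub x y => x.eval m - y.eval m

/-- Real expressions: field arithmetic, with rational constants only and no rounding. -/
inductive RExpr where
  | const (q : ℚ)
  | ofNat (x : NExpr)
  | read (a : ℕ) (i j : NExpr)
  | add (x y : RExpr)
  | sub (x y : RExpr)
  | mul (x y : RExpr)
  | div (x y : RExpr)

noncomputable def RExpr.eval (m : Mem) : RExpr → ℝ
  | .const q => (q : ℝ)
  | .ofNat x => (x.eval m : ℝ)
  | .read a i j => m.real a (i.eval m) (j.eval m)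
  | .add x y => x.eval m + y.eval m
  | .sub x y => x.eval m - y.eval m
  | .mul x y => x.eval m * y.eval m
  | .div x y => x.eval m / y.eval m

/-- Tests: comparisons of integers and of reals, and their Boolean combinations. -/
inductive BExpr where
  | natLe (x y : NExpr)
  | realLe (x y : RExpr)
  | not (b : BExpr)
  | and (b c : BExpr)

def BExpr.holds (m : Mem) : BExpr → Prop
  | .natLe x y => x.eval m ≤ y.eval m
  | .realLe x y => x.eval m ≤ y.eval m
  | .not b => ¬ b.holds m
  | .and b c => b.holds m ∧ c.holds m

inductive Prog where
  | skip
  | setNat (a : ℕ) (i j v : NExpr)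
  | setReal (a : ℕ) (i j : NExpr) (v : RExpr)
  | seq (p q : Prog)
  | ite (b : BExpr) (p q : Prog)
  | while (b : BExpr) (p : Prog)

/-- `Prog.Run p m T m'`: started in memory `m`, the program `p` halts in memory `m'` after exactly
`T` steps, where each executed assignment or `skip` and each evaluated test is one step. (Every
expression has a fixed size in a given program, so this is the number of operations up to a
constant factor.) -/
inductive Prog.Run : Prog → Mem → ℕ → Mem → Prop
  | skip (m : Mem) : Run .skip m 1 m
  | setNat (a : ℕ) (i j v : NExpr) (m : Mem) :
      Run (.setNat a i j v) m 1
        { m with nat := setCell m.nat a (i.eval m) (j.eval m) (v.eval m) }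
  | setReal (a : ℕ) (i j : NExpr) (v : RExpr) (m : Mem) :
      Run (.setReal a i j v) m 1
        { m with real := setCell m.real a (i.eval m) (j.eval m) (v.eval m) }
  | seq {p q : Prog} {m m' m'' : Mem} {S T : ℕ} (hp : Run p m S m') (hq : Run q m' T m'') :
      Run (.seq p q) m (S + T) m''
  | ite_true {b : BExpr} {p q : Prog} {m m' : Mem} {T : ℕ} (hb : b.holds m) (hp : Run p m T m') :
      Run (.ite b p q) m (T + 1) m'
  | ite_false {b : BExpr} {p q : Prog} {m m' : Mem} {T : ℕ} (hb : ¬ b.holds m)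
      (hq : Run q m T m') : Run (.ite b p q) m (T + 1) m'
  | while_true {b : BExpr} {p : Prog} {m m' m'' : Mem} {S T : ℕ} (hb : b.holds m)
      (hp : Run p m S m') (hw : Run (.while b p) m' T m'') :
      Run (.while b p) m (S + T + 1) m''
  | while_false {b : BExpr} {p : Prog} {m : Mem} (hb : ¬ b.holds m) : Run (.while b p) m 1 m

/-! ### Maximization problems and polynomial-time approximation algorithms -/

/-- A maximization problem, with the way its instances are written into the memory and the way a
solution is read off the memory. -/
structure MaxProblem where
  Inst : Type
  size : Inst → ℕ
  encode : Inst → Mem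
  Sol : Inst → Type
  IsOutput : (x : Inst) → Mem → Sol x → Prop
  Feasible : (x : Inst) → Sol x → Prop
  value : (x : Inst) → Sol x → ℝ

/-- The problem has a polynomial-time `α`-approximation algorithm: one program which, on every
instance that has a feasible solution, halts within polynomially many steps with a feasible solution
whose value is at least `α` times that of every feasible solution. -/
def MaxProblem.HasApproxAlgorithm (P : MaxProblem) (α : ℝ) : Prop :=
  ∃ (prog : Prog) (p : Polynomial ℕ), ∀ x : P.Inst, (∃ s, P.Feasible x s) →
    ∃ (T : ℕ) (m : Mem), prog.Run (P.encode x) T m ∧ T ≤ p.eval (P.size x) ∧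
      ∃ s : P.Sol x, P.IsOutput x m s ∧ P.Feasible x s ∧
        ∀ s' : P.Sol x, P.Feasible x s' → α * P.value x s' ≤ P.value x s

/-! ### Markets and assortment plans -/

/-- `nS` sponsored products, `nO` organic products and `k` positions. The positions in `reserved`
are those reserved for sponsored products; the others are the organic positions. -/
structure Market where
  nS : ℕ
  nO : ℕ
  k : ℕ
  reserved : Finset (Fin k)
  card_reserved : reserved.card = nS
  /-- the valid positions of a sponsored product -/
  valid : Fin nS → Finset (Fin k)
  valid_subset : ∀ i, valid i ⊆ reserved
  /-- revenues -/
  r : Fin nS ⊕ Fin nO → ℝ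
  r_nonneg : ∀ p, 0 ≤ r p
  /-- utility (MNL weight) of a product in a position -/
  w : Fin nS ⊕ Fin nO → Fin k → ℝ
  w_nonneg : ∀ p t, 0 ≤ w p t
  /-- utility of the non-purchase option -/
  w0 : ℝ
  w0_pos : 0 < w0

namespace Market

variable (M : Market)

abbrev Product : Type := Fin M.nS ⊕ Fin M.nO

/-- Which product, if any, is displayed in each position. -/
abbrev Plan : Type := Fin M.k → Option M.Product

/-- No product is displayed twice. -/
def IsSequence (π : M.Plan) : Prop :=
  ∀ t t' p, π t = some p → π t' = some p → t = t'

/-- The total weight of the displayed products. -/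
def totalWeight (π : M.Plan) : ℝ := ∑ t, (π t).elim 0 (fun p => M.w p t)

/-- The expected revenue of `π` under the MNL model with non-purchase utility `v`. -/
noncomputable def revenue (v : ℝ) (π : M.Plan) : ℝ :=
  ∑ t, (π t).elim 0 (fun p => M.r p * (M.w p t / (v + M.totalWeight π)))

/-- Every sponsored product is displayed in one of its valid positions. -/
def PlacesSponsored (π : M.Plan) : Prop :=
  ∀ i : Fin M.nS, ∃ t ∈ M.valid i, π t = some (Sum.inl i)

/-- The set of organic products displayed by `π`. -/
def organicSet (π : M.Plan) : Finset (Fin M.nO) :=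
  Finset.univ.filter (fun j => ∃ t, π t = some (Sum.inr j))

/-- Feasible plans of the constrained problem (P.2), for a family `F` of feasible organic sets. -/
def P2Feasible (F : Set (Finset (Fin M.nO))) (π : M.Plan) : Prop :=
  M.IsSequence π ∧ M.PlacesSponsored π ∧ M.organicSet π ∈ F

/-- Feasible plans of the minimum weight problem (P.4) for the sponsored products alone. -/
def P4Feasible (π : M.Plan) : Prop :=
  M.IsSequence π ∧ M.PlacesSponsored π ∧ M.organicSet π = ∅

/-- Minimum weight placements of the sponsored products. -/
def P4Optimal (σ : M.Plan) : Prop :=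
  M.P4Feasible σ ∧ ∀ τ, M.P4Feasible τ → M.totalWeight σ ≤ M.totalWeight τ

/-- Feasible plans of (P.5): organic products only, in organic positions, forming a set in `F`. -/
def P5Feasible (F : Set (Finset (Fin M.nO))) (π : M.Plan) : Prop :=
  M.IsSequence π ∧ (∀ t p, π t = some p → p.isRight ∧ t ∉ M.reserved) ∧ M.organicSet π ∈ F

/-- The non-purchase utility `w₀'` once the sponsored products are placed by `σ`. -/
def residualW0 (σ : M.Plan) : ℝ := M.w0 + M.totalWeight σ

/-- Optimal solutions of (P.5) on top of the sponsored placement `σ`. -/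
def P5Optimal (F : Set (Finset (Fin M.nO))) (σ π : M.Plan) : Prop :=
  M.P5Feasible F π ∧ ∀ τ, M.P5Feasible F τ →
    M.revenue (M.residualW0 σ) τ ≤ M.revenue (M.residualW0 σ) π

/-! #### The set function on pairs (organic product, organic position) -/

/-- A pair of an organic product and a position for it. -/
abbrev Elem : Type := Fin M.nO × Fin M.k

/-- The organic products that occur in `U`. -/
def productsOf (U : Finset M.Elem) : Finset (Fin M.nO) := U.image Prod.fst

/-- The largest weight of `i` over the positions `t` with `(i, t) ∈ U`. -/
noncomputable def bestWeight (U : Finset M.Elem) (i : Fin M.nO) : ℝ :=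
  if h : (U.filter (fun e => e.1 = i)).Nonempty then
    (U.filter (fun e => e.1 = i)).sup' h (fun e => M.w (Sum.inr e.1) e.2)
  else 0

/-- The function `l`, with non-purchase utility `v`. -/
noncomputable def setRevenue (v : ℝ) (U : Finset M.Elem) : ℝ :=
  ∑ i ∈ M.productsOf U, M.r (Sum.inr i) * M.bestWeight U i /
    (v + ∑ j ∈ M.productsOf U, M.bestWeight U j)

/-- The function `h U = max_{X ⊆ U} l X`. -/
noncomputable def bestSetRevenue (v : ℝ) (U : Finset M.Elem) : ℝ :=
  U.powerset.sup' ⟨∅, Finset.empty_mem_powerset U⟩ (M.setRevenue v)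

/-- The pairs whose position is organic and whose product has revenue at least `ρ`. -/
noncomputable def ground (ρ : ℝ) : Finset M.Elem :=
  Finset.univ.filter (fun e => e.2 ∉ M.reserved ∧ ρ ≤ M.r (Sum.inr e.1))

/-- Sets of pairs from `ground ρ` that use each organic position at most once. -/
def OnePerPosition (ρ : ℝ) (U : Finset M.Elem) : Prop :=
  U ⊆ M.ground ρ ∧ ∀ t, t ∉ M.reserved → (U ∩ (M.ground ρ).filter (fun e => e.2 = t)).card ≤ 1

end Market

/-! ### Set functions and constraints -/

def MonotoneOnSubsets {α : Type} (E : Finset α) (g : Finset α → ℝ) : Prop :=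
  ∀ A B, A ⊆ B → B ⊆ E → g A ≤ g B

def SubmodularOnSubsets {α : Type} [DecidableEq α] (E : Finset α) (g : Finset α → ℝ) : Prop :=
  ∀ A B, A ⊆ B → B ⊆ E → ∀ x ∈ E, x ∉ B → g (insert x B) - g B ≤ g (insert x A) - g A

/-- `F` is the family of independent sets of a partition matroid on `E`. -/
def IsPartitionMatroid {α : Type} [DecidableEq α] (E : Finset α) (F : Finset α → Prop) : Prop :=
  ∃ (n : ℕ) (part : Fin n → Finset α) (cap : Fin n → ℕ),
    (∀ p q, p ≠ q → Disjoint (part p) (part q)) ∧ E = Finset.univ.biUnion part ∧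
    ∀ U, F U ↔ U ⊆ E ∧ ∀ q, (U ∩ part q).card ≤ cap q

/-- On subsets of `E`, `F` is a knapsack constraint with nonnegative costs. -/
def IsKnapsackConstraint {α : Type} (E : Finset α) (F : Finset α → Prop) : Prop :=
  ∃ (cost : α → ℝ) (budget : ℝ), (∀ e ∈ E, 0 ≤ cost e) ∧
    ∀ U ⊆ E, F U ↔ ∑ e ∈ U, cost e ≤ budget

/-- The maximization of `g` under `F'` replaces that under `F`: sets feasible for `F'` are feasible
for `F`, and every set feasible for `F` contains one that is feasible for `F'` of the same value. -/
def ReducesTo {α : Type} (g : Finset α → ℝ) (F F' : Finset α → Prop) : Prop :=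
  (∀ V, F' V → F V) ∧ ∀ U, F U → ∃ V ⊆ U, F' V ∧ g V = g U

/-! ### Input and output conventions -/

def table1 {α : Type} [Zero α] {n : ℕ} (f : Fin n → α) (i : ℕ) : α :=
  if h : i < n then f ⟨i, h⟩ else 0

def table2 {α : Type} [Zero α] {n k : ℕ} (f : Fin n → Fin k → α) (i j : ℕ) : α :=
  table1 (fun a => table1 (f a) j) i

/-- The input of an unconstrained market; all other cells are `0`. -/
def Market.encode (M : Market) : Mem where
  nat := fun a i j =>
    match a, i, j with
    | 0, 0, 0 => M.nS
    | 0, 0, 1 => M.nO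
    | 0, 0, 2 => M.k
    | 1, i, t => table2 (fun i t => if t ∈ M.valid i then 1 else 0) i t
    | 2, t, 0 => table1 (fun t => if t ∈ M.reserved then 1 else 0) t
    | _, _, _ => 0
  real := fun a i j =>
    match a, i, j with
    | 0, 0, 0 => M.w0
    | 1, i, 0 => table1 (fun i => M.r (Sum.inl i)) i
    | 2, i, 0 => table1 (fun i => M.r (Sum.inr i)) i
    | 3, i, t => table2 (fun i t => M.w (Sum.inl i) t) i t
    | 4, i, t => table2 (fun i t => M.w (Sum.inr i) t) i t
    | _, _, _ => 0

/-- `0` for an empty position, `1, …, nS` for sponsored, `nS + 1, …, nS + nO` for organic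
products. -/
def Market.code (M : Market) : Option M.Product → ℕ
  | none => 0
  | some (Sum.inl i) => i + 1
  | some (Sum.inr j) => M.nS + j + 1

/-- A plan is output in the integer array `5`, position by position. -/
def Market.IsPlanOutput (M : Market) (m : Mem) (π : M.Plan) : Prop :=
  ∀ t : Fin M.k, m.nat 5 t 0 = M.code (π t)

/-- A set of pairs is output in the integer array `5` through its indicator function. -/
def Market.IsSetOutput (M : Market) (m : Mem) (U : Finset M.Elem) : Prop :=
  ∀ (i : Fin M.nO) (t : Fin M.k), m.nat 5 i t = if (i, t) ∈ U then 1 else 0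

/-! ### Constrained markets and the problems (P.2), (P.5), (P.6) -/

/-- A class of constraints: instances consisting of a market and a family of feasible sets of
organic products, with their sizes and encodings. -/
structure ConstraintClass where
  Inst : Type
  market : Inst → Market
  family : (x : Inst) → Set (Finset (Fin (market x).nO))
  size : Inst → ℕ
  encode : Inst → Mem

namespace ConstraintClass

variable (K : ConstraintClass)

/-- The original problem (P.2). -/
noncomputable def P2 : MaxProblem where
  Inst := K.Inst
  size := K.size
  encode := K.encode
  Sol x := (K.market x).Plan
  IsOutput x := (K.market x).IsPlanOutput
  Feasible x := (K.market x).P2Feasible (K.family x)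
  value x := (K.market x).revenue (K.market x).w0

/-- An instance of (P.5): a market with a minimum weight placement of its sponsored products. -/
structure P5Inst where
  base : K.Inst
  σ : (K.market base).Plan
  σ_optimal : (K.market base).P4Optimal σ

variable {K}

abbrev P5Inst.M (y : K.P5Inst) : Market := K.market y.base

/-- The non-purchase utility `w₀'`. -/
def P5Inst.w0' (y : K.P5Inst) : ℝ := y.M.residualW0 y.σ

/-- The input of (P.5): the constrained market and `w₀'`. -/
def P5Inst.encode (y : K.P5Inst) : Mem :=
  { K.encode y.base with real := setCell (K.encode y.base).real 0 0 2 y.w0' }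

variable (K) in
/-- The problem (P.5). -/
noncomputable def P5 : MaxProblem where
  Inst := K.P5Inst
  size y := K.size y.base
  encode y := y.encode
  Sol y := y.M.Plan
  IsOutput y := y.M.IsPlanOutput
  Feasible y := y.M.P5Feasible (K.family y.base)
  value y := y.M.revenue y.w0'

variable (K) in
/-- An instance of (P.6): an instance of (P.5) with a nonempty optimal solution `π'` of it. -/
structure P6Inst extends K.P5Inst where
  π' : (K.market base).Plan
  π'_optimal : (K.market base).P5Optimal (K.family base) σ π'
  π'_nonempty : ((K.market base).organicSet π').Nonempty

/-- The minimum revenue `r'_min` of the products in `π'`. -/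
noncomputable def P6Inst.rMin (y : K.P6Inst) : ℝ :=
  (y.M.organicSet y.π').inf' y.π'_nonempty (fun j => y.M.r (Sum.inr j))

/-- The ground set: pairs of an organic product of revenue at least `r'_min` and an organic
position. -/
noncomputable def P6Inst.ground (y : K.P6Inst) : Finset y.M.Elem := y.M.ground y.rMin

/-- The objective `min {h U, r'_min}`. -/
noncomputable def P6Inst.objective (y : K.P6Inst) (U : Finset y.M.Elem) : ℝ :=
  min (y.M.bestSetRevenue y.w0' U) y.rMin

def P6Inst.OnePerPosition (y : K.P6Inst) (U : Finset y.M.Elem) : Prop :=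
  y.M.OnePerPosition y.rMin U

/-- Feasible sets of (P.6). -/
def P6Inst.Feasible (y : K.P6Inst) (U : Finset y.M.Elem) : Prop :=
  y.OnePerPosition U ∧ y.M.productsOf U ∈ K.family y.base

/-- The input of (P.6): the constrained market, `w₀'` and `r'_min`, but not `π'`. -/
noncomputable def P6Inst.encode (y : K.P6Inst) : Mem :=
  { y.toP5Inst.encode with real := setCell y.toP5Inst.encode.real 0 0 3 y.rMin }

variable (K) in
/-- The maximization of the objective of (P.6) under an arbitrary feasibility condition. -/
noncomputable def P6With (Feas : (y : K.P6Inst) → Finset y.M.Elem → Prop) : MaxProblem where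
  Inst := K.P6Inst
  size y := K.size y.base
  encode y := y.encode
  Sol y := Finset y.M.Elem
  IsOutput y := y.M.IsSetOutput
  Feasible := Feas
  value y := y.objective

variable (K) in
/-- The problem (P.6). -/
noncomputable def P6 : MaxProblem := K.P6With P6Inst.Feasible

end ConstraintClass

/-! ### The two classes of constraints -/

/-- A market with a cost for each organic product and a capacity. -/
structure KnapsackInst where
  M : Market
  cost : Fin M.nO → ℝ
  cost_nonneg : ∀ i, 0 ≤ cost i
  capacity : ℝ
  capacity_nonneg : 0 ≤ capacity

def KnapsackInst.encode (x : KnapsackInst) : Mem where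
  nat := x.M.encode.nat
  real := fun a i j =>
    match a, i, j with
    | 0, 0, 1 => x.capacity
    | 5, i, 0 => table1 x.cost i
    | a, i, j => x.M.encode.real a i j

def knapsackClass : ConstraintClass where
  Inst := KnapsackInst
  market x := x.M
  family x := {A | ∑ i ∈ A, x.cost i ≤ x.capacity}
  size x := x.M.nS + x.M.nO + x.M.k
  encode x := x.encode

/-- A market whose organic products are partitioned into `m` groups, at most `γ q` products being
allowed from group `q`. -/
structure GroupInst where
  M : Market
  m : ℕ
  group : Fin M.nO → Fin m
  γ : Fin m → ℕ

def GroupInst.encode (x : GroupInst) : Mem where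
  nat := fun a i j =>
    match a, i, j with
    | 0, 0, 3 => x.m
    | 3, i, 0 => table1 (fun i => (x.group i : ℕ)) i
    | 4, q, 0 => table1 x.γ q
    | a, i, j => x.M.encode.nat a i j
  real := x.M.encode.real

def groupClass : ConstraintClass where
  Inst := GroupInst
  market x := x.M
  family x := {A | ∀ q, (A.filter (fun i => x.group i = q)).card ≤ x.γ q}
  size x := x.M.nS + x.M.nO + x.M.k + x.m
  encode x := x.encode

namespace ConstraintClass.P6Inst

/-- Each pair pays the cost of its product. -/
def PairBudget (y : knapsackClass.P6Inst) (U : Finset y.M.Elem) : Prop :=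
  ∑ e ∈ U, KnapsackInst.cost y.base e.1 ≤ KnapsackInst.capacity y.base

/-- The converted problem for knapsack constraints. -/
def KnapsackFeasible (y : knapsackClass.P6Inst) (U : Finset y.M.Elem) : Prop :=
  y.OnePerPosition U ∧ PairBudget y U

/-- At most `γ q` pairs have their product in group `q`. -/
def PairQuota (y : groupClass.P6Inst) (U : Finset y.M.Elem) : Prop :=
  U ⊆ y.ground ∧
    ∀ q, (U.filter (fun e => GroupInst.group y.base e.1 = q)).card ≤ GroupInst.γ y.base q

/-- The converted problem for group constraints. -/
def GroupFeasible (y : groupClass.P6Inst) (U : Finset y.M.Elem) : Prop :=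
  y.OnePerPosition U ∧ PairQuota y U

end ConstraintClass.P6Inst

/-! Plans are judged by a ratio A / (v + W) of a total revenue A = ∑ r w to a total weight W = ∑ w
plus a constant. Such a ratio is at least z exactly when the gains (r - z) w add up to at least z v.
For a fixed price z the problem is therefore linear: assign products to positions so as to maximize
a sum of gains, subject to a budget and to quotas. The algorithms rest on this linearization and use
no submodular maximization; monotonicity and submodularity of the objective of `P6` are proved
separately, from the same linearization.

Quotas and the forced display of sponsored products become part of an assignment problem on a square
table (`PlanData.table`). Besides the positions there is one extra place per organic product, open
only to undisplayed products of the same group and, unless its rank within the group has reached the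
quota, to empty rows. The places of rank at least the quota must be filled by undisplayed products
of the group, which is precisely the quota. `PlanData.exists_plan` and `PlanData.exists_isSol`
translate solutions into plans and back, and `PlanData.Rel.value_eq` matches the values.

The budget C is handled by a Lagrange multiplier (`Table.le_value_of_optimal`). Let τ be the gain
still needed from the optional pairs to reach z v when the forced pairs do their best, and charge 2τ
/ C per unit of cost (nothing if τ ≤ 0). The Hungarian method solves the relaxed assignment exactly
(`Assign.hungarian_spec`). If the pairs it selects fit into the budget and some solution has value
at least 3z, they reach z v, because the total penalty is at most 2z(v + W), where W is the weight
of that solution. If they do not fit, the first overflowing prefix gains at least 2τ, and the better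
of its last row and the rows before it gains at least τ. So every price up to a third of the optimum
yields a feasible solution of value at least that price. If C = 0 nothing overflows and nothing is
paid, so every price up to the optimum itself works.

A suitable price is found by guessing which pairs have the largest r w and the largest w in an
optimal solution, and then trying a geometric progression with ratio 1 + 1/k
(`Table.search_approx`). This loses a factor 3(1 + 1/k) with a budget and 1 + 1/k with quotas alone.
`P2` is solved directly, the sponsored products being rows of forced pairs; it gets the ratio α
itself, which is at least α / (α + 1).

For `P6`, any feasible set can be thinned to one best pair per product without changing the
objective, and such sets are the sets of pairs of plans. The cut-off at the minimum revenue does no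
harm because α ≤ 1. All programs are written with loops whose lengths are multiples of one number N,
so polynomial running time follows once and for all from `Cmd.compile_run`. -/

/-! ### Programs with bounded loops -/

/-- Overwrite one integer cell. -/
def Mem.setN (m : Mem) (a i j v : ℕ) : Mem := { m with nat := setCell m.nat a i j v }

/-- Overwrite one real cell. -/
def Mem.setR (m : Mem) (a i j : ℕ) (v : ℝ) : Mem := { m with real := setCell m.real a i j v }

@[simp] theorem Mem.setN_real (m : Mem) (a i j v : ℕ) : (m.setN a i j v).real = m.real := rfl

@[simp] theorem Mem.setR_nat (m : Mem) (a i j : ℕ) (v : ℝ) : (m.setR a i j v).nat = m.nat := rfl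

theorem Mem.setN_nat (m : Mem) (a i j v a' i' j' : ℕ) :
    (m.setN a i j v).nat a' i' j' = if a' = a ∧ i' = i ∧ j' = j then v else m.nat a' i' j' := rfl

theorem Mem.setR_real (m : Mem) (a i j : ℕ) (v : ℝ) (a' i' j' : ℕ) :
    (m.setR a i j v).real a' i' j' = if a' = a ∧ i' = i ∧ j' = j then v else m.real a' i' j' := rfl

theorem Mem.setN_nat_ne (m : Mem) {a i j v a' : ℕ} (h : a' ≠ a) :
    (m.setN a i j v).nat a' = m.nat a' := by
  funext i' j'; simp [Mem.setN_nat, h]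

theorem Mem.setR_real_ne (m : Mem) {a i j : ℕ} {v : ℝ} {a' : ℕ} (h : a' ≠ a) :
    (m.setR a i j v).real a' = m.real a' := by
  funext i' j'; simp [Mem.setR_real, h]

/-- Programs whose only loops run `c * N` times, where `N` is stored in the integer cell
`(6, 0, 1)`. The counter of the loop with name `x` is the integer cell `(6, x, 0)`. -/
inductive Cmd where
  | skip
  | setNat (a : ℕ) (i j v : NExpr)
  | setReal (a : ℕ) (i j : NExpr) (v : RExpr)
  | seq (p q : Cmd)
  | ite (b : BExpr) (p q : Cmd)
  | loop (x c : ℕ) (p : Cmd)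

/-- The state after `i` rounds of a loop with name `x` and body `f`. -/
def Mem.rounds (f : Mem → Mem) (x : ℕ) (m : Mem) : ℕ → Mem
  | 0 => m.setN 6 x 0 0
  | i + 1 => (f (Mem.rounds f x m i)).setN 6 x 0 (i + 1)

namespace Cmd

open Classical in
/-- The memory in which a bounded program halts. -/
noncomputable def exec : Cmd → Mem → Mem
  | .skip, m => m
  | .setNat a i j v, m => m.setN a (i.eval m) (j.eval m) (v.eval m)
  | .setReal a i j v, m => m.setR a (i.eval m) (j.eval m) (v.eval m)
  | .seq p q, m => q.exec (p.exec m)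
  | .ite b p q, m => if b.holds m then p.exec m else q.exec m
  | .loop x c p, m => m.rounds p.exec x (c * m.nat 6 0 1)

theorem exec_ite_pos {b : BExpr} {p q : Cmd} {m : Mem} (h : b.holds m) :
    (Cmd.ite b p q).exec m = p.exec m := by simp only [exec, h, if_true]

theorem exec_ite_neg {b : BExpr} {p q : Cmd} {m : Mem} (h : ¬ b.holds m) :
    (Cmd.ite b p q).exec m = q.exec m := by simp only [exec, h, if_false]

/-- Sequential composition of a list of programs. -/
def block : List Cmd → Cmd
  | [] => .skip
  | p :: l => .seq p (block l)

/-- The names of the loops. -/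
def loops : Cmd → List ℕ
  | .seq p q => p.loops ++ q.loops
  | .ite _ p q => p.loops ++ q.loops
  | .loop x _ p => x :: p.loops
  | _ => []

/-- The integer arrays assigned to. -/
def natWrites : Cmd → List ℕ
  | .setNat a _ _ _ => [a]
  | .seq p q => p.natWrites ++ q.natWrites
  | .ite _ p q => p.natWrites ++ q.natWrites
  | .loop _ _ p => p.natWrites
  | _ => []

/-- The real arrays assigned to. -/
def realWrites : Cmd → List ℕ
  | .setReal a _ _ _ => [a]
  | .seq p q => p.realWrites ++ q.realWrites
  | .ite _ p q => p.realWrites ++ q.realWrites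
  | .loop _ _ p => p.realWrites
  | _ => []

/-- The loop counters and the loop bound are never assigned to explicitly, and nested loops have
different names. -/
def ok : Cmd → Bool
  | .setNat a _ _ _ => a != 6
  | .seq p q => p.ok && q.ok
  | .ite _ p q => p.ok && q.ok
  | .loop x _ p => !(p.loops.contains x) && p.ok
  | _ => true

/-- The states `m` and `m'` agree outside the cells that `p` may change. -/
structure Frame (p : Cmd) (m m' : Mem) : Prop where
  nat : ∀ a, a ≠ 6 → p.natWrites.contains a = false → m'.nat a = m.nat a
  real : ∀ a, p.realWrites.contains a = false → m'.real a = m.real a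
  ctr : ∀ x, p.loops.contains x = false → m'.nat 6 x 0 = m.nat 6 x 0
  len : m'.nat 6 0 1 = m.nat 6 0 1

theorem Frame.refl (p : Cmd) (m : Mem) : p.Frame m m :=
  ⟨fun _ _ _ => rfl, fun _ _ => rfl, fun _ _ => rfl, rfl⟩

theorem Frame.trans {p : Cmd} {m m' m'' : Mem} (h : p.Frame m m') (h' : p.Frame m' m'') :
    p.Frame m m'' :=
  ⟨fun a h6 ha => (h'.nat a h6 ha).trans (h.nat a h6 ha),
    fun a ha => (h'.real a ha).trans (h.real a ha),
    fun x hx => (h'.ctr x hx).trans (h.ctr x hx), h'.len.trans h.len⟩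

theorem Frame.mono {p q : Cmd} {m m' : Mem} (h : p.Frame m m')
    (hn : ∀ a, q.natWrites.contains a = false → p.natWrites.contains a = false)
    (hr : ∀ a, q.realWrites.contains a = false → p.realWrites.contains a = false)
    (hl : ∀ x, q.loops.contains x = false → p.loops.contains x = false) : q.Frame m m' :=
  ⟨fun a h6 ha => h.nat a h6 (hn a ha), fun a ha => h.real a (hr a ha),
    fun x hx => h.ctr x (hl x hx), h.len⟩

theorem Frame.setCtr {x c : ℕ} {p : Cmd} (m : Mem) (i : ℕ) :
    (Cmd.loop x c p).Frame m (m.setN 6 x 0 i) := by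
  refine ⟨fun a h6 _ => Mem.setN_nat_ne m h6, fun a _ => rfl, fun y hy => ?_, ?_⟩
  · simp [loops] at hy
    simp [Mem.setN_nat, hy.1]
  · simp [Mem.setN_nat]

theorem Frame.body {x c : ℕ} {p : Cmd} {m m' : Mem} (h : p.Frame m m') :
    (Cmd.loop x c p).Frame m m' := by
  refine h.mono (fun a ha => ha) (fun a ha => ha) (fun y hy => ?_)
  simp [loops] at hy ⊢
  exact hy.2

/-- A bounded program changes nothing outside its frame. -/
theorem exec_frame (p : Cmd) (hp : p.ok = true) (m : Mem) : p.Frame m (p.exec m) := by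
  induction p generalizing m with
  | skip => exact Frame.refl _ _
  | setNat a i j v =>
    simp [ok] at hp
    refine ⟨fun b _ hb => ?_, fun b _ => rfl, fun x _ => ?_, ?_⟩
    · simp [natWrites] at hb
      exact Mem.setN_nat_ne m (by simpa using hb)
    · simp [exec, Mem.setN_nat, Ne.symm hp]
    · simp [exec, Mem.setN_nat, Ne.symm hp]
  | setReal a i j v =>
    refine ⟨fun b _ _ => rfl, fun b hb => ?_, fun x _ => rfl, rfl⟩
    simp [realWrites] at hb
    exact Mem.setR_real_ne m (by simpa using hb)
  | seq p q ihp ihq =>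
    simp [ok] at hp
    refine Frame.trans (m' := p.exec m) ((ihp hp.1 m).mono ?_ ?_ ?_)
      ((ihq hp.2 _).mono ?_ ?_ ?_) <;>
      simp +contextual [natWrites, realWrites, loops]
  | ite b p q ihp ihq =>
    simp [ok] at hp
    by_cases hb : b.holds m
    · simp only [exec, hb, if_true]
      refine (ihp hp.1 m).mono ?_ ?_ ?_ <;> simp +contextual [natWrites, realWrites, loops]
    · simp only [exec, hb, if_false]
      refine (ihq hp.2 m).mono ?_ ?_ ?_ <;> simp +contextual [natWrites, realWrites, loops]
  | loop x c p ih =>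
    simp only [ok, Bool.and_eq_true] at hp
    simp only [exec]
    generalize c * m.nat 6 0 1 = n
    induction n with
    | zero => exact Frame.setCtr m 0
    | succ n ihn => exact (ihn.trans (ih hp.2 _).body).trans (Frame.setCtr _ _)

theorem rounds_frame {x c : ℕ} {p : Cmd} (hp : (Cmd.loop x c p).ok = true) (m : Mem) (i : ℕ) :
    (Cmd.loop x c p).Frame m (m.rounds p.exec x i) := by
  simp only [ok, Bool.and_eq_true] at hp
  induction i with
  | zero => exact Frame.setCtr m 0
  | succ n ihn => exact (ihn.trans (exec_frame p hp.2 _).body).trans (Frame.setCtr _ _)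

theorem rounds_ctr (f : Mem → Mem) (x : ℕ) (m : Mem) (i : ℕ) :
    (m.rounds f x i).nat 6 x 0 = i := by
  cases i <;> simp [Mem.rounds, Mem.setN_nat]

/-- Induction over the rounds of a loop. -/
theorem loop_induction {x c : ℕ} {p : Cmd} (hp : (Cmd.loop x c p).ok = true) (m : Mem)
    (I : ℕ → Mem → Prop) (h0 : I 0 (m.setN 6 x 0 0))
    (hs : ∀ i < c * m.nat 6 0 1, ∀ m', I i m' → m'.nat 6 x 0 = i → (Cmd.loop x c p).Frame m m' →
      I (i + 1) ((p.exec m').setN 6 x 0 (i + 1))) :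
    I (c * m.nat 6 0 1) ((Cmd.loop x c p).exec m) := by
  simp only [exec]
  have : ∀ i ≤ c * m.nat 6 0 1, I i (m.rounds p.exec x i) := by
    intro i
    induction i with
    | zero => exact fun _ => h0
    | succ i ih =>
      exact fun hi => hs i hi _ (ih (by omega)) (rounds_ctr _ _ _ _) (rounds_frame hp m i)
  exact this _ le_rfl

/-- Induction over the rounds of a loop that runs `N` times. -/
theorem loop_one_induction {x : ℕ} {p : Cmd} (hp : (Cmd.loop x 1 p).ok = true) (m : Mem) {N : ℕ}
    (hN : m.nat 6 0 1 = N) (I : ℕ → Mem → Prop) (h0 : I 0 (m.setN 6 x 0 0))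
    (hs : ∀ i < N, ∀ m', I i m' → m'.nat 6 x 0 = i → (Cmd.loop x 1 p).Frame m m' →
      I (i + 1) ((p.exec m').setN 6 x 0 (i + 1))) :
    I N ((Cmd.loop x 1 p).exec m) := by
  have := loop_induction hp m I h0 (by simpa only [one_mul, hN] using hs)
  rwa [one_mul, hN] at this

/-- If a loop body preserves `I` and `G`, and establishes `G` in round `i₀`, then `G` holds after
the loop. -/
theorem loop_reaches {x c : ℕ} {p : Cmd} (hp : (Cmd.loop x c p).ok = true) (m : Mem)
    (I G : Mem → Prop) (hI : I m)
    (hctr : ∀ m' i, I m' → I (m'.setN 6 x 0 i)) (hGctr : ∀ m' i, G m' → G (m'.setN 6 x 0 i))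
    (hbody : ∀ m', I m' → (Cmd.loop x c p).Frame m m' → I (p.exec m') ∧ (G m' → G (p.exec m')))
    (i₀ : ℕ) (hi₀ : i₀ < c * m.nat 6 0 1)
    (hhit : ∀ m', I m' → m'.nat 6 x 0 = i₀ → (Cmd.loop x c p).Frame m m' → G (p.exec m')) :
    I ((Cmd.loop x c p).exec m) ∧ G ((Cmd.loop x c p).exec m) := by
  have := loop_induction hp m (fun i m' => I m' ∧ (i₀ < i → G m'))
    ⟨hctr _ _ hI, fun h => absurd h (Nat.not_lt_zero _)⟩
    (fun i hi m' h hc hF => by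
      refine ⟨hctr _ _ (hbody m' h.1 hF).1, fun hlt => hGctr _ _ ?_⟩
      rcases Nat.lt_succ_iff_lt_or_eq.1 hlt with h1 | h1
      · exact (hbody m' h.1 hF).2 (h.2 h1)
      · exact hhit m' h.1 (hc.trans h1.symm) hF)
  exact ⟨this.1, this.2 hi₀⟩

/-! ### Compilation -/

/-- The expression `c * e`. -/
def natScale (c : ℕ) (e : NExpr) : NExpr :=
  match c with
  | 0 => .const 0
  | c + 1 => .add (natScale c e) e

theorem natScale_eval (c : ℕ) (e : NExpr) (m : Mem) : (natScale c e).eval m = c * e.eval m := by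
  induction c with
  | zero => simp [natScale, NExpr.eval]
  | succ c ih => simp [natScale, NExpr.eval, ih, Nat.succ_mul]

/-- The counter of the loop `x`. -/
abbrev ctr (x : ℕ) : NExpr := .read 6 (.const x) (.const 0)

/-- The loop bound `N`. -/
abbrev len : NExpr := .read 6 (.const 0) (.const 1)

/-- Translation into real RAM programs. -/
def compile : Cmd → Prog
  | .skip => .skip
  | .setNat a i j v => .setNat a i j v
  | .setReal a i j v => .setReal a i j v
  | .seq p q => .seq p.compile q.compile
  | .ite b p q => .ite b p.compile q.compile
  | .loop x c p => .seq (.setNat 6 (.const x) (.const 0) (.const 0))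
      (.while (.natLe (.add (ctr x) (.const 1)) (natScale c len))
        (.seq p.compile (.setNat 6 (.const x) (.const 0) (.add (ctr x) (.const 1)))))

/-- A bound on the number of steps in terms of `N`. -/
noncomputable def cost : Cmd → Polynomial ℕ
  | .seq p q => p.cost + q.cost
  | .ite _ p q => p.cost + q.cost + 1
  | .loop _ c p => Polynomial.C c * Polynomial.X * (p.cost + 2) + 2
  | _ => 1

/-- All running times come from here. A round of a loop costs its body, one test and one update of
the counter, and by the frame property nothing inside the body changes the number of rounds. No
program below needs a running time analysis of its own. -/
theorem compile_run (p : Cmd) (hp : p.ok = true) (m : Mem) :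
    ∃ T, p.compile.Run m T (p.exec m) ∧ T ≤ p.cost.eval (m.nat 6 0 1) := by
  induction p generalizing m with
  | skip => exact ⟨1, .skip m, by simp [cost]⟩
  | setNat a i j v => exact ⟨1, .setNat a i j v m, by simp [cost]⟩
  | setReal a i j v => exact ⟨1, .setReal a i j v m, by simp [cost]⟩
  | seq p q ihp ihq =>
    simp [ok] at hp
    obtain ⟨S, hS, hS'⟩ := ihp hp.1 m
    obtain ⟨T, hT, hT'⟩ := ihq hp.2 (p.exec m)
    rw [(exec_frame p hp.1 m).len] at hT'
    exact ⟨S + T, .seq hS hT, by simp only [cost, Polynomial.eval_add]; omega⟩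
  | ite b p q ihp ihq =>
    simp [ok] at hp
    by_cases hb : b.holds m
    · obtain ⟨S, hS, hS'⟩ := ihp hp.1 m
      simp only [exec, hb, if_true, compile]
      exact ⟨S + 1, .ite_true hb hS, by
        simp only [cost, Polynomial.eval_add, Polynomial.eval_one]; omega⟩
    · obtain ⟨S, hS, hS'⟩ := ihq hp.2 m
      simp only [exec, hb, if_false, compile]
      exact ⟨S + 1, .ite_false hb hS, by
        simp only [cost, Polynomial.eval_add, Polynomial.eval_one]; omega⟩
  | loop x c p ih =>
    have hp' := hp
    simp only [ok, Bool.and_eq_true] at hp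
    set n := c * m.nat 6 0 1 with hn
    set B := p.cost.eval (m.nat 6 0 1) with hB
    -- Induction on the number `d` of rounds that are left; the `+ 1` pays for the final test, which
    -- fails.
    have key : ∀ d i, i + d = n → ∃ T, Prog.Run
        (.while (.natLe (.add (ctr x) (.const 1)) (natScale c len))
          (.seq p.compile (.setNat 6 (.const x) (.const 0) (.add (ctr x) (.const 1)))))
        (m.rounds p.exec x i) T (m.rounds p.exec x n) ∧ T ≤ d * (B + 2) + 1 := by
      intro d
      induction d with
      | zero =>
        intro i hi
        obtain rfl : i = n := by omega
        refine ⟨1, .while_false ?_, by omega⟩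
        simp [BExpr.holds, NExpr.eval, natScale_eval, rounds_ctr, (rounds_frame hp' m n).len, ← hn]
      | succ d ihd =>
        intro i hi
        obtain ⟨T, hT, hT'⟩ := ihd (i + 1) (by omega)
        obtain ⟨S, hS, hS'⟩ := ih hp.2 (m.rounds p.exec x i)
        rw [(rounds_frame hp' m i).len, ← hB] at hS'
        have hstep := Prog.Run.setNat 6 (.const x) (.const 0) (.add (ctr x) (.const 1))
          (p.exec (m.rounds p.exec x i))
        have hc : (p.exec (m.rounds p.exec x i)).nat 6 x 0 = i := by
          rw [(exec_frame p hp.2 _).ctr x (by simpa using hp.1), rounds_ctr]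
        simp only [NExpr.eval, hc] at hstep
        refine ⟨S + 1 + T + 1, .while_true ?_ (.seq hS hstep) hT, ?_⟩
        · simp [BExpr.holds, NExpr.eval, natScale_eval, rounds_ctr, (rounds_frame hp' m i).len,
            ← hn]
          omega
        · rw [Nat.succ_mul]; omega
    obtain ⟨T, hT, hT'⟩ := key n 0 (by omega)
    refine ⟨1 + T, .seq (.setNat 6 (.const x) (.const 0) (.const 0) m) hT, ?_⟩
    simp [cost, ← hn, ← hB]
    omega

/-- Natural coefficients make the polynomial monotone. This is needed because the loop bound is only
at most the size of the instance. -/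
theorem natPolynomial_eval_mono (p : Polynomial ℕ) {a b : ℕ} (h : a ≤ b) :
    p.eval a ≤ p.eval b := by
  induction p using Polynomial.induction_on' with
  | add p q hp hq => simpa using add_le_add hp hq
  | monomial n c => simpa using Nat.mul_le_mul_left c (Nat.pow_le_pow_left h n)

/-! ### Abbreviations -/

/-- An integer variable: the cell `(0, 0)` of an array of its own. -/
abbrev nvar (x : ℕ) : NExpr := .read x (.const 0) (.const 0)

/-- A real variable. -/
abbrev rvar (x : ℕ) : RExpr := .read x (.const 0) (.const 0)

/-- Assignment to an integer variable. -/
abbrev setNV (x : ℕ) (v : NExpr) : Cmd := .setNat x (.const 0) (.const 0) v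

/-- Assignment to a real variable. -/
abbrev setRV (x : ℕ) (v : RExpr) : Cmd := .setReal x (.const 0) (.const 0) v

/-- Cell of a one-dimensional integer array. -/
abbrev nat1 (a : ℕ) (i : NExpr) : NExpr := .read a i (.const 0)

/-- Cell of a one-dimensional real array. -/
abbrev real1 (a : ℕ) (i : NExpr) : RExpr := .read a i (.const 0)

/-- Conditional without alternative. -/
abbrev whenever (b : BExpr) (p : Cmd) : Cmd := .ite b p .skip

/-- Equality of integers. -/
def natEq (x y : NExpr) : BExpr := .and (.natLe x y) (.natLe y x)

/-- Strict inequality of integers. -/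
def natLt (x y : NExpr) : BExpr := .not (.natLe y x)

/-- Strict inequality of reals. -/
def realLt (x y : RExpr) : BExpr := .not (.realLe y x)

/-- Disjunction of tests. -/
def bor (b c : BExpr) : BExpr := .not (.and (.not b) (.not c))

theorem holds_natEq (x y : NExpr) (m : Mem) : (natEq x y).holds m ↔ x.eval m = y.eval m := by
  simp [natEq, BExpr.holds, le_antisymm_iff]

theorem holds_natLt (x y : NExpr) (m : Mem) : (natLt x y).holds m ↔ x.eval m < y.eval m := by
  simp [natLt, BExpr.holds]

theorem holds_realLt (x y : RExpr) (m : Mem) : (realLt x y).holds m ↔ x.eval m < y.eval m := by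
  simp [realLt, BExpr.holds]

theorem holds_bor (b c : BExpr) (m : Mem) : (bor b c).holds m ↔ b.holds m ∨ c.holds m := by
  simp only [bor, BExpr.holds]; tauto

end Cmd

/-! ### The assignment problem -/

namespace Assign
open Cmd

/-- `f` permutes `{0, …, N - 1}`. -/
def IsPerm (N : ℕ) (f : ℕ → ℕ) : Prop :=
  (∀ p < N, f p < N) ∧ ∀ p < N, ∀ q < N, f p = f q → p = q

theorem IsPerm.image {N : ℕ} {f : ℕ → ℕ} (hf : IsPerm N f) :
    (Finset.range N).image f = Finset.range N := by
  apply Finset.eq_of_subset_of_card_le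
  · intro q hq
    obtain ⟨p, hp, rfl⟩ := Finset.mem_image.1 hq
    exact Finset.mem_range.2 (hf.1 p (Finset.mem_range.1 hp))
  · rw [Finset.card_image_of_injOn]
    intro p hp q hq h
    exact hf.2 p (by simpa using hp) q (by simpa using hq) h

theorem IsPerm.surj {N : ℕ} {f : ℕ → ℕ} (hf : IsPerm N f) {q : ℕ} (hq : q < N) :
    ∃ p < N, f p = q := by
  have : q ∈ (Finset.range N).image f := by rw [hf.image]; simpa using hq
  simpa using this

theorem IsPerm.sum_comp {N : ℕ} {f : ℕ → ℕ} (hf : IsPerm N f) (g : ℕ → ℝ) :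
    ∑ p ∈ Finset.range N, g (f p) = ∑ q ∈ Finset.range N, g q := by
  conv_rhs => rw [← hf.image]
  rw [Finset.sum_image]
  intro p hp q hq h
  exact hf.2 p (by simpa using hp) q (by simpa using hq) h

theorem IsPerm.swap {N : ℕ} {f f' : ℕ → ℕ} (hf : IsPerm N f) {r q : ℕ} (hr : r < N) (hq : q < N)
    (h : ∀ p, f' p = if p = q then f r else if p = r then f q else f p) : IsPerm N f' := by
  have key : ∀ p, f' p = f (Equiv.swap r q p) := by
    intro p
    rw [h, Equiv.swap_apply_def]
    split_ifs <;> simp_all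
  have hlt : ∀ p < N, Equiv.swap r q p < N := by
    intro p hp
    rw [Equiv.swap_apply_def]; split_ifs <;> assumption
  refine ⟨fun p hp => ?_, fun p hp p' hp' e => ?_⟩
  · rw [key]; exact hf.1 _ (hlt p hp)
  · rw [key, key] at e
    exact (Equiv.swap r q).injective (hf.2 _ (hlt p hp) _ (hlt p' hp') e)

/-- Weak duality. -/
theorem optimal_of_tight {N : ℕ} {V : ℕ → ℕ → ℝ} {u v : ℕ → ℝ} {f g : ℕ → ℕ}
    (hf : IsPerm N f) (hg : IsPerm N g) (hfeas : ∀ p < N, ∀ q < N, V p q ≤ u p + v q)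
    (htight : ∀ p < N, V p (f p) = u p + v (f p)) :
    ∑ p ∈ Finset.range N, V p (g p) ≤ ∑ p ∈ Finset.range N, V p (f p) := by
  have h1 : ∑ p ∈ Finset.range N, V p (f p) =
      ∑ p ∈ Finset.range N, u p + ∑ q ∈ Finset.range N, v q := by
    rw [← hf.sum_comp v, ← Finset.sum_add_distrib]
    exact Finset.sum_congr rfl fun p hp => htight p (Finset.mem_range.1 hp)
  have h2 : ∑ p ∈ Finset.range N, V p (g p) ≤
      ∑ p ∈ Finset.range N, u p + ∑ q ∈ Finset.range N, v q := by
    rw [← hg.sum_comp v, ← Finset.sum_add_distrib]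
    exact Finset.sum_le_sum fun p hp =>
      hfeas p (Finset.mem_range.1 hp) _ (hg.1 p (Finset.mem_range.1 hp))
  rw [h1]; exact h2

/-! Integer arrays: `10` the current permutation, `11` the reached rows, `12` the parent rows.
Real arrays: `10` the values, `11` and `12` the dual variables of rows and columns.
Integer variables: `30` whether the search is over, `31` whether a pair was found, `32` and `33`
the pair of least slack, `34` scratch, `35` the current row of the augmentation.
Real variables: `30` the least slack, `31` an upper bound on the values. -/

/-- The row `p` is the root of the current search, or has been reached. -/
abbrev inTree (p : NExpr) : BExpr := bor (natEq p (ctr 11)) (natEq (nat1 11 p) (.const 1))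

/-- The slack of row `p` and the column of row `q`. -/
abbrev slackE (p q : NExpr) : RExpr :=
  .sub (.add (real1 11 p) (real1 12 (nat1 10 q))) (.read 10 p (nat1 10 q))

/-- Compare one pair with the best pair found so far. -/
def scanStep : Cmd :=
  whenever
    (.and (.and (inTree (ctr 14)) (.not (natEq (nat1 11 (ctr 15)) (.const 1))))
      (bor (natEq (nvar 31) (.const 0)) (realLt (slackE (ctr 14) (ctr 15)) (rvar 30))))
    (block [setNV 31 (.const 1), setNV 32 (ctr 14), setNV 33 (ctr 15),
      setRV 30 (slackE (ctr 14) (ctr 15))])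

/-- Find the pair of least slack between the tree and the columns outside. -/
def scan : Cmd := .loop 14 1 (.loop 15 1 scanStep)

/-- Change the dual variables of one row, and of its column, by the least slack. -/
def shiftStep : Cmd :=
  block [
    whenever (inTree (ctr 16))
      (.setReal 11 (ctr 16) (.const 0) (.sub (real1 11 (ctr 16)) (rvar 30))),
    whenever (natEq (nat1 11 (ctr 16)) (.const 1))
      (.setReal 12 (nat1 10 (ctr 16)) (.const 0) (.add (real1 12 (nat1 10 (ctr 16))) (rvar 30)))]

/-- Add a new row to the tree, or end the search. -/
def searchStep : Cmd :=
  whenever (natEq (nvar 30) (.const 0)) (block [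
    setNV 31 (.const 0), scan, .loop 16 1 shiftStep,
    .ite (.natLe (ctr 11) (nvar 33)) (setNV 30 (.const 1))
      (block [.setNat 11 (nvar 33) (.const 0) (.const 1),
        .setNat 12 (nvar 33) (.const 0) (nvar 32)])])

/-- Exchange the columns of the root and of row `q`. -/
def exchange (q : NExpr) : Cmd :=
  block [setNV 34 (nat1 10 (ctr 11)), .setNat 10 (ctr 11) (.const 0) (nat1 10 q),
    .setNat 10 q (.const 0) (nvar 34)]

/-- Move a column one step along the tree path to the root. -/
def augmentStep : Cmd :=
  whenever (.not (natEq (nvar 35) (ctr 11)))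
    (block [exchange (nvar 35), setNV 35 (nat1 12 (nvar 35))])

/-- Handle one row. -/
def phase : Cmd :=
  block [.loop 12 1 (.setNat 11 (ctr 12) (.const 0) (.const 0)),
    setNV 30 (.const 0), .loop 13 1 searchStep, exchange (nvar 33), setNV 35 (nvar 32),
    .loop 17 1 augmentStep]

/-- Initial values of one row and one column. -/
def initStep : Cmd :=
  block [.setNat 10 (ctr 10) (.const 0) (ctr 10),
    .setReal 11 (ctr 10) (.const 0) (rvar 31), .setReal 12 (ctr 10) (.const 0) (.const 0)]

/-- The Hungarian method. -/
def hungarian : Cmd := block [.loop 10 1 initStep, .loop 11 1 phase]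

/-- The slack of row `p` and the column of row `q` in the state `m`. -/
def slack (m : Mem) (p q : ℕ) : ℝ :=
  m.real 11 p 0 + m.real 12 (m.nat 10 q 0) 0 - m.real 10 p (m.nat 10 q 0)

/-- Row `p` is in the tree, and the column of row `q` is not. -/
def Leaving (m : Mem) (p q : ℕ) : Prop :=
  (p = m.nat 6 11 0 ∨ m.nat 11 p 0 = 1) ∧ m.nat 11 q 0 ≠ 1

/-- The best pair among those in `S` has been recorded in `m'`. -/
def Scanned (m : Mem) (S : ℕ → ℕ → Prop) (m' : Mem) : Prop :=
  (m'.nat 31 0 0 = 0 ∧ ∀ p q, S p q → ¬ Leaving m p q) ∨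
  (m'.nat 31 0 0 = 1 ∧ Leaving m (m'.nat 32 0 0) (m'.nat 33 0 0) ∧
    m'.nat 32 0 0 < m.nat 6 0 1 ∧ m'.nat 33 0 0 < m.nat 6 0 1 ∧
    m'.real 30 0 0 = slack m (m'.nat 32 0 0) (m'.nat 33 0 0) ∧
    ∀ p q, S p q → Leaving m p q → m'.real 30 0 0 ≤ slack m p q)

/-- The minimum is taken over the pairs scanned so far in lexicographic order. The flag in variable
`31` stands in for an infinite initial minimum. -/
theorem scan_spec (m : Mem) (h0 : m.nat 31 0 0 = 0) :
    Scanned m (fun p q => p < m.nat 6 0 1 ∧ q < m.nat 6 0 1) (scan.exec m) := by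
  refine loop_one_induction (x := 14) (p := .loop 15 1 scanStep) rfl m rfl
    (fun i m' => Scanned m (fun p q => p < i ∧ q < m.nat 6 0 1) m')
    (Or.inl ⟨by simp [Mem.setN_nat, h0], by simp⟩) ?_
  intro i hi m₁ hI hc hF
  have hN : m₁.nat 6 0 1 = m.nat 6 0 1 := hF.len
  have inner := loop_one_induction (x := 15) (p := scanStep) rfl m₁ hN
    (fun j m' => Scanned m (fun p q => (p < i ∧ q < m.nat 6 0 1) ∨ (p = i ∧ q < j)) m')
    ?_ ?_
  · have h2 : ∀ S T m' k, (∀ p q, T p q → S p q) → Scanned m S m' →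
        Scanned m T (m'.setN 6 14 0 k) := by
      intro S T m' k hST h
      rcases h with ⟨h1, h2⟩ | ⟨h1, h2, h3, h4, h5, h6⟩
      · exact Or.inl ⟨by simpa [Mem.setN_nat] using h1, fun p q h => h2 p q (hST p q h)⟩
      · refine Or.inr ?_
        simp only [Mem.setN_nat_ne _ (show 31 ≠ 6 by decide),
          Mem.setN_nat_ne _ (show 32 ≠ 6 by decide), Mem.setN_nat_ne _ (show 33 ≠ 6 by decide),
          Mem.setN_real]
        exact ⟨h1, h2, h3, h4, h5, fun p q h => h6 p q (hST p q h)⟩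
    refine h2 _ _ _ _ ?_ inner
    rintro p q ⟨h3, h4⟩
    rcases Nat.lt_succ_iff_lt_or_eq.1 h3 with h5 | h5
    · exact Or.inl ⟨h5, h4⟩
    · exact Or.inr ⟨h5, h4⟩
  · simpa [Scanned, Mem.setN_nat] using hI
  · intro j hj m₂ hJ hc₂ hF₂
    have e6 : m₂.nat 6 14 0 = i := (hF₂.ctr 14 rfl).trans hc
    have e11 : m₂.nat 6 11 0 = m.nat 6 11 0 := (hF₂.ctr 11 rfl).trans (hF.ctr 11 rfl)
    have eQ : m₂.nat 11 = m.nat 11 := (hF₂.nat 11 (by decide) rfl).trans (hF.nat 11 (by decide) rfl)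
    have eM : m₂.nat 10 = m.nat 10 := (hF₂.nat 10 (by decide) rfl).trans (hF.nat 10 (by decide) rfl)
    have eV : m₂.real 10 = m.real 10 := (hF₂.real 10 rfl).trans (hF.real 10 rfl)
    have eu : m₂.real 11 = m.real 11 := (hF₂.real 11 rfl).trans (hF.real 11 rfl)
    have ev : m₂.real 12 = m.real 12 := (hF₂.real 12 rfl).trans (hF.real 12 rfl)
    rw [scanStep]
    by_cases hb : Leaving m i j ∧ (m₂.nat 31 0 0 = 0 ∨ slack m i j < m₂.real 30 0 0)
    · rw [exec_ite_pos (by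
        simpa [BExpr.holds, holds_natEq, holds_bor, holds_realLt, NExpr.eval, RExpr.eval, Leaving,
          slack, e6, e11, hc₂, eQ, eM, eV, eu, ev] using hb)]
      refine Or.inr ?_
      simp only [exec, block, NExpr.eval, RExpr.eval, Mem.setN_nat, Mem.setR_real, Mem.setN_real,
        Mem.setR_nat]
      simp only [e6, hc₂, eM, eu, ev, eV]
      norm_num
      refine ⟨hb.1, hi, hj, rfl, ?_⟩
      intro p q hS hL
      suffices h : slack m i j ≤ slack m p q by rw [slack] at h; linarith
      have hS' : ((p < i ∧ q < m.nat 6 0 1) ∨ (p = i ∧ q < j)) ∨ (p = i ∧ q = j) := by omega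
      rcases hS' with hS' | ⟨rfl, rfl⟩
      · rcases hJ with ⟨_, h2⟩ | ⟨h1, _, _, _, _, h6⟩
        · exact absurd hL (h2 p q hS')
        · rcases hb.2 with h | h
          · omega
          · exact h.le.trans (h6 p q hS' hL)
      · exact le_rfl
    · rw [exec_ite_neg (by
        simpa [BExpr.holds, holds_natEq, holds_bor, holds_realLt, NExpr.eval, RExpr.eval, Leaving,
          slack, e6, e11, hc₂, eQ, eM, eV, eu, ev] using hb)]
      change Scanned m _ (m₂.setN 6 15 0 (j + 1))
      have h3 : ∀ p q, ((p < i ∧ q < m.nat 6 0 1) ∨ (p = i ∧ q < j + 1)) →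
        ((p < i ∧ q < m.nat 6 0 1) ∨ (p = i ∧ q < j)) ∨ (p = i ∧ q = j) := by intros; omega
      simp only [Scanned, Mem.setN_nat_ne _ (show 31 ≠ 6 by decide),
          Mem.setN_nat_ne _ (show 32 ≠ 6 by decide), Mem.setN_nat_ne _ (show 33 ≠ 6 by decide),
          Mem.setN_real]
      rcases hJ with ⟨h1, h2⟩ | ⟨h1, h2, h4, h5, h6, h7⟩
      · refine Or.inl ⟨h1, fun p q hS hL => ?_⟩
        rcases h3 p q hS with h | ⟨rfl, rfl⟩
        · exact h2 p q h hL
        · exact hb ⟨hL, Or.inl h1⟩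
      · refine Or.inr ⟨h1, h2, h4, h5, h6, fun p q hS hL => ?_⟩
        rcases h3 p q hS with h | ⟨rfl, rfl⟩
        · exact h7 p q h hL
        · exact not_lt.1 fun h => hb ⟨hL, Or.inr h⟩

/-- A column is addressed through the row that owns it, so injectivity of the permutation is what
prevents a column from being changed twice. -/
theorem shift_spec (m : Mem) {N : ℕ} (hN : m.nat 6 0 1 = N)
    (hmu : IsPerm N (fun p => m.nat 10 p 0)) :
    (∀ p < N, ((Cmd.loop 16 1 shiftStep).exec m).real 11 p 0 = m.real 11 p 0 -
      if p = m.nat 6 11 0 ∨ m.nat 11 p 0 = 1 then m.real 30 0 0 else 0) ∧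
    ∀ p < N, ((Cmd.loop 16 1 shiftStep).exec m).real 12 (m.nat 10 p 0) 0 =
      m.real 12 (m.nat 10 p 0) 0 + if m.nat 11 p 0 = 1 then m.real 30 0 0 else 0 := by
  have := loop_one_induction (x := 16) (p := shiftStep) rfl m hN
    (fun i m' => ∀ p < N,
      (m'.real 11 p 0 = m.real 11 p 0 - if p < i then
        (if p = m.nat 6 11 0 ∨ m.nat 11 p 0 = 1 then m.real 30 0 0 else 0) else 0) ∧
      (m'.real 12 (m.nat 10 p 0) 0 = m.real 12 (m.nat 10 p 0) 0 + if p < i then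
        (if m.nat 11 p 0 = 1 then m.real 30 0 0 else 0) else 0))
    (by simp) ?_
  · refine ⟨fun p hp => ?_, fun p hp => ?_⟩
    · have h := (this p hp).1
      rwa [if_pos hp] at h
    · have h := (this p hp).2
      rwa [if_pos hp] at h
  intro i hi m₁ hI hc hF p hp
  have e11 : m₁.nat 6 11 0 = m.nat 6 11 0 := hF.ctr 11 rfl
  have eQ : m₁.nat 11 = m.nat 11 := hF.nat 11 (by decide) rfl
  have eM : m₁.nat 10 = m.nat 10 := hF.nat 10 (by decide) rfl
  have eD : m₁.real 30 = m.real 30 := hF.real 30 rfl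
  obtain ⟨h1, h2⟩ := hI p hp
  have hinj : m.nat 10 p 0 = m.nat 10 i 0 ↔ p = i :=
    ⟨fun h => hmu.2 p hp i hi h, fun h => by rw [h]⟩
  rw [Mem.setN_real]
  have key : ∀ b : Prop, ∀ [Decidable b], ∀ x : ℝ, (if p < i + 1 then if b then x else 0 else 0) =
      (if p < i then if b then x else 0 else 0) + if p = i then if b then x else 0 else 0 := by
    intro b _ x
    rcases lt_trichotomy p i with h | h | h
    · simp [h, h.ne, Nat.lt_succ_of_lt h]
    · simp [h]
    · simp [h.ne', h.not_gt, show ¬ p < i + 1 by omega]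
  rw [key, key, sub_add_eq_sub_sub, ← h1, ← add_assoc, ← h2]
  by_cases hT : i = m.nat 6 11 0 ∨ m.nat 11 i 0 = 1 <;> by_cases hQ : m.nat 11 i 0 = 1 <;>
    by_cases hpi : p = i <;>
    simp [shiftStep, block, exec, holds_bor, holds_natEq, NExpr.eval, RExpr.eval, Mem.setR_real,
      hc, e11, eQ, eM, eD, hQ, hpi, hinj] <;> simp_all [Mem.setR_real]

/-- The state of a search: dual feasibility, tightness of the edges of the processed rows and of
the tree, and the order in which rows have been reached. -/
structure Tree (N r s : ℕ) (V : ℕ → ℕ → ℝ) (mu Q par : ℕ → ℕ) (u v : ℕ → ℝ) (ord : ℕ → ℕ) :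
    Prop where
  feas : ∀ p < N, ∀ q < N, V p q ≤ u p + v q
  tight : ∀ p < r, V p (mu p) = u p + v (mu p)
  reached : ∀ q < N, Q q = 1 → q < r ∧ ord q < s ∧ par q < N ∧
    V (par q) (mu q) = u (par q) + v (mu q) ∧ (par q = r ∨ (Q (par q) = 1 ∧ ord (par q) < ord q))

/-- The slack of an edge drops only from a tree row to an unreached column, by `δ`, and there `δ` is
at most the slack. Between a row outside the tree and a reached column it grows, and elsewhere it is
unchanged. A processed row and its own column are shifted together or not at all, so tight edges
stay tight. -/
theorem Tree.shift {N r s : ℕ} {V : ℕ → ℕ → ℝ} {mu Q par : ℕ → ℕ} {u v : ℕ → ℝ} {ord : ℕ → ℕ}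
    (h : Tree N r s V mu Q par u v ord) (hmu : IsPerm N mu) (hr : r < N) {u' v' : ℕ → ℝ} {δ : ℝ}
    (hu : ∀ p < N, u' p = u p - if p = r ∨ Q p = 1 then δ else 0)
    (hv : ∀ p < N, v' (mu p) = v (mu p) + if Q p = 1 then δ else 0)
    (hδ0 : 0 ≤ δ)
    (hδ : ∀ p < N, ∀ q < N, (p = r ∨ Q p = 1) → Q q ≠ 1 → δ ≤ u p + v (mu q) - V p (mu q)) :
    Tree N r s V mu Q par u' v' ord := by
  have hQr : ∀ p < N, Q p = 1 → p < r := fun p hp hq => (h.reached p hp hq).1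
  refine ⟨fun p hp q hq => ?_, fun p hp => ?_, fun q hq hQ => ?_⟩
  · obtain ⟨q, hq', rfl⟩ := hmu.surj hq
    rw [hu p hp, hv q hq']
    have h1 := h.feas p hp (mu q) hq
    by_cases hT : p = r ∨ Q p = 1 <;> by_cases hQ : Q q = 1 <;> simp only [hT, hQ, if_true, if_false]
    · linarith
    · linarith [hδ p hp q hq' hT hQ]
    · linarith
    · linarith
  · rw [hu p (hp.trans hr), hv p (hp.trans hr), h.tight p hp]
    simp [hp.ne]
  · obtain ⟨h1, h2, h3, h4, h5⟩ := h.reached q hq hQ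
    refine ⟨h1, h2, h3, ?_, h5⟩
    rw [hu _ h3, hv q hq, h4, if_pos hQ, if_pos (h5.imp id And.left)]
    ring

/-- The new row gets the time stamp `s`, later than all earlier ones. Stamps thus decrease from a
row to its parent, which bounds the length of the path to the root. -/
theorem Tree.insert {N r s : ℕ} {V : ℕ → ℕ → ℝ} {mu Q par Q' par' : ℕ → ℕ} {u v : ℕ → ℝ}
    {ord : ℕ → ℕ} (h : Tree N r s V mu Q par u v ord) {a b : ℕ} (ha : a < N) (hb : b < r)
    (hbQ : Q b ≠ 1) (haT : a = r ∨ Q a = 1) (hab : V a (mu b) = u a + v (mu b))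
    (hQ' : ∀ q, Q' q = if q = b then 1 else Q q) (hpar : ∀ q, par' q = if q = b then a else par q) :
    Tree N r (s + 1) V mu Q' par' u v (fun q => if q = b then s else ord q) := by
  refine ⟨h.feas, h.tight, fun q hq hQ => ?_⟩
  by_cases hqb : q = b
  · subst hqb
    simp only [hpar, if_true, hQ']
    refine ⟨hb, by omega, ha, hab, haT.imp id fun h1 => ?_⟩
    have : a ≠ q := fun e => hbQ (e ▸ h1)
    simp [this, h1, (h.reached a ha h1).2.1]
  · rw [hQ', if_neg hqb] at hQ
    obtain ⟨h1, h2, h3, h4, h5⟩ := h.reached q hq hQ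
    simp only [hpar, hqb, if_false, hQ']
    refine ⟨h1, by omega, h3, h4, h5.imp id fun h6 => ?_⟩
    have : par q ≠ b := fun e => hbQ (e ▸ h6.1)
    simpa [this] using h6

/-- The invariant of the search, after `s` rounds. -/
def SearchInv (N r s : ℕ) (V : ℕ → ℕ → ℝ) (mu : ℕ → ℕ) (m : Mem) : Prop :=
  ∃ ord : ℕ → ℕ, Tree N r s V mu (fun q => m.nat 11 q 0) (fun q => m.nat 12 q 0)
    (fun p => m.real 11 p 0) (fun q => m.real 12 q 0) ord ∧
  ((m.nat 30 0 0 = 0 ∧ ((Finset.range N).filter (fun q => m.nat 11 q 0 = 1)).card = s) ∨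
    (m.nat 30 0 0 = 1 ∧ r ≤ m.nat 33 0 0 ∧ m.nat 33 0 0 < N ∧ m.nat 32 0 0 < N ∧
      (m.nat 32 0 0 = r ∨ m.nat 11 (m.nat 32 0 0) 0 = 1) ∧
      V (m.nat 32 0 0) (mu (m.nat 33 0 0)) =
        m.real 11 (m.nat 32 0 0) 0 + m.real 12 (mu (m.nat 33 0 0)) 0))

theorem Tree.mono {N r s s' : ℕ} {V : ℕ → ℕ → ℝ} {mu Q par : ℕ → ℕ} {u v : ℕ → ℝ} {ord : ℕ → ℕ}
    (h : Tree N r s V mu Q par u v ord) (hs : s ≤ s') : Tree N r s' V mu Q par u v ord :=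
  ⟨h.feas, h.tight, fun q hq hQ => by
    obtain ⟨h1, h2, h3⟩ := h.reached q hq hQ
    exact ⟨h1, by omega, h3⟩⟩

/-- The root is never marked as reached, so the pair of the root and its own column is always a
candidate and the scan cannot fail. After the shift the pair found is tight. If its column belongs
to an unprocessed row (possibly the root) the search ends; otherwise the owner joins the tree. -/
theorem searchStep_spec {N r s : ℕ} {V : ℕ → ℕ → ℝ} {mu : ℕ → ℕ} {m : Mem} (hN : m.nat 6 0 1 = N)
    (hr : m.nat 6 11 0 = r) (hrN : r < N) (hmu : IsPerm N mu) (hm : ∀ p, m.nat 10 p 0 = mu p)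
    (hV : ∀ p q, m.real 10 p q = V p q) (hI : SearchInv N r s V mu m) :
    SearchInv N r (s + 1) V mu (searchStep.exec m) := by
  obtain ⟨ord, hT, hD⟩ := hI
  rcases hD with ⟨h30, hcard⟩ | hD
  swap
  · rw [searchStep, exec_ite_neg (by simp [holds_natEq, NExpr.eval, hD.1])]
    exact ⟨ord, hT.mono (Nat.le_succ s), Or.inr hD⟩
  rw [searchStep, exec_ite_pos (by simp [holds_natEq, NExpr.eval, h30])]
  simp only [block, exec.eq_4]
  set m₁ := (setNV 31 (.const 0)).exec m with hm₁
  have F₁ := exec_frame (setNV 31 (.const 0)) rfl m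
  rw [← hm₁] at F₁
  have hsc := scan_spec m₁ (by simp [hm₁, exec, NExpr.eval, Mem.setN_nat])
  have F₂ := exec_frame scan rfl m₁
  set m₂ := scan.exec m₁ with hm₂
  have F₃ := exec_frame (Cmd.loop 16 1 shiftStep) rfl m₂
  have N₂ : m₂.nat 6 0 1 = N := by rw [F₂.len, F₁.len, hN]
  have e10 : m₂.nat 10 = m.nat 10 := (F₂.nat 10 (by decide) rfl).trans (F₁.nat 10 (by decide) rfl)
  have e11 : m₂.nat 11 = m.nat 11 := (F₂.nat 11 (by decide) rfl).trans (F₁.nat 11 (by decide) rfl)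
  have e12 : m₂.nat 12 = m.nat 12 := (F₂.nat 12 (by decide) rfl).trans (F₁.nat 12 (by decide) rfl)
  have er : m₂.nat 6 11 0 = r := by rw [F₂.ctr 11 rfl, F₁.ctr 11 rfl, hr]
  have eu : m₂.real 11 = m.real 11 := (F₂.real 11 rfl).trans (F₁.real 11 rfl)
  have ev : m₂.real 12 = m.real 12 := (F₂.real 12 rfl).trans (F₁.real 12 rfl)
  have hL : ∀ p q, Leaving m₁ p q ↔ (p = r ∨ m.nat 11 p 0 = 1) ∧ m.nat 11 q 0 ≠ 1 := by
    intro p q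
    rw [Leaving, F₁.ctr 11 rfl, hr, F₁.nat 11 (by decide) rfl]
  have hsl : ∀ p q, slack m₁ p q = m.real 11 p 0 + m.real 12 (mu q) 0 - V p (mu q) := by
    intro p q
    rw [slack, F₁.real 11 rfl, F₁.real 12 rfl, F₁.real 10 rfl, F₁.nat 10 (by decide) rfl, hm, hV]
  have hroot : m.nat 11 r 0 ≠ 1 := fun h => lt_irrefl _ (hT.reached r hrN h).1
  rw [Scanned, F₁.len, hN] at hsc
  rcases hsc with ⟨_, hno⟩ | ⟨_, hab, ha, hb, hδ, hmin⟩
  · exact absurd ((hL r r).2 ⟨Or.inl rfl, hroot⟩) (hno r r ⟨hrN, hrN⟩)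
  rw [hL] at hab
  rw [hsl] at hδ
  set a := m₂.nat 32 0 0 with ha'
  set b := m₂.nat 33 0 0 with hb'
  set δ := m₂.real 30 0 0 with hδ'
  have hmin' : ∀ p < N, ∀ q < N, (p = r ∨ m.nat 11 p 0 = 1) → m.nat 11 q 0 ≠ 1 →
      δ ≤ m.real 11 p 0 + m.real 12 (mu q) 0 - V p (mu q) := by
    intro p hp q hq h1 h2
    rw [← hsl]; exact hmin p q ⟨hp, hq⟩ ((hL p q).2 ⟨h1, h2⟩)
  have hδ0 : 0 ≤ δ := by
    rw [hδ]; linarith [hT.feas a ha (mu b) (hmu.1 b hb)]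
  obtain ⟨hu', hv'⟩ := shift_spec m₂ N₂ (by rw [e10]; simpa only [hm] using hmu)
  simp only [e10, e11, er, eu, ev, hm, ← hδ'] at hu' hv'
  set m₃ := (Cmd.loop 16 1 shiftStep).exec m₂ with hm₃
  have f10 : m₃.nat 10 = m.nat 10 := (F₃.nat 10 (by decide) rfl).trans e10
  have f11 : m₃.nat 11 = m.nat 11 := (F₃.nat 11 (by decide) rfl).trans e11
  have f12 : m₃.nat 12 = m.nat 12 := (F₃.nat 12 (by decide) rfl).trans e12
  have f32 : m₃.nat 32 = m₂.nat 32 := F₃.nat 32 (by decide) rfl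
  have f33 : m₃.nat 33 = m₂.nat 33 := F₃.nat 33 (by decide) rfl
  have f30 : m₃.nat 30 = m.nat 30 := ((F₃.nat 30 (by decide) rfl).trans
    (F₂.nat 30 (by decide) rfl)).trans (F₁.nat 30 (by decide) rfl)
  have fr : m₃.nat 6 11 0 = r := (F₃.ctr 11 rfl).trans er
  have hT' := hT.shift hmu hrN (u' := fun p => m₃.real 11 p 0) (v' := fun q => m₃.real 12 q 0)
    hu' hv' hδ0 hmin'
  have hab' : V a (mu b) = m₃.real 11 a 0 + m₃.real 12 (mu b) 0 := by
    rw [hu' a ha, hv' b hb, if_pos hab.1, if_neg hab.2, hδ]; ring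
  by_cases hrb : r ≤ b
  · rw [exec_ite_pos (by simpa [BExpr.holds, NExpr.eval, fr, f33, ← hb'] using hrb)]
    refine ⟨ord, ?_, Or.inr ?_⟩
    · simpa [exec, Mem.setN_nat, NExpr.eval, f11, f12] using hT'.mono (Nat.le_succ s)
    · simp only [exec, NExpr.eval, Mem.setN_nat, Mem.setN_real]
      simpa [f11, f32, f33, ← ha', ← hb'] using ⟨hrb, hb, ha, hab.1, hab'⟩
  · rw [exec_ite_neg (by simpa [BExpr.holds, NExpr.eval, fr, f33, ← hb'] using hrb)]
    push Not at hrb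
    refine ⟨_, hT'.insert ha hrb hab.2 hab.1 hab' ?_ ?_, Or.inl ⟨?_, ?_⟩⟩
    · intro q
      simp [exec, Mem.setN_nat, NExpr.eval, f11, f33, ← hb']
    · intro q
      simp [exec, Mem.setN_nat, NExpr.eval, f12, f33, f32, ← ha', ← hb']
    · simp [exec, Mem.setN_nat, NExpr.eval, f30, h30]
    · rw [← hcard]
      have : ((Finset.range N).filter (fun q => (exec (block [.setNat 11 (nvar 33) (.const 0)
          (.const 1), .setNat 12 (nvar 33) (.const 0) (nvar 32)]) m₃).nat 11 q 0 = 1)) =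
          insert b ((Finset.range N).filter (fun q => m.nat 11 q 0 = 1)) := by
        ext q
        simp only [exec, block, Mem.setN_nat, NExpr.eval, f11, f33, ← hb', Finset.mem_filter,
          Finset.mem_insert, Finset.mem_range]
        by_cases hq : q = b
        · simp [hq, hb]
        · simp [hq]
      exact (congrArg Finset.card this).trans
        (Finset.card_insert_of_notMem (by simp [hab.2]))

/-- The index `q` is evaluated after the scratch variable has been written, and again after the
entry of the root has been overwritten. The hypotheses say that neither write disturbs it. -/
theorem exchange_spec (q : NExpr) (m : Mem) (p : ℕ)
    (hq : ∀ v w, q.eval ((m.setN 34 0 0 v).setN 10 (m.nat 6 11 0) 0 w) = q.eval m)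
    (hq' : ∀ v, q.eval (m.setN 34 0 0 v) = q.eval m) :
    ((exchange q).exec m).nat 10 p 0 = if p = q.eval m then m.nat 10 (m.nat 6 11 0) 0 else
      if p = m.nat 6 11 0 then m.nat 10 (q.eval m) 0 else m.nat 10 p 0 := by
  simp [exchange, block, exec, NExpr.eval, Mem.setN_nat, hq, hq']

/-- The invariant of the augmentation, after `s` rounds. -/
def AugInv (N r s : ℕ) (V : ℕ → ℕ → ℝ) (u v : ℕ → ℝ) (mu₀ Q ord : ℕ → ℕ) (m : Mem) : Prop :=
  IsPerm N (fun p => m.nat 10 p 0) ∧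
  (∀ p < r, V p (m.nat 10 p 0) = u p + v (m.nat 10 p 0)) ∧
  V (m.nat 35 0 0) (m.nat 10 r 0) = u (m.nat 35 0 0) + v (m.nat 10 r 0) ∧
  (m.nat 35 0 0 = r ∨ (m.nat 35 0 0 < N ∧ Q (m.nat 35 0 0) = 1 ∧ ord (m.nat 35 0 0) + s < N ∧
    ∀ q < N, Q q = 1 → ord q ≤ ord (m.nat 35 0 0) → m.nat 10 q 0 = mu₀ q))

/-- During the augmentation the root holds a column that is tight for the current row. An exchange
hands this column over and gives the root the old column of the current row, which is tight for the
parent. Rows with smaller time stamps still own their original columns, so the tightness recorded in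
the tree remains usable. -/
theorem augmentStep_spec {N r s t : ℕ} {V : ℕ → ℕ → ℝ} {u v : ℕ → ℝ} {mu₀ Q par ord : ℕ → ℕ}
    {m : Mem} (hr : m.nat 6 11 0 = r) (hrN : r < N) (hT : Tree N r t V mu₀ Q par u v ord)
    (hpar : ∀ q, m.nat 12 q 0 = par q) (hI : AugInv N r s V u v mu₀ Q ord m) :
    AugInv N r (s + 1) V u v mu₀ Q ord (augmentStep.exec m) := by
  obtain ⟨h1, h2, h3, h4⟩ := hI
  by_cases hc : m.nat 35 0 0 = r
  · rw [augmentStep, exec_ite_neg (by simp [BExpr.holds, holds_natEq, NExpr.eval, hc, hr])]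
    exact ⟨h1, h2, h3, Or.inl hc⟩
  rw [augmentStep, exec_ite_pos (by simp [BExpr.holds, holds_natEq, NExpr.eval, hc, hr])]
  obtain ⟨hcN, hcQ, hcord, hcmu⟩ := h4.resolve_left hc
  set a := m.nat 35 0 0 with ha
  have hmu : ∀ p, ((block [exchange (nvar 35), setNV 35 (nat1 12 (nvar 35))]).exec m).nat 10 p 0 =
      if p = a then m.nat 10 r 0 else if p = r then m.nat 10 a 0 else m.nat 10 p 0 := by
    intro p
    have := exchange_spec (nvar 35) m p (by simp [NExpr.eval, Mem.setN_nat])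
      (by simp [NExpr.eval, Mem.setN_nat])
    simp only [NExpr.eval, hr, ← ha] at this
    rw [← this]
    simp [block, exec, Mem.setN_nat]
  have h35 : ((block [exchange (nvar 35), setNV 35 (nat1 12 (nvar 35))]).exec m).nat 35 0 0 =
      par a := by
    have F := exec_frame (exchange (nvar 35)) rfl m
    simp only [block, exec.eq_4]
    simp [exec, NExpr.eval, Mem.setN_nat, F.nat 12 (by decide) rfl, F.nat 35 (by decide) rfl, hpar,
      ← ha]
  obtain ⟨t1, t2, t3, t4, t5⟩ := hT.reached a hcN hcQ
  have hra : r ≠ a := Ne.symm hc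
  rw [AugInv, h35]
  simp only [hmu]
  refine ⟨?_, ?_, ?_, ?_⟩
  · exact h1.swap hrN hcN (fun p => rfl)
  · intro p hp
    by_cases hpa : p = a
    · simp only [hpa, if_true]; exact h3
    · simp only [hpa, if_false, hp.ne]; exact h2 p hp
  · simp only [hra, if_false, if_true, hcmu a hcN hcQ le_rfl]
    exact t4
  · refine t5.imp id fun t6 => ⟨t3, t6.1, by omega, fun q hq hQ hord => ?_⟩
    have hqa : q ≠ a := fun e => by subst e; omega
    have hqr : q ≠ r := ((hT.reached q hq hQ).1).ne
    rw [if_neg hqa, if_neg hqr]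
    exact hcmu q hq hQ (by omega)

/-- The invariant of the Hungarian method after `r` rows have been processed. -/
def PhaseInv (N r : ℕ) (V : ℕ → ℕ → ℝ) (m : Mem) : Prop :=
  IsPerm N (fun p => m.nat 10 p 0) ∧
  (∀ p < N, ∀ q < N, V p q ≤ m.real 11 p 0 + m.real 12 q 0) ∧
  ∀ p < r, V p (m.nat 10 p 0) = m.real 11 p 0 + m.real 12 (m.nat 10 p 0) 0

/-- Rows from `r` on own columns too, but their edges need not be tight. The phase makes the edge of
row `r` tight at the expense of unprocessed rows only. -/
theorem phase_spec {N r : ℕ} {V : ℕ → ℕ → ℝ} {m : Mem} (hN : m.nat 6 0 1 = N)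
    (hr : m.nat 6 11 0 = r) (hrN : r < N) (hV : ∀ p q, m.real 10 p q = V p q)
    (hI : PhaseInv N r V m) : PhaseInv N (r + 1) V (phase.exec m) := by
  obtain ⟨hperm, hfeas, htight⟩ := hI
  simp only [phase, block, exec.eq_4]
  have F₁ := exec_frame (.loop 12 1 (.setNat 11 (ctr 12) (.const 0) (.const 0))) rfl m
  have hclear := loop_one_induction (x := 12)
    (p := .setNat 11 (ctr 12) (.const 0) (.const 0)) rfl m hN
    (fun i m' => ∀ p < i, m'.nat 11 p 0 = 0) (by simp)
    (fun i hi m' hI' hc hF p hp => by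
      simp only [exec, NExpr.eval, Mem.setN_nat, hc]
      by_cases hpi : p = i
      · simp [hpi]
      · simpa [hpi] using hI' p (by omega))
  set m₁ := (Cmd.loop 12 1 (.setNat 11 (ctr 12) (.const 0) (.const 0))).exec m
  have F₂ := exec_frame (setNV 30 (.const 0)) rfl m₁
  have h30 : ((setNV 30 (.const 0)).exec m₁).nat 30 0 0 = 0 := by
    simp [exec, NExpr.eval, Mem.setN_nat]
  set m₂ := (setNV 30 (.const 0)).exec m₁
  set mu : ℕ → ℕ := fun p => m.nat 10 p 0 with hmu
  have e10 : m₂.nat 10 = m.nat 10 := (F₂.nat 10 (by decide) rfl).trans (F₁.nat 10 (by decide) rfl)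
  have e11 : m₂.nat 11 = m₁.nat 11 := F₂.nat 11 (by decide) rfl
  have N₂ : m₂.nat 6 0 1 = N := by rw [F₂.len, F₁.len, hN]
  have r₂ : m₂.nat 6 11 0 = r := by rw [F₂.ctr 11 rfl, F₁.ctr 11 rfl, hr]
  have v₂ : m₂.real 10 = m.real 10 := (F₂.real 10 rfl).trans (F₁.real 10 rfl)
  have hQ0 : ∀ q < N, m₂.nat 11 q 0 = 0 := fun q hq => by rw [e11]; exact hclear q hq
  have hsearch := loop_one_induction (x := 13) (p := searchStep) rfl m₂ N₂
    (fun s m' => SearchInv N r s V mu m') ?_ ?_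
  rotate_left
  · refine ⟨fun _ => 0, ⟨fun p hp q hq => ?_, fun p hp => ?_, fun q hq hQ => ?_⟩, Or.inl ⟨?_, ?_⟩⟩
    · simpa [F₂.real 11 rfl, F₁.real 11 rfl, F₂.real 12 rfl, F₁.real 12 rfl] using hfeas p hp q hq
    · simpa [F₂.real 11 rfl, F₁.real 11 rfl, F₂.real 12 rfl, F₁.real 12 rfl] using htight p hp
    · simp [Mem.setN_nat, hQ0 q hq] at hQ
    · simpa [Mem.setN_nat] using h30
    · rw [Finset.card_eq_zero, Finset.filter_eq_empty_iff]
      intro q hq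
      simp [Mem.setN_nat, hQ0 q (by simpa using hq)]
  · intro i hi m' hI hc hF
    have := searchStep_spec (m := m') (hF.len.trans N₂) ((hF.ctr 11 rfl).trans r₂) hrN hperm
      (fun p => by rw [hF.nat 10 (by decide) rfl, e10])
      (fun p q => by rw [hF.real 10 rfl, v₂, hV]) hI
    simpa [SearchInv, Mem.setN_nat] using this
  have F₃ := exec_frame (.loop 13 1 searchStep) rfl m₂
  set m₃ := (Cmd.loop 13 1 searchStep).exec m₂
  obtain ⟨ord, hT, hD⟩ := hsearch
  -- All reached rows lie below `r < N`, so there cannot be `N` of them: the search has ended within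
  -- its `N` rounds.
  have hD' := hD.resolve_left (fun h => by
    have hsub : (Finset.range N).filter (fun q => m₃.nat 11 q 0 = 1) ⊆ Finset.range r := by
      intro q hq
      rw [Finset.mem_filter, Finset.mem_range] at hq
      exact Finset.mem_range.2 (hT.reached q hq.1 hq.2).1
    have := Finset.card_le_card hsub
    rw [h.2, Finset.card_range] at this
    omega)
  obtain ⟨_, hrb, hbN, haN, haT, hab⟩ := hD'
  have g10 : m₃.nat 10 = m.nat 10 := (F₃.nat 10 (by decide) rfl).trans e10
  have r₃ : m₃.nat 6 11 0 = r := (F₃.ctr 11 rfl).trans r₂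
  have F₄ := exec_frame (exchange (nvar 33)) rfl m₃
  have hex : ∀ p, ((exchange (nvar 33)).exec m₃).nat 10 p 0 =
      if p = m₃.nat 33 0 0 then mu r else if p = r then mu (m₃.nat 33 0 0) else mu p := by
    intro p
    have := exchange_spec (nvar 33) m₃ p (by simp [NExpr.eval, Mem.setN_nat])
      (by simp [NExpr.eval, Mem.setN_nat])
    simpa only [NExpr.eval, r₃, g10] using this
  set m₄ := (exchange (nvar 33)).exec m₃
  have F₅ := exec_frame (setNV 35 (nvar 32)) rfl m₄
  have h35 : ((setNV 35 (nvar 32)).exec m₄).nat 35 0 0 = m₃.nat 32 0 0 := by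
    simp [exec, NExpr.eval, Mem.setN_nat, F₄.nat 32 (by decide) rfl]
  set m₅ := (setNV 35 (nvar 32)).exec m₄
  have k10 : ∀ p, m₅.nat 10 p 0 = if p = m₃.nat 33 0 0 then mu r else
      if p = r then mu (m₃.nat 33 0 0) else mu p := by
    intro p; rw [F₅.nat 10 (by decide) rfl]; exact hex p
  have N₅ : m₅.nat 6 0 1 = N := by rw [F₅.len, F₄.len, F₃.len, N₂]
  have r₅ : m₅.nat 6 11 0 = r := by rw [F₅.ctr 11 rfl, F₄.ctr 11 rfl, r₃]
  have p₅ : m₅.nat 12 = m₃.nat 12 := (F₅.nat 12 (by decide) rfl).trans (F₄.nat 12 (by decide) rfl)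
  have haug := loop_one_induction (x := 17) (p := augmentStep) rfl m₅ N₅
    (fun s m' => AugInv N r s V (fun p => m₃.real 11 p 0) (fun q => m₃.real 12 q 0) mu
      (fun q => m₃.nat 11 q 0) ord m') ?_ ?_
  rotate_left
  · simp only [AugInv, Mem.setN_nat_ne _ (show 10 ≠ 6 by decide),
      Mem.setN_nat_ne _ (show 35 ≠ 6 by decide), k10, h35]
    refine ⟨hperm.swap hrN hbN (fun p => rfl), fun p hp => ?_, ?_, ?_⟩
    · rw [if_neg (by omega), if_neg hp.ne]; exact hT.tight p hp
    · have e : (if r = m₃.nat 33 0 0 then mu r else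
          if True then mu (m₃.nat 33 0 0) else mu r) = mu (m₃.nat 33 0 0) := by
        by_cases h : r = m₃.nat 33 0 0
        · rw [if_pos h, ← h]
        · rw [if_neg h, if_pos trivial]
      rw [e]
      exact hab
    · refine haT.imp id fun h => ⟨haN, h, (hT.reached _ haN h).2.1, fun q hq hQ _ => ?_⟩
      have := (hT.reached q hq hQ).1
      rw [if_neg (by omega), if_neg this.ne]
  · intro i hi m' hI hc hF
    have := augmentStep_spec (m := m') ((hF.ctr 11 rfl).trans r₅) hrN hT
      (fun q => by rw [hF.nat 12 (by decide) rfl, p₅]) hI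
    simpa [AugInv, Mem.setN_nat] using this
  have F₆ := exec_frame (.loop 17 1 augmentStep) rfl m₅
  set m₆ := (Cmd.loop 17 1 augmentStep).exec m₅
  obtain ⟨a1, a2, a3, a4⟩ := haug
  -- Each round lowers the time stamp of the current row; after `N` rounds `ord + N < N` is absurd,
  -- so the path has arrived at the root.
  have hcur : m₆.nat 35 0 0 = r := a4.resolve_right (fun h => by omega)
  have u₆ : m₆.real 11 = m₃.real 11 :=
    ((F₆.real 11 rfl).trans (F₅.real 11 rfl)).trans (F₄.real 11 rfl)
  have v₆ : m₆.real 12 = m₃.real 12 :=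
    ((F₆.real 12 rfl).trans (F₅.real 12 rfl)).trans (F₄.real 12 rfl)
  change PhaseInv N (r + 1) V m₆
  rw [PhaseInv, u₆, v₆]
  refine ⟨a1, hT.feas, fun p hp => ?_⟩
  rcases Nat.lt_succ_iff_lt_or_eq.1 hp with h | rfl
  · exact a2 p h
  · rw [hcur] at a3; exact a3

/-- The Hungarian method finds a permutation of maximum value. -/
theorem hungarian_spec {m : Mem} {N : ℕ} (hN : m.nat 6 0 1 = N)
    (hB : ∀ p < N, ∀ q < N, m.real 10 p q ≤ m.real 31 0 0) :
    IsPerm N (fun p => (hungarian.exec m).nat 10 p 0) ∧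
    ∀ f, IsPerm N f → ∑ p ∈ Finset.range N, m.real 10 p (f p) ≤
      ∑ p ∈ Finset.range N, m.real 10 p ((hungarian.exec m).nat 10 p 0) := by
  have F₁ := exec_frame (.loop 10 1 initStep) rfl m
  have hinit := loop_one_induction (x := 10) (p := initStep) rfl m hN
    (fun i m' => ∀ p < i, m'.nat 10 p 0 = p ∧ m'.real 11 p 0 = m.real 31 0 0 ∧
      m'.real 12 p 0 = 0) (by simp)
    (fun i hi m' hI hc hF p hp => by
      have e31 : m'.real 31 = m.real 31 := hF.real 31 rfl
      by_cases hpi : p = i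
      · simp [initStep, exec, block, NExpr.eval, RExpr.eval, Mem.setN_nat, Mem.setR_real, hc, hpi,
          e31]
      · simpa [initStep, exec, block, NExpr.eval, RExpr.eval, Mem.setN_nat, Mem.setR_real, hc, hpi,
          e31] using hI p (by omega))
  set m₁ := (Cmd.loop 10 1 initStep).exec m with hm₁
  have hph := loop_one_induction (x := 11) (p := phase) rfl m₁ (F₁.len.trans hN)
    (fun r m' => PhaseInv N r (m.real 10) m') ?_ ?_
  · have he : hungarian.exec m = (Cmd.loop 11 1 phase).exec m₁ := rfl
    rw [he]
    refine ⟨hph.1, fun f hf => ?_⟩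
    exact optimal_of_tight hph.1 hf hph.2.1 hph.2.2
  · simp only [PhaseInv, Mem.setN_nat_ne _ (show 10 ≠ 6 by decide), Mem.setN_real]
    refine ⟨⟨fun p hp => ?_, fun p hp q hq h => ?_⟩, fun p hp q hq => ?_, by simp⟩
    · simpa only [(hinit p hp).1] using hp
    · simpa only [(hinit p hp).1, (hinit q hq).1] using h
    · rw [(hinit p hp).2.1, (hinit q hq).2.2, add_zero]; exact hB p hp q hq
  · intro i hi m' hI hc hF
    have := phase_spec (m := m') (hF.len.trans (F₁.len.trans hN)) hc hi
      (fun p q => by rw [hF.real 10 rfl, F₁.real 10 rfl]) hI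
    simpa [PhaseInv, Mem.setN_nat] using this

end Assign

/-! ### Fractional assignment with a budget -/

open Cmd Assign

/-- An assignment problem. The type of a pair is `0` if it is forbidden, `1` if it is counted
whenever it is used, `2` if it may be counted when it is used, and `3` if it is never counted. -/
structure Table where
  N : ℕ
  n₁ : ℕ
  ty : ℕ → ℕ → ℕ
  r : ℕ → ℕ → ℝ
  w : ℕ → ℕ → ℝ
  c : ℕ → ℝ
  v : ℝ
  C : ℝ

namespace Table

/-- The table stored in the memory: integer array `20` and variable `45`, real arrays `20`, `21`,
`22` and variables `40`, `41`. -/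
def ofMem (m : Mem) : Table where
  N := m.nat 6 0 1
  n₁ := m.nat 45 0 0
  ty := m.nat 20
  r := m.real 20
  w := m.real 21
  c := fun p => m.real 22 p 0
  v := m.real 40 0 0
  C := m.real 41 0 0

theorem ofMem_frame {p : Cmd} {m m' : Mem} (h : p.Frame m m')
    (h1 : p.natWrites.contains 20 = false) (h2 : p.natWrites.contains 45 = false)
    (h3 : p.realWrites.contains 20 = false) (h4 : p.realWrites.contains 21 = false)
    (h5 : p.realWrites.contains 22 = false) (h6 : p.realWrites.contains 40 = false)
    (h7 : p.realWrites.contains 41 = false) : ofMem m' = ofMem m := by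
  simp only [ofMem, h.len, h.nat 20 (by decide) h1, h.nat 45 (by decide) h2, h.real 20 h3,
    h.real 21 h4, h.real 22 h5, h.real 40 h6, h.real 41 h7]

variable (T : Table)

/-- A permutation that avoids the forbidden pairs. -/
def Allowed (f : ℕ → ℕ) : Prop := IsPerm T.N f ∧ ∀ p < T.N, T.ty p (f p) ≠ 0

/-- A permutation with a set of counted rows that obeys the budget. -/
structure IsSol (f : ℕ → ℕ) (S : Finset ℕ) : Prop where
  allowed : T.Allowed f
  forced : ∀ p < T.N, T.ty p (f p) = 1 → p ∈ S
  counted : ∀ p ∈ S, p < T.N ∧ (T.ty p (f p) = 1 ∨ T.ty p (f p) = 2)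
  budget : ∑ p ∈ S, (if T.ty p (f p) = 2 then T.c p else 0) ≤ T.C

/-- The objective. -/
noncomputable def value (f : ℕ → ℕ) (S : Finset ℕ) : ℝ :=
  (∑ p ∈ S, T.r p (f p) * T.w p (f p)) / (T.v + ∑ p ∈ S, T.w p (f p))

/-- Nonnegativity, and independence of the rows below `n₁` from the other rows. -/
structure Valid : Prop where
  v_pos : 0 < T.v
  C_nonneg : 0 ≤ T.C
  r_nonneg : ∀ p < T.N, ∀ q < T.N, 0 ≤ T.r p q
  w_nonneg : ∀ p < T.N, ∀ q < T.N, 0 ≤ T.w p q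
  c_nonneg : ∀ p < T.N, 0 ≤ T.c p
  c_le : ∀ p < T.N, ∀ q < T.N, T.ty p q = 2 → T.c p ≤ T.C
  low : ∀ p < T.n₁, ∀ q < T.N, T.ty p q ≠ 2
  high : ∀ p < T.N, T.n₁ ≤ p → ∀ q < T.N, T.ty p q ≠ 1
  mix : ∀ f g, T.Allowed f → T.Allowed g → T.Allowed (fun p => if p < T.n₁ then f p else g p)

/-- The gain of a pair over the price `z` per unit of weight. -/
def gain (z : ℝ) (p q : ℕ) : ℝ := (T.r p q - z) * T.w p q

open Classical in
/-- The Lagrangian value of a pair; the pairs of type `2` are ignored if `¬ b`. -/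
noncomputable def val (z lam : ℝ) (b : Prop) (p q : ℕ) : ℝ :=
  if T.ty p q = 1 then T.gain z p q
  else if T.ty p q = 2 ∧ b ∧ 0 < T.gain z p q - lam * T.c p then T.gain z p q - lam * T.c p
  else 0

variable {T}

theorem value_nonneg (hT : T.Valid) {f : ℕ → ℕ} {S : Finset ℕ} (h : T.IsSol f S) :
    0 ≤ T.value f S := by
  have hlt : ∀ p ∈ S, p < T.N ∧ f p < T.N := fun p hp =>
    ⟨(h.counted p hp).1, h.allowed.1.1 p (h.counted p hp).1⟩
  refine div_nonneg (Finset.sum_nonneg fun p hp => mul_nonneg ?_ ?_) (add_nonneg hT.v_pos.le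
    (Finset.sum_nonneg fun p hp => ?_))
  · exact hT.r_nonneg p (hlt p hp).1 _ (hlt p hp).2
  · exact hT.w_nonneg p (hlt p hp).1 _ (hlt p hp).2
  · exact hT.w_nonneg p (hlt p hp).1 _ (hlt p hp).2

open Classical in
/-- The rows of type `2` with positive Lagrangian value. -/
noncomputable def positive (T : Table) (z lam : ℝ) (f : ℕ → ℕ) : Finset ℕ :=
  (Finset.range T.N).filter fun p => T.ty p (f p) = 2 ∧ 0 < T.val z lam True p (f p)

/-- The rows of type `1`. -/
def fixedRows (T : Table) (f : ℕ → ℕ) : Finset ℕ :=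
  (Finset.range T.N).filter fun p => T.ty p (f p) = 1

theorem sum_val_false {z lam : ℝ} {f : ℕ → ℕ} :
    ∑ p ∈ Finset.range T.N, T.val z lam False p (f p) = ∑ p ∈ T.fixedRows f, T.gain z p (f p) := by
  rw [fixedRows, Finset.sum_filter]
  refine Finset.sum_congr rfl fun p _ => ?_
  simp [val]

theorem val_nonneg_of_ne {z lam : ℝ} {b : Prop} {p q : ℕ} (h : T.ty p q ≠ 1) :
    0 ≤ T.val z lam b p q := by
  rw [val, if_neg h]
  split_ifs with h1
  · exact h1.2.2.le
  · exact le_rfl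

theorem positive_iff {z lam : ℝ} {p q : ℕ} (h : T.ty p q = 2) :
    0 < T.val z lam True p q ↔ lam * T.c p < T.gain z p q := by
  simp only [val, h]
  norm_num
  split_ifs with h1
  · simp [h1]
  · simp [h1]

/-- Optional rows whose reduced gain is not positive contribute `0`, so the relaxed optimum decides
by itself which optional rows are counted. -/
theorem sum_val_true {z lam : ℝ} {f : ℕ → ℕ} :
    ∑ p ∈ Finset.range T.N, T.val z lam True p (f p) = ∑ p ∈ T.fixedRows f, T.gain z p (f p) +
      ∑ p ∈ T.positive z lam f, (T.gain z p (f p) - lam * T.c p) := by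
  classical
  rw [fixedRows, Finset.sum_filter, positive, Finset.sum_filter, ← Finset.sum_add_distrib]
  refine Finset.sum_congr rfl fun p _ => ?_
  by_cases h1 : T.ty p (f p) = 1
  · simp [val, h1]
  · by_cases h2 : T.ty p (f p) = 2
    · have := positive_iff (z := z) (lam := lam) h2
      simp only [h2, true_and, this]
      simp [val, h2]
    · simp [val, h1, h2]

/-- The main estimate. `μ₀` is optimal when the pairs of type `2` are ignored, `μ` is optimal for
the Lagrangian, and `K` is the set of kept rows of type `2`. -/
theorem le_value_of_optimal (hT : T.Valid) {z lam τ : ℝ} (hz : 0 < z) {μ₀ μ : ℕ → ℕ}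
    (h₀ : T.Allowed μ₀) (hμ : T.Allowed μ)
    (hopt₀ : ∀ f, T.Allowed f → ∑ p ∈ Finset.range T.N, T.val z 0 False p (f p) ≤
      ∑ p ∈ Finset.range T.N, T.val z 0 False p (μ₀ p))
    (hopt : ∀ f, T.Allowed f → ∑ p ∈ Finset.range T.N, T.val z lam True p (f p) ≤
      ∑ p ∈ Finset.range T.N, T.val z lam True p (μ p))
    (hτ : τ = z * T.v - ∑ p ∈ Finset.range T.N, T.val z 0 False p (μ₀ p))
    (hlam : lam = if τ ≤ 0 then 0 else 2 * τ / T.C)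
    {K : Finset ℕ} (hK : K = T.positive z lam μ ∨ ∃ x, T.C < ∑ p ∈ (T.positive z lam μ).filter
      (fun p => p ≤ x), T.c p ∧ ∑ p ∈ (T.positive z lam μ).filter (fun p => p ≤ x),
        T.gain z p (μ p) ≤ 2 * ∑ p ∈ K, T.gain z p (μ p))
    (hKsub : K ⊆ T.positive z lam μ)
    {f : ℕ → ℕ} {S : Finset ℕ} (hS : T.IsSol f S)
    (hzS : 3 * z ≤ T.value f S ∨ (T.C = 0 ∧ z ≤ T.value f S)) :
    z ≤ T.value μ (T.fixedRows μ ∪ K) := by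
  classical
  have hlam0 : 0 ≤ lam := by
    rw [hlam]; split_ifs with h
    · exact le_rfl
    · exact div_nonneg (by linarith) hT.C_nonneg
  have hposc : ∀ p ∈ T.positive z lam μ,
      p < T.N ∧ T.ty p (μ p) = 2 ∧ lam * T.c p < T.gain z p (μ p) := by
    intro p hp
    simp only [positive, Finset.mem_filter, Finset.mem_range] at hp
    exact ⟨hp.1, hp.2.1, (positive_iff hp.2.1).1 hp.2.2⟩
  have hlt : ∀ p ∈ S, p < T.N ∧ f p < T.N := fun p hp =>
    ⟨(hS.counted p hp).1, hS.allowed.1.1 p (hS.counted p hp).1⟩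
  set s := ∑ p ∈ Finset.range T.N, T.val z 0 False p (μ₀ p) with hs
  -- the fixed rows of `μ` are as good as those of `μ₀`
  have hfix : s ≤ ∑ p ∈ T.fixedRows μ, T.gain z p (μ p) := by
    -- Compare `μ` with the permutation that takes its rows below `n₁` from `μ₀`. The other rows
    -- contribute the same to both, and the rows below `n₁` have no pairs of type `2`, so penalties
    -- play no role in the difference.
    have h1 := hopt _ (hT.mix μ₀ μ h₀ hμ)
    have h2 : ∑ p ∈ Finset.range T.N, (T.val z lam True p (μ p) -
        T.val z lam True p (if p < T.n₁ then μ₀ p else μ p)) = ∑ p ∈ Finset.range T.N,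
        (T.val z 0 False p (μ p) - T.val z 0 False p (μ₀ p)) := by
      refine Finset.sum_congr rfl fun p hp => ?_
      rw [Finset.mem_range] at hp
      by_cases hp1 : p < T.n₁
      · have a1 := hT.low p hp1 (μ p) (hμ.1.1 p hp)
        have a2 := hT.low p hp1 (μ₀ p) (h₀.1.1 p hp)
        simp [val, hp1, a1, a2]
      · have a1 := hT.high p hp (by omega) (μ p) (hμ.1.1 p hp)
        have a2 := hT.high p hp (by omega) (μ₀ p) (h₀.1.1 p hp)
        simp [val, hp1, a1, a2]
    rw [Finset.sum_sub_distrib, Finset.sum_sub_distrib] at h2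
    rw [← sum_val_false (lam := 0)]
    linarith
  -- the reference solution
  set A := ∑ p ∈ S, T.r p (f p) * T.w p (f p) with hA
  set W := ∑ p ∈ S, T.w p (f p) with hW
  have hW0 : 0 ≤ W := Finset.sum_nonneg fun p hp => hT.w_nonneg p (hlt p hp).1 _ (hlt p hp).2
  have hD : 0 < T.v + W := by linarith [hT.v_pos]
  have hgS : ∑ p ∈ S, T.gain z p (f p) = A - z * W := by
    rw [hA, hW, Finset.mul_sum, ← Finset.sum_sub_distrib]
    exact Finset.sum_congr rfl fun p _ => by rw [gain]; ring
  -- Revenues are nonnegative, so each forced pair of the reference solution gains at least `-z`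
  -- times its weight, and `μ₀` does at least as well as these pairs together.
  have hτle : τ ≤ z * (T.v + W) := by
    have h1 := hopt₀ f hS.allowed
    rw [sum_val_false] at h1
    have h2 : -(z * W) ≤ ∑ p ∈ T.fixedRows f, T.gain z p (f p) := by
      have h3 : ∑ p ∈ T.fixedRows f, T.w p (f p) ≤ W := by
        refine Finset.sum_le_sum_of_subset_of_nonneg ?_ ?_
        · intro p hp
          rw [fixedRows, Finset.mem_filter, Finset.mem_range] at hp
          exact hS.forced p hp.1 hp.2
        · intro p hp _
          exact hT.w_nonneg p (hlt p hp).1 _ (hlt p hp).2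
      have h4 : -(z * ∑ p ∈ T.fixedRows f, T.w p (f p)) ≤
          ∑ p ∈ T.fixedRows f, T.gain z p (f p) := by
        rw [Finset.mul_sum, ← Finset.sum_neg_distrib]
        refine Finset.sum_le_sum fun p hp => ?_
        rw [fixedRows, Finset.mem_filter, Finset.mem_range] at hp
        have a1 := hT.r_nonneg p hp.1 _ (hS.allowed.1.1 p hp.1)
        have a2 := hT.w_nonneg p hp.1 _ (hS.allowed.1.1 p hp.1)
        rw [gain]; nlinarith [mul_nonneg a1 a2]
      nlinarith
    rw [hτ]; nlinarith
  -- The reference solution obeys the budget, so it pays at most `lam * C`. The rows it does not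
  -- count have nonnegative value, since all its forced rows are counted.
  have href : A - z * W - lam * T.C ≤ ∑ p ∈ Finset.range T.N, T.val z lam True p (μ p) := by
    refine le_trans ?_ (hopt f hS.allowed)
    have h1 : ∑ p ∈ S, (T.gain z p (f p) - lam * (if T.ty p (f p) = 2 then T.c p else 0)) ≤
        ∑ p ∈ S, T.val z lam True p (f p) := by
      refine Finset.sum_le_sum fun p hp => ?_
      rcases (hS.counted p hp).2 with h | h
      · simp [val, h]
      · simp only [val, h]
        norm_num
        split_ifs with h5
        · linarith
        · linarith
    have h2 : ∑ p ∈ S, T.val z lam True p (f p) ≤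
        ∑ p ∈ Finset.range T.N, T.val z lam True p (f p) := by
      refine Finset.sum_le_sum_of_subset_of_nonneg ?_ ?_
      · intro p hp; exact Finset.mem_range.2 (hlt p hp).1
      · intro p hp hpS
        exact val_nonneg_of_ne fun h => hpS (hS.forced p (Finset.mem_range.1 hp) h)
    rw [Finset.sum_sub_distrib, hgS, ← Finset.mul_sum] at h1
    have h3 := mul_le_mul_of_nonneg_left hS.budget hlam0
    linarith
  -- it remains to estimate the total gain
  have hdisj : Disjoint (T.fixedRows μ) K := by
    rw [Finset.disjoint_left]
    intro p hp hpK
    have h1 := (hposc p (hKsub hpK)).2.1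
    rw [fixedRows, Finset.mem_filter] at hp
    omega
  suffices hmain : z * T.v ≤ ∑ p ∈ T.fixedRows μ, T.gain z p (μ p) + ∑ p ∈ K, T.gain z p (μ p) by
    rw [← Finset.sum_union hdisj] at hmain
    have hg : ∑ p ∈ T.fixedRows μ ∪ K, T.gain z p (μ p) =
        ∑ p ∈ T.fixedRows μ ∪ K, T.r p (μ p) * T.w p (μ p) -
        z * ∑ p ∈ T.fixedRows μ ∪ K, T.w p (μ p) := by
      rw [Finset.mul_sum, ← Finset.sum_sub_distrib]
      exact Finset.sum_congr rfl fun p _ => by rw [gain]; ring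
    have hw : 0 ≤ ∑ p ∈ T.fixedRows μ ∪ K, T.w p (μ p) := by
      refine Finset.sum_nonneg fun p hp => ?_
      have hpN : p < T.N := by
        rcases Finset.mem_union.1 hp with h | h
        · rw [fixedRows, Finset.mem_filter, Finset.mem_range] at h; exact h.1
        · exact (hposc p (hKsub h)).1
      exact hT.w_nonneg p hpN _ (hμ.1.1 p hpN)
    rw [value, le_div_iff₀ (by linarith [hT.v_pos])]
    linarith
  rcases hK with rfl | ⟨x, hx1, hx2⟩
  -- Everything fits. The total gain is at least the relaxed optimum, hence at least `A - z * W -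
  -- lam * C`. Here `A ≥ 3 * z * (v + W)` and `lam * C ≤ 2 * z * (v + W)`, which leaves `z * v`; the
  -- constant `3` comes from this balance.
  · have h1 : ∑ p ∈ T.positive z lam μ, (T.gain z p (μ p) - lam * T.c p) ≤
        ∑ p ∈ T.positive z lam μ, T.gain z p (μ p) := by
      refine Finset.sum_le_sum fun p hp => ?_
      have := mul_nonneg hlam0 (hT.c_nonneg p (hposc p hp).1)
      linarith
    rw [sum_val_true] at href
    suffices lam * T.C ≤ A - z * (T.v + W) by linarith
    rcases hzS with h | ⟨hC, h⟩
    · rw [value, le_div_iff₀ hD] at h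
      have h2 : lam * T.C ≤ 2 * (z * (T.v + W)) := by
        rw [hlam]; split_ifs with h3
        · rw [zero_mul]; positivity
        · by_cases hC : T.C = 0
          · rw [hC, mul_zero]; positivity
          · rw [div_mul_cancel₀ _ hC]; linarith
      linarith
    · rw [value, le_div_iff₀ hD] at h
      rw [hC, mul_zero]; linarith
  -- The budget overflows. Each row of the prefix gains more than `lam` times its cost, so the
  -- prefix gains at least `lam * C ≥ 2 * τ`. `K` keeps at least half of this, and the fixed rows
  -- supply the remaining `z * v - τ`. With `C = 0` the costs of optional pairs vanish and no
  -- overflow can occur.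
  · have hC : T.C ≠ 0 := by
      intro hC
      have : ∑ p ∈ (T.positive z lam μ).filter (fun p => p ≤ x), T.c p ≤ 0 := by
        refine Finset.sum_nonpos fun p hp => ?_
        have h1 := hposc p (Finset.mem_filter.1 hp).1
        have := hT.c_le p h1.1 _ (hμ.1.1 p h1.1) h1.2.1
        linarith
      linarith
    have h1 : lam * ∑ p ∈ (T.positive z lam μ).filter (fun p => p ≤ x), T.c p ≤
        ∑ p ∈ (T.positive z lam μ).filter (fun p => p ≤ x), T.gain z p (μ p) := by
      rw [Finset.mul_sum]
      exact Finset.sum_le_sum fun p hp => (hposc p (Finset.mem_filter.1 hp).1).2.2.le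
    have h2 := mul_le_mul_of_nonneg_left hx1.le hlam0
    have h3 : 2 * τ ≤ lam * T.C := by
      rw [hlam]; split_ifs with h4
      · linarith
      · rw [div_mul_cancel₀ _ hC]
    linarith

end Table

/-! ### Solving the Lagrangian relaxation -/

namespace Table

/-! Real variables: `42` the price `z`, `43` the multiplier `lam`, `44` a bound on the values, `45`
the optimum without pairs of type `2`, `46` the value of `τ`, `47` the cost and `48` the gain of the
rows kept so far, `49` and `50` the numerator and the denominator of the objective, `51` the best
objective so far. Integer variables: `40` whether pairs of type `2` are used, `41` and `42` the
range of the kept rows, `43` whether the budget was exceeded, `44` whether a solution was found.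
Integer arrays: `21` the counted rows, `22` and `23` the best permutation and its counted rows. -/

/-- The gain of the pair `(p, q)`. -/
abbrev gainE (p q : NExpr) : RExpr := .mul (.sub (.read 20 p q) (rvar 42)) (.read 21 p q)

/-- The Lagrangian value of the pair `(p, q)` of type `2`. -/
abbrev reducedE (p q : NExpr) : RExpr := .sub (gainE p q) (.mul (rvar 43) (real1 22 p))

/-- Compute the value of one pair. -/
def fillStep : Cmd :=
  block [
    .ite (natEq (.read 20 (ctr 20) (ctr 21)) (.const 1))
      (.setReal 10 (ctr 20) (ctr 21) (gainE (ctr 20) (ctr 21)))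
      (.ite (.and (natEq (.read 20 (ctr 20) (ctr 21)) (.const 2)) (.and
          (natEq (nvar 40) (.const 1)) (realLt (.const 0) (reducedE (ctr 20) (ctr 21)))))
        (.setReal 10 (ctr 20) (ctr 21) (reducedE (ctr 20) (ctr 21)))
        (.setReal 10 (ctr 20) (ctr 21) (.const 0))),
    setRV 44 (.add (rvar 44) (.add (.mul (.read 10 (ctr 20) (ctr 21)) (.read 10 (ctr 20) (ctr 21)))
      (.const 1)))]

/-- Give a forbidden pair a very negative value. -/
def forbidStep : Cmd :=
  whenever (natEq (.read 20 (ctr 22) (ctr 23)) (.const 0))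
    (.setReal 10 (ctr 22) (ctr 23) (.sub (.const 0) (rvar 31)))

/-- Find a best permutation without forbidden pairs. -/
def solve : Cmd :=
  block [setRV 44 (.const 0), .loop 20 1 (.loop 21 1 fillStep),
    setRV 31 (.add (.add (rvar 44) (rvar 44)) (.const 1)),
    .loop 22 1 (.loop 23 1 forbidStep), hungarian]

theorem fillStep_spec (m : Mem) (p q : ℕ) (hp : m.nat 6 20 0 = p) (hq : m.nat 6 21 0 = q) :
    (fillStep.exec m).real 44 0 0 = m.real 44 0 0 +
      ((ofMem m).val (m.real 42 0 0) (m.real 43 0 0) (m.nat 40 0 0 = 1) p q ^ 2 + 1) ∧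
    ∀ p' q', (fillStep.exec m).real 10 p' q' = if p' = p ∧ q' = q then
      (ofMem m).val (m.real 42 0 0) (m.real 43 0 0) (m.nat 40 0 0 = 1) p q
      else m.real 10 p' q' := by
  simp only [fillStep, block, exec.eq_4]
  have key : (Cmd.ite (natEq (.read 20 (ctr 20) (ctr 21)) (.const 1))
      (.setReal 10 (ctr 20) (ctr 21) (gainE (ctr 20) (ctr 21)))
      (.ite (.and (natEq (.read 20 (ctr 20) (ctr 21)) (.const 2)) (.and
          (natEq (nvar 40) (.const 1)) (realLt (.const 0) (reducedE (ctr 20) (ctr 21)))))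
        (.setReal 10 (ctr 20) (ctr 21) (reducedE (ctr 20) (ctr 21)))
        (.setReal 10 (ctr 20) (ctr 21) (.const 0)))).exec m = m.setR 10 p q
        ((ofMem m).val (m.real 42 0 0) (m.real 43 0 0) (m.nat 40 0 0 = 1) p q) := by
    rw [val]
    by_cases h1 : (ofMem m).ty p q = 1
    · have h1' : m.nat 20 p q = 1 := h1
      rw [exec_ite_pos (by simp [holds_natEq, NExpr.eval, hp, hq, h1']), if_pos h1]
      simp only [exec, NExpr.eval, RExpr.eval, hp, hq]
      rfl
    · have h1' : ¬ m.nat 20 p q = 1 := h1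
      rw [exec_ite_neg (by simp [holds_natEq, NExpr.eval, hp, hq, h1']), if_neg h1]
      split_ifs with h2
      · rw [exec_ite_pos (by
          simpa [BExpr.holds, holds_natEq, holds_realLt, NExpr.eval, RExpr.eval, hp, hq, ofMem,
            gain] using h2)]
        simp only [exec, NExpr.eval, RExpr.eval, hp, hq]
        rfl
      · rw [exec_ite_neg (by
          simpa [BExpr.holds, holds_natEq, holds_realLt, NExpr.eval, RExpr.eval, hp, hq, ofMem,
            gain] using h2)]
        simp [exec, NExpr.eval, RExpr.eval, hp, hq]
  rw [key]
  constructor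
  · simp [exec, NExpr.eval, RExpr.eval, hp, hq, Mem.setR_real]
    ring
  · intro p' q'
    simp [exec, Mem.setR_real]

/-- Since `|V| ≤ V ^ 2 + 1`, the accumulated sum bounds the absolute value of every permutation. It
supplies a safe penalty for forbidden pairs and a starting dual solution without computing maxima or
absolute values. -/
theorem fill_spec (m : Mem) {N : ℕ} (hN : m.nat 6 0 1 = N) (h44 : m.real 44 0 0 = 0) (V : ℕ → ℕ → ℝ)
    (hV : V = (ofMem m).val (m.real 42 0 0) (m.real 43 0 0) (m.nat 40 0 0 = 1)) :
    ((Cmd.loop 20 1 (.loop 21 1 fillStep)).exec m).real 44 0 0 =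
      ∑ p ∈ Finset.range N, ∑ q ∈ Finset.range N, (V p q ^ 2 + 1) ∧
    ∀ p < N, ∀ q < N, ((Cmd.loop 20 1 (.loop 21 1 fillStep)).exec m).real 10 p q = V p q := by
  refine loop_one_induction (x := 20) (p := .loop 21 1 fillStep) rfl m hN
    (fun i m' => m'.real 44 0 0 =
      ∑ p ∈ Finset.range i, ∑ q ∈ Finset.range N, (V p q ^ 2 + 1) ∧
      ∀ p < i, ∀ q < N, m'.real 10 p q = V p q) ⟨by simpa using h44, by simp⟩ ?_
  intro i hi m₁ hI hc hF
  have hN₁ : m₁.nat 6 0 1 = N := hF.len.trans hN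
  rw [Mem.setN_real]
  have := loop_one_induction (x := 21) (p := fillStep) rfl m₁ hN₁
    (fun j m' => m'.real 44 0 0 =
      ∑ p ∈ Finset.range i, ∑ q ∈ Finset.range N, (V p q ^ 2 + 1) +
        ∑ q ∈ Finset.range j, (V i q ^ 2 + 1) ∧
      (∀ p < i, ∀ q < N, m'.real 10 p q = V p q) ∧ ∀ q < j, m'.real 10 i q = V i q)
    ⟨by simpa using hI.1, by simpa using hI.2, by simp⟩ ?_
  · obtain ⟨h1, h2, h3⟩ := this
    refine ⟨by rw [h1, Finset.sum_range_succ], fun p hp q hq => ?_⟩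
    rcases Nat.lt_succ_iff_lt_or_eq.1 hp with h | rfl
    · exact h2 p h q hq
    · exact h3 q hq
  · intro j hj m₂ hJ hc₂ hF₂
    have e := fillStep_spec m₂ i j ((hF₂.ctr 20 rfl).trans hc) hc₂
    have eT : ofMem m₂ = ofMem m := (ofMem_frame hF₂ rfl rfl rfl rfl rfl rfl rfl).trans
      (ofMem_frame hF rfl rfl rfl rfl rfl rfl rfl)
    rw [eT, hF₂.real 42 rfl, hF.real 42 rfl, hF₂.real 43 rfl, hF.real 43 rfl,
      hF₂.nat 40 (by decide) rfl, hF.nat 40 (by decide) rfl, ← hV] at e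
    obtain ⟨h1, h2, h3⟩ := hJ
    rw [Mem.setN_real]
    refine ⟨by rw [e.1, h1, Finset.sum_range_succ, add_assoc], fun p hp q hq => ?_, fun q hq => ?_⟩
    · rw [e.2, if_neg (by omega)]; exact h2 p hp q hq
    · rw [e.2]
      by_cases hqj : q = j
      · simp [hqj]
      · rw [if_neg (by simp [hqj])]; exact h3 q (by omega)

theorem forbid_spec (m : Mem) {N : ℕ} (hN : m.nat 6 0 1 = N) :
    ∀ p < N, ∀ q < N, ((Cmd.loop 22 1 (.loop 23 1 forbidStep)).exec m).real 10 p q =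
      if m.nat 20 p q = 0 then - m.real 31 0 0 else m.real 10 p q := by
  have := loop_one_induction (x := 22) (p := .loop 23 1 forbidStep) rfl m hN
    (fun i m' => ∀ p q, m'.real 10 p q =
      if (p < i ∧ q < N) ∧ m.nat 20 p q = 0 then - m.real 31 0 0 else m.real 10 p q) (by simp) ?_
  · intro p hp q hq
    rw [this p q]; simp [hp, hq]
  intro i hi m₁ hI hc hF
  rw [Mem.setN_real]
  have := loop_one_induction (x := 23) (p := forbidStep) rfl m₁ (hF.len.trans hN)
    (fun j m' => ∀ p q, m'.real 10 p q = if ((p < i ∧ q < N) ∨ (p = i ∧ q < j)) ∧ m.nat 20 p q = 0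
      then - m.real 31 0 0 else m.real 10 p q) (by simpa using hI) ?_
  · intro p q
    rw [this p q]
    have : ((p < i ∧ q < N) ∨ (p = i ∧ q < N)) ↔ (p < i + 1 ∧ q < N) := by omega
    simp only [this]
  · intro j hj m₂ hJ hc₂ hF₂ p q
    have e1 : m₂.nat 6 22 0 = i := (hF₂.ctr 22 rfl).trans hc
    have e20 : m₂.nat 20 = m.nat 20 := (hF₂.nat 20 (by decide) rfl).trans (hF.nat 20 (by decide) rfl)
    have e31 : m₂.real 31 = m.real 31 := (hF₂.real 31 rfl).trans (hF.real 31 rfl)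
    have hiff : ((p < i ∧ q < N) ∨ (p = i ∧ q < j + 1)) ↔
      ((p < i ∧ q < N) ∨ (p = i ∧ q < j)) ∨ (p = i ∧ q = j) := by omega
    simp only [hiff]
    rw [Mem.setN_real, forbidStep]
    by_cases h0 : m.nat 20 i j = 0
    · rw [exec_ite_pos (by simp [holds_natEq, NExpr.eval, e1, hc₂, e20, h0])]
      simp only [exec, NExpr.eval, RExpr.eval, Mem.setR_real, e1, hc₂, e31, hJ p q]
      by_cases hpq : p = i ∧ q = j
      · simp [hpq, h0]
      · simp [hpq]
    · rw [exec_ite_neg (by simp [holds_natEq, NExpr.eval, e1, hc₂, e20, h0])]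
      change m₂.real 10 p q = _
      rw [hJ p q]
      by_cases hpq : p = i ∧ q = j
      · simp [hpq, h0]
      · simp [hpq]

/-- `solve` finds a permutation of maximum value without forbidden pairs, if there is one. -/
theorem solve_spec (m : Mem) (T : Table) (hT : ofMem m = T) (V : ℕ → ℕ → ℝ)
    (hV : V = T.val (m.real 42 0 0) (m.real 43 0 0) (m.nat 40 0 0 = 1))
    (hex : ∃ f, T.Allowed f) :
    T.Allowed (fun p => (solve.exec m).nat 10 p 0) ∧
    (∀ f, T.Allowed f → ∑ p ∈ Finset.range T.N, V p (f p) ≤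
      ∑ p ∈ Finset.range T.N, V p ((solve.exec m).nat 10 p 0)) ∧
    ∀ p < T.N, (solve.exec m).real 10 p ((solve.exec m).nat 10 p 0) =
      V p ((solve.exec m).nat 10 p 0) := by
  have hN : m.nat 6 0 1 = T.N := by rw [← hT]; rfl
  have hty : m.nat 20 = T.ty := by rw [← hT]; rfl
  set N := T.N with hNdef
  have hsolve : solve.exec m = hungarian.exec ((Cmd.loop 22 1 (.loop 23 1 forbidStep)).exec
      ((setRV 31 (.add (.add (rvar 44) (rvar 44)) (.const 1))).exec
      ((Cmd.loop 20 1 (.loop 21 1 fillStep)).exec ((setRV 44 (.const 0)).exec m)))) := rfl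
  have F₁ := exec_frame (setRV 44 (.const 0)) rfl m
  have h44 : ((setRV 44 (.const 0)).exec m).real 44 0 0 = 0 := by
    simp [exec, NExpr.eval, RExpr.eval, Mem.setR_real]
  set m₁ := (setRV 44 (.const 0)).exec m
  have F₂ := exec_frame (Cmd.loop 20 1 (.loop 21 1 fillStep)) rfl m₁
  have hfill := fill_spec m₁ (F₁.len.trans hN) h44 V (by
    rw [ofMem_frame F₁ rfl rfl rfl rfl rfl rfl rfl, F₁.real 42 rfl, F₁.real 43 rfl,
      F₁.nat 40 (by decide) rfl, hT, hV])
  set m₂ := (Cmd.loop 20 1 (.loop 21 1 fillStep)).exec m₁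
  have F₃ := exec_frame (setRV 31 (.add (.add (rvar 44) (rvar 44)) (.const 1))) rfl m₂
  have h31 : ((setRV 31 (.add (.add (rvar 44) (rvar 44)) (.const 1))).exec m₂).real 31 0 0 =
      2 * m₂.real 44 0 0 + 1 := by
    simp [exec, NExpr.eval, RExpr.eval, Mem.setR_real]; ring
  set m₃ := (setRV 31 (.add (.add (rvar 44) (rvar 44)) (.const 1))).exec m₂
  have N₃ : m₃.nat 6 0 1 = N := by rw [F₃.len, F₂.len, F₁.len, hN]
  have F₄ := exec_frame (Cmd.loop 22 1 (.loop 23 1 forbidStep)) rfl m₃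
  have hforb := forbid_spec m₃ N₃
  set m₄ := (Cmd.loop 22 1 (.loop 23 1 forbidStep)).exec m₃
  have N₄ : m₄.nat 6 0 1 = N := F₄.len.trans N₃
  have e20 : m₃.nat 20 = T.ty := by
    rw [F₃.nat 20 (by decide) rfl, F₂.nat 20 (by decide) rfl, F₁.nat 20 (by decide) rfl, hty]
  set s := ∑ p ∈ Finset.range N, ∑ q ∈ Finset.range N, (V p q ^ 2 + 1) with hs
  have hB : m₄.real 31 0 0 = 2 * s + 1 := by
    rw [F₄.real 31 rfl, h31, hfill.1]
  have h4V : ∀ p < N, ∀ q < N, m₄.real 10 p q = if T.ty p q = 0 then -(2 * s + 1) else V p q := by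
    intro p hp q hq
    rw [hforb p hp q hq, e20, h31, hfill.1, F₃.real 10 rfl, hfill.2 p hp q hq]
  have hrow : ∀ p, ∀ q < N, V p q ^ 2 + 1 ≤ ∑ q ∈ Finset.range N, (V p q ^ 2 + 1) :=
    fun p q hq => Finset.single_le_sum (f := fun q => V p q ^ 2 + 1)
      (fun _ _ => by positivity) (Finset.mem_range.2 hq)
  have hs0 : 0 ≤ s := Finset.sum_nonneg fun _ _ => Finset.sum_nonneg fun _ _ => by positivity
  have hperm : ∀ g, IsPerm N g → ∑ p ∈ Finset.range N, (V p (g p) ^ 2 + 1) ≤ s := fun g hg =>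
    Finset.sum_le_sum fun p hp => hrow p _ (hg.1 p (Finset.mem_range.1 hp))
  have hle : ∀ p < N, ∀ q < N, m₄.real 10 p q ≤ V p q ^ 2 + 1 := by
    intro p hp q hq
    rw [h4V p hp q hq]
    split_ifs
    · nlinarith [sq_nonneg (V p q)]
    · nlinarith [sq_nonneg (V p q - 1)]
  obtain ⟨hμ, hopt⟩ := hungarian_spec (m := m₄) N₄ (by
    intro p hp q hq
    have h1 : ∑ q ∈ Finset.range N, (V p q ^ 2 + 1) ≤ s :=
      Finset.single_le_sum (f := fun p => ∑ q ∈ Finset.range N, (V p q ^ 2 + 1))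
        (fun _ _ => Finset.sum_nonneg fun _ _ => by positivity) (Finset.mem_range.2 hp)
    rw [hB]
    linarith [hle p hp q hq, hrow p q hq])
  have F₅ := exec_frame hungarian rfl m₄
  rw [hsolve]
  set μ : ℕ → ℕ := fun p => (hungarian.exec m₄).nat 10 p 0 with hμdef
  have hsum : ∀ g, T.Allowed g → ∑ p ∈ Finset.range N, m₄.real 10 p (g p) =
      ∑ p ∈ Finset.range N, V p (g p) := by
    intro g hg
    refine Finset.sum_congr rfl fun p hp => ?_
    rw [Finset.mem_range] at hp
    rw [h4V p hp _ (hg.1.1 p hp), if_neg (hg.2 p hp)]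
  -- A single forbidden pair contributes `-(2 * s + 1)` and the other rows at most `s`, which is
  -- worse than the `-s` that every allowed permutation achieves.
  have hall : T.Allowed μ := by
    refine ⟨hμ, fun p₀ hp₀ h0 => ?_⟩
    obtain ⟨g, hg⟩ := hex
    have h1 := hopt g hg.1
    rw [hsum g hg] at h1
    have h2 : -s ≤ ∑ p ∈ Finset.range N, V p (g p) := by
      have : ∑ p ∈ Finset.range N, -(V p (g p) ^ 2 + 1) ≤ ∑ p ∈ Finset.range N, V p (g p) :=
        Finset.sum_le_sum fun p _ => by nlinarith [sq_nonneg (V p (g p) + 1)]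
      rw [Finset.sum_neg_distrib] at this
      linarith [hperm g hg.1]
    have h3 : ∑ p ∈ Finset.range N, m₄.real 10 p (μ p) ≤ -(2 * s + 1) + s := by
      rw [← Finset.add_sum_erase _ _ (Finset.mem_range.2 hp₀), h4V p₀ hp₀ _ (hμ.1 p₀ hp₀),
        if_pos h0]
      refine add_le_add le_rfl (le_trans ?_ (hperm μ hμ))
      refine le_trans (Finset.sum_le_sum (g := fun p => V p (μ p) ^ 2 + 1) fun p hp => ?_)
        (Finset.sum_le_sum_of_subset_of_nonneg (Finset.erase_subset _ _)
          fun _ _ _ => by positivity)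
      have hp' := Finset.mem_range.1 (Finset.mem_of_mem_erase hp)
      exact hle p hp' _ (hμ.1 p hp')
    have h4 : ∑ p ∈ Finset.range N, m₄.real 10 p (μ p) =
      ∑ p ∈ Finset.range N, m₄.real 10 p ((hungarian.exec m₄).nat 10 p 0) := rfl
    linarith
  refine ⟨hall, fun f hf => ?_, fun p hp => ?_⟩
  · rw [← hsum f hf]
    exact (hopt f hf.1).trans (hsum μ hall).le
  · rw [F₅.real 10 rfl]
    exact (h4V p hp _ (hall.1.1 p hp)).trans (if_neg (hall.2 p hp))

end Table

/-! ### The solution for a given price -/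

namespace Table

/-- The row `p` has type `2` and positive Lagrangian value. -/
abbrev positiveE (p : NExpr) : BExpr :=
  .and (natEq (.read 20 p (nat1 10 p)) (.const 2)) (realLt (.const 0) (.read 10 p (nat1 10 p)))

/-- Keep the current row if it fits into the budget. Otherwise stop, and keep it alone if it gains
more than the rows before it. -/
def pickStep : Cmd :=
  whenever (.and (positiveE (ctr 25)) (natEq (nvar 43) (.const 0)))
    (.ite (.realLe (.add (rvar 47) (real1 22 (ctr 25))) (rvar 41))
      (block [setRV 47 (.add (rvar 47) (real1 22 (ctr 25))),
        setRV 48 (.add (rvar 48) (gainE (ctr 25) (nat1 10 (ctr 25))))])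
      (block [setNV 43 (.const 1),
        .ite (.realLe (rvar 48) (gainE (ctr 25) (nat1 10 (ctr 25))))
          (block [setNV 41 (ctr 25), setNV 42 (.add (ctr 25) (.const 1))])
          (setNV 42 (ctr 25))]))

/-- Mark the current row if it is counted, and update the objective. -/
def markStep : Cmd :=
  .ite (bor (natEq (.read 20 (ctr 26) (nat1 10 (ctr 26))) (.const 1))
      (.and (positiveE (ctr 26)) (.and (.natLe (nvar 41) (ctr 26)) (natLt (ctr 26) (nvar 42)))))
    (block [.setNat 21 (ctr 26) (.const 0) (.const 1),
      setRV 49 (.add (rvar 49) (.mul (.read 20 (ctr 26) (nat1 10 (ctr 26)))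
        (.read 21 (ctr 26) (nat1 10 (ctr 26))))),
      setRV 50 (.add (rvar 50) (.read 21 (ctr 26) (nat1 10 (ctr 26))))])
    (.setNat 21 (ctr 26) (.const 0) (.const 0))

/-- Copy one row of the current solution. -/
def copyStep : Cmd :=
  block [.setNat 22 (ctr 27) (.const 0) (nat1 10 (ctr 27)),
    .setNat 23 (ctr 27) (.const 0) (nat1 21 (ctr 27))]

/-- Add the value of one row. -/
def sumStep : Cmd := setRV 45 (.add (rvar 45) (.read 10 (ctr 24) (nat1 10 (ctr 24))))

/-- Optimize without the pairs of type `2`, and set the multiplier. -/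
def prepare : Cmd :=
  block [setNV 40 (.const 0), setRV 43 (.const 0), solve, setRV 45 (.const 0), .loop 24 1 sumStep,
    setRV 46 (.sub (.mul (rvar 42) (rvar 40)) (rvar 45)),
    .ite (.realLe (rvar 46) (.const 0)) (setRV 43 (.const 0))
      (setRV 43 (.div (.mul (.const 2) (rvar 46)) (rvar 41))),
    setNV 40 (.const 1)]

/-- Choose the kept rows. -/
def pick : Cmd :=
  block [setNV 41 (.const 0), setNV 42 len, setNV 43 (.const 0), setRV 47 (.const 0),
    setRV 48 (.const 0), .loop 25 1 pickStep]

/-- Mark the counted rows. -/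
def mark : Cmd := block [setRV 49 (.const 0), setRV 50 (rvar 40), .loop 26 1 markStep]

/-- Keep the current solution if it is the best one so far. -/
def record : Cmd :=
  whenever (bor (natEq (nvar 44) (.const 0)) (realLt (rvar 51) (.div (rvar 49) (rvar 50))))
    (block [setNV 44 (.const 1), setRV 51 (.div (rvar 49) (rvar 50)), .loop 27 1 copyStep])

/-- Try the price in variable `42`. -/
def tryPrice : Cmd := block [prepare, solve, pick, mark, record]

/-- This computes the multiplier for the current price. For `C = 0` the division by zero returns
`0`, and no penalty is needed then, because optional pairs cost nothing. -/
theorem prepare_spec (m : Mem) (T : Table) (hT : ofMem m = T) (hex : ∃ f, T.Allowed f) (z : ℝ)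
    (hz : m.real 42 0 0 = z) :
    (prepare.exec m).nat 40 0 0 = 1 ∧ ∃ μ₀, T.Allowed μ₀ ∧
      (∀ f, T.Allowed f → ∑ p ∈ Finset.range T.N, T.val z 0 False p (f p) ≤
        ∑ p ∈ Finset.range T.N, T.val z 0 False p (μ₀ p)) ∧
      ∃ τ, τ = z * T.v - ∑ p ∈ Finset.range T.N, T.val z 0 False p (μ₀ p) ∧
        (prepare.exec m).real 43 0 0 = if τ ≤ 0 then 0 else 2 * τ / T.C := by
  have he : prepare.exec m = (block [setRV 46 (.sub (.mul (rvar 42) (rvar 40)) (rvar 45)),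
    .ite (.realLe (rvar 46) (.const 0)) (setRV 43 (.const 0))
      (setRV 43 (.div (.mul (.const 2) (rvar 46)) (rvar 41))),
    setNV 40 (.const 1)]).exec ((Cmd.loop 24 1 sumStep).exec ((setRV 45 (.const 0)).exec
      (solve.exec ((block [setNV 40 (.const 0), setRV 43 (.const 0)]).exec m)))) := rfl
  have F₁ := exec_frame (block [setNV 40 (.const 0), setRV 43 (.const 0)]) rfl m
  have a1 : ((block [setNV 40 (.const 0), setRV 43 (.const 0)]).exec m).nat 40 0 0 = 0 := by
    simp [exec, block, NExpr.eval, Mem.setN_nat]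
  have a2 : ((block [setNV 40 (.const 0), setRV 43 (.const 0)]).exec m).real 43 0 0 = 0 := by
    simp [exec, block, NExpr.eval, RExpr.eval, Mem.setR_real]
  set m₁ := (block [setNV 40 (.const 0), setRV 43 (.const 0)]).exec m
  have T₁ : ofMem m₁ = T := (ofMem_frame F₁ rfl rfl rfl rfl rfl rfl rfl).trans hT
  obtain ⟨b1, b2, b3⟩ := solve_spec m₁ T T₁ (T.val z 0 False) (by
    rw [F₁.real 42 rfl, hz, a2, a1]; simp) hex
  have F₂ := exec_frame solve rfl m₁
  set m₂ := solve.exec m₁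
  have F₃ := exec_frame (setRV 45 (.const 0)) rfl m₂
  have a3 : ((setRV 45 (.const 0)).exec m₂).real 45 0 0 = 0 := by
    simp [exec, NExpr.eval, RExpr.eval, Mem.setR_real]
  set m₃ := (setRV 45 (.const 0)).exec m₂
  have T₃ : ofMem m₃ = T := ((ofMem_frame F₃ rfl rfl rfl rfl rfl rfl rfl).trans
    (ofMem_frame F₂ rfl rfl rfl rfl rfl rfl rfl)).trans T₁
  have N₃ : m₃.nat 6 0 1 = T.N := by rw [← T₃]; rfl
  have hsum := loop_one_induction (x := 24) (p := sumStep) rfl m₃ N₃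
    (fun i m' => m'.real 45 0 0 = ∑ p ∈ Finset.range i, m₂.real 10 p (m₂.nat 10 p 0))
    (by simpa using a3) (fun i hi m' hI hc hF => by
      have e1 : m'.nat 10 = m₂.nat 10 := (hF.nat 10 (by decide) rfl).trans (F₃.nat 10 (by decide) rfl)
      have e2 : m'.real 10 = m₂.real 10 := (hF.real 10 rfl).trans (F₃.real 10 rfl)
      rw [Finset.sum_range_succ, ← hI]
      simp [sumStep, exec, NExpr.eval, RExpr.eval, Mem.setR_real, hc, e1, e2])
  have F₄ := exec_frame (Cmd.loop 24 1 sumStep) rfl m₃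
  set m₄ := (Cmd.loop 24 1 sumStep).exec m₃
  have T₄ : ofMem m₄ = T := (ofMem_frame F₄ rfl rfl rfl rfl rfl rfl rfl).trans T₃
  have z₄ : m₄.real 42 0 0 = z := by
    rw [F₄.real 42 rfl, F₃.real 42 rfl, F₂.real 42 rfl, F₁.real 42 rfl, hz]
  have v₄ : m₄.real 40 0 0 = T.v := by rw [← T₄]; rfl
  have C₄ : m₄.real 41 0 0 = T.C := by rw [← T₄]; rfl
  have s₄ : m₄.real 45 0 0 = ∑ p ∈ Finset.range T.N, T.val z 0 False p (m₂.nat 10 p 0) := by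
    rw [hsum]
    exact Finset.sum_congr rfl fun p hp => b3 p (Finset.mem_range.1 hp)
  rw [he]
  refine ⟨?_, fun p => m₂.nat 10 p 0, b1, b2, _, rfl, ?_⟩
  · simp [block, exec, NExpr.eval, Mem.setN_nat]
  · rw [← s₄, ← v₄, ← C₄, ← z₄]
    by_cases hτ : m₄.real 42 0 0 * m₄.real 40 0 0 - m₄.real 45 0 0 ≤ 0
    · simp [block, exec, NExpr.eval, RExpr.eval, Mem.setR_real, BExpr.holds, hτ]
    · simp [block, exec, NExpr.eval, RExpr.eval, Mem.setR_real, BExpr.holds, hτ]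

theorem sum_filter_lt_succ (P : Finset ℕ) (g : ℕ → ℝ) (i : ℕ) :
    ∑ p ∈ P.filter (fun p => p < i + 1), g p =
      ∑ p ∈ P.filter (fun p => p < i), g p + if i ∈ P then g i else 0 := by
  by_cases h : i ∈ P
  · have : P.filter (fun p => p < i + 1) = insert i (P.filter (fun p => p < i)) := by
      ext p; simp only [Finset.mem_filter, Finset.mem_insert]
      constructor
      · rintro ⟨h1, h2⟩
        rcases Nat.lt_succ_iff_lt_or_eq.1 h2 with h3 | h3
        · exact Or.inr ⟨h1, h3⟩
        · exact Or.inl h3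
      · rintro (rfl | ⟨h1, h2⟩)
        · exact ⟨h, by omega⟩
        · exact ⟨h1, by omega⟩
    rw [this, Finset.sum_insert (by simp), if_pos h, add_comm]
  · have : P.filter (fun p => p < i + 1) = P.filter (fun p => p < i) := by
      refine Finset.filter_congr fun p hp => ?_
      have : p ≠ i := fun e => h (e ▸ hp)
      omega
    rw [this, if_neg h, add_zero]

/-- The kept rows of the state `m`. -/
def kept (P : Finset ℕ) (m : Mem) : Finset ℕ :=
  P.filter fun p => m.nat 41 0 0 ≤ p ∧ p < m.nat 42 0 0

/-- The invariant of `pick` after `i` rows. -/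
def PickInv (N : ℕ) (P : Finset ℕ) (c g : ℕ → ℝ) (C : ℝ) (i : ℕ) (m : Mem) : Prop :=
  (m.nat 43 0 0 = 0 ∧ m.nat 41 0 0 = 0 ∧ m.nat 42 0 0 = N ∧
    m.real 47 0 0 = ∑ p ∈ P.filter (fun p => p < i), c p ∧ m.real 47 0 0 ≤ C ∧
    m.real 48 0 0 = ∑ p ∈ P.filter (fun p => p < i), g p) ∨
  (m.nat 43 0 0 = 1 ∧ ∑ p ∈ kept P m, c p ≤ C ∧ ∃ x, C < ∑ p ∈ P.filter (fun p => p ≤ x), c p ∧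
    ∑ p ∈ P.filter (fun p => p ≤ x), g p ≤ 2 * ∑ p ∈ kept P m, g p)

theorem PickInv.congr {N : ℕ} {P : Finset ℕ} {c g : ℕ → ℝ} {C : ℝ} {i : ℕ} {m m' : Mem}
    (h : PickInv N P c g C i m) (h1 : m'.nat 41 0 0 = m.nat 41 0 0)
    (h2 : m'.nat 42 0 0 = m.nat 42 0 0) (h3 : m'.nat 43 0 0 = m.nat 43 0 0)
    (h4 : m'.real 47 0 0 = m.real 47 0 0) (h5 : m'.real 48 0 0 = m.real 48 0 0) :
    PickInv N P c g C i m' := by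
  simpa only [PickInv, kept, h1, h2, h3, h4, h5] using h

/-- At the first row that does not fit, either this row alone or the rows before it are kept,
whichever gains more. Together they overflow the budget, and the kept part has at least half of
their gain. A single row fits because no row of `P` costs more than `C`. -/
theorem pickStep_spec {N i : ℕ} {P : Finset ℕ} {c g : ℕ → ℝ} {C : ℝ} {m : Mem}
    (hi : m.nat 6 25 0 = i) (hP : i ∈ P ↔ m.nat 20 i (m.nat 10 i 0) = 2 ∧
      0 < m.real 10 i (m.nat 10 i 0)) (hc : m.real 22 i 0 = c i) (hcC : i ∈ P → c i ≤ C)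
    (hC : m.real 41 0 0 = C)
    (hg : (m.real 20 i (m.nat 10 i 0) - m.real 42 0 0) * m.real 21 i (m.nat 10 i 0) = g i)
    (h : PickInv N P c g C i m) : PickInv N P c g C (i + 1) (pickStep.exec m) := by
  rcases h with ⟨h43, h41, h42, h47, hle, h48⟩ | h
  swap
  · rw [pickStep, exec_ite_neg (by simp [BExpr.holds, holds_natEq, NExpr.eval, h.1])]
    exact Or.inr h
  by_cases hiP : i ∈ P
  swap
  · rw [pickStep, exec_ite_neg (by
      rw [hP] at hiP
      simp only [BExpr.holds, holds_natEq, holds_realLt, NExpr.eval, RExpr.eval, hi]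
      intro h; exact hiP ⟨h.1.1, by simpa using h.1.2⟩)]
    refine Or.inl ⟨h43, h41, h42, ?_, hle, ?_⟩
    · rw [sum_filter_lt_succ, if_neg hiP, add_zero]; exact h47
    · rw [sum_filter_lt_succ, if_neg hiP, add_zero]; exact h48
  rw [pickStep, exec_ite_pos (by
      have := hP.1 hiP
      simp only [BExpr.holds, holds_natEq, holds_realLt, NExpr.eval, RExpr.eval, hi]
      exact ⟨⟨this.1, by simpa using this.2⟩, h43⟩)]
  have hle_iff : ∀ f : ℕ → ℝ, ∑ p ∈ P.filter (fun p => p ≤ i), f p =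
      ∑ p ∈ P.filter (fun p => p < i), f p + f i := by
    intro f
    have := sum_filter_lt_succ P f i
    rw [if_pos hiP] at this
    rw [← this]
    simp only [Nat.lt_succ_iff]
  by_cases hb : m.real 47 0 0 + c i ≤ C
  · rw [exec_ite_pos (by simpa [BExpr.holds, NExpr.eval, RExpr.eval, hi, hc, hC] using hb)]
    refine Or.inl ⟨h43, h41, h42, ?_, ?_, ?_⟩
    · rw [sum_filter_lt_succ, if_pos hiP, ← h47]
      simp [block, exec, NExpr.eval, RExpr.eval, Mem.setR_real, hi, hc]
    · refine le_trans (le_of_eq ?_) hb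
      simp [block, exec, NExpr.eval, RExpr.eval, Mem.setR_real, hi, hc]
    · rw [sum_filter_lt_succ, if_pos hiP, ← h48]
      simp [block, exec, NExpr.eval, RExpr.eval, Mem.setR_real, hi, ← hg]
  · rw [exec_ite_neg (by simpa [BExpr.holds, NExpr.eval, RExpr.eval, hi, hc, hC] using hb)]
    push Not at hb
    simp only [block, exec.eq_4]
    have F := exec_frame (setNV 43 (.const 1)) rfl m
    have k43 : ((setNV 43 (.const 1)).exec m).nat 43 0 0 = 1 := by
      simp [exec, NExpr.eval, Mem.setN_nat]
    set m₁ := (setNV 43 (.const 1)).exec m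
    have k41 : m₁.nat 41 0 0 = 0 := by rw [F.nat 41 (by decide) rfl, h41]
    have k6 : m₁.nat 6 25 0 = i := by rw [F.ctr 25 rfl, hi]
    have k48 : m₁.real 48 = m.real 48 := F.real 48 rfl
    have kg : (m₁.real 20 i (m₁.nat 10 i 0) - m₁.real 42 0 0) * m₁.real 21 i (m₁.nat 10 i 0) =
        g i := by
      rw [F.nat 10 (by decide) rfl, ← hg]; rfl
    refine Or.inr ?_
    by_cases hg' : m.real 48 0 0 ≤ g i
    · rw [exec_ite_pos (by
        simp only [BExpr.holds, NExpr.eval, RExpr.eval, k6, kg, k48]; exact hg')]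
      have hk : kept P (exec .skip (exec ((setNV 41 (ctr 25)).seq
          ((setNV 42 ((ctr 25).add (.const 1))).seq .skip)) m₁)) = {i} := by
        ext p
        simp [kept, exec, NExpr.eval, Mem.setN_nat, k6]
        constructor
        · rintro ⟨_, h1, h2⟩; omega
        · rintro rfl; exact ⟨hiP, by omega, by omega⟩
      refine ⟨?_, ?_, i, ?_, ?_⟩
      · simpa [exec, NExpr.eval, Mem.setN_nat] using k43
      · rw [hk, Finset.sum_singleton]; exact hcC hiP
      · rw [hle_iff, ← h47]; exact hb
      · rw [hk, Finset.sum_singleton, hle_iff, ← h48]; linarith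
    · rw [exec_ite_neg (by
        simp only [BExpr.holds, NExpr.eval, RExpr.eval, k6, kg, k48]; exact hg')]
      have hk : kept P (exec .skip (exec (setNV 42 (ctr 25)) m₁)) =
          P.filter (fun p => p < i) := by
        ext p
        simp [kept, exec, NExpr.eval, Mem.setN_nat, k6, k41]
      refine ⟨?_, ?_, i, ?_, ?_⟩
      · simpa [exec, NExpr.eval, Mem.setN_nat] using k43
      · rw [hk, ← h47]; exact hle
      · rw [hle_iff, ← h47]; exact hb
      · rw [hk, hle_iff, ← h48]; linarith

theorem pick_spec {m : Mem} {N : ℕ} (hN : m.nat 6 0 1 = N) {P : Finset ℕ} {c g : ℕ → ℝ} {C : ℝ}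
    (hPN : ∀ p ∈ P, p < N)
    (hP : ∀ p < N, (p ∈ P ↔ m.nat 20 p (m.nat 10 p 0) = 2 ∧ 0 < m.real 10 p (m.nat 10 p 0)))
    (hc : ∀ p, m.real 22 p 0 = c p) (hcC : ∀ p ∈ P, c p ≤ C) (hC : m.real 41 0 0 = C) (hC0 : 0 ≤ C)
    (hg : ∀ p, (m.real 20 p (m.nat 10 p 0) - m.real 42 0 0) * m.real 21 p (m.nat 10 p 0) = g p) :
    ∑ p ∈ kept P (pick.exec m), c p ≤ C ∧ (kept P (pick.exec m) = P ∨
      ∃ x, C < ∑ p ∈ P.filter (fun p => p ≤ x), c p ∧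
      ∑ p ∈ P.filter (fun p => p ≤ x), g p ≤ 2 * ∑ p ∈ kept P (pick.exec m), g p) := by
  have he : pick.exec m = (Cmd.loop 25 1 pickStep).exec ((block [setNV 41 (.const 0), setNV 42 len,
    setNV 43 (.const 0), setRV 47 (.const 0), setRV 48 (.const 0)]).exec m) := rfl
  have F := exec_frame (block [setNV 41 (.const 0), setNV 42 len,
    setNV 43 (.const 0), setRV 47 (.const 0), setRV 48 (.const 0)]) rfl m
  have h0 : PickInv N P c g C 0 ((block [setNV 41 (.const 0), setNV 42 len,
      setNV 43 (.const 0), setRV 47 (.const 0), setRV 48 (.const 0)]).exec m) := by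
    refine Or.inl ?_
    simp [block, exec, NExpr.eval, RExpr.eval, Mem.setN_nat, Mem.setR_real, hN, hC0]
  set m₁ := (block [setNV 41 (.const 0), setNV 42 len,
    setNV 43 (.const 0), setRV 47 (.const 0), setRV 48 (.const 0)]).exec m
  have := loop_one_induction (x := 25) (p := pickStep) rfl m₁ (F.len.trans hN)
    (fun i m' => PickInv N P c g C i m') (h0.congr rfl rfl rfl rfl rfl) ?_
  · rw [he]
    set m₂ := (Cmd.loop 25 1 pickStep).exec m₁
    rcases this with ⟨_, h41, h42, h47, hle, _⟩ | ⟨_, h1, h2⟩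
    · have hk : kept P m₂ = P := by
        ext p; simp only [kept, Finset.mem_filter, h41, h42]
        exact ⟨fun h => h.1, fun h => ⟨h, Nat.zero_le _, hPN p h⟩⟩
      have hk' : P.filter (fun p => p < N) = P := Finset.filter_true_of_mem hPN
      rw [hk] at *
      rw [hk'] at h47
      exact ⟨h47 ▸ hle, Or.inl rfl⟩
    · exact ⟨h1, Or.inr h2⟩
  · intro i hi m' hI hc' hF
    have e10 : m'.nat 10 = m.nat 10 := (hF.nat 10 (by decide) rfl).trans (F.nat 10 (by decide) rfl)
    have e20 : m'.nat 20 = m.nat 20 := (hF.nat 20 (by decide) rfl).trans (F.nat 20 (by decide) rfl)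
    have r10 : m'.real 10 = m.real 10 := (hF.real 10 rfl).trans (F.real 10 rfl)
    have r20 : m'.real 20 = m.real 20 := (hF.real 20 rfl).trans (F.real 20 rfl)
    have r21 : m'.real 21 = m.real 21 := (hF.real 21 rfl).trans (F.real 21 rfl)
    have r22 : m'.real 22 = m.real 22 := (hF.real 22 rfl).trans (F.real 22 rfl)
    have r41 : m'.real 41 = m.real 41 := (hF.real 41 rfl).trans (F.real 41 rfl)
    have r42 : m'.real 42 = m.real 42 := (hF.real 42 rfl).trans (F.real 42 rfl)
    have := pickStep_spec (m := m') hc' (by rw [e10, e20, r10]; exact hP i hi)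
      (by rw [r22]; exact hc i) (hcC i) (by rw [r41]; exact hC)
      (by rw [r20, e10, r42, r21]; exact hg i) hI
    exact this.congr rfl rfl rfl rfl rfl

/-- The rows of a state marked in the integer array `a`. -/
def marked (N a : ℕ) (m : Mem) : Finset ℕ := (Finset.range N).filter fun p => m.nat a p 0 = 1

theorem mark_spec {m : Mem} {N : ℕ} (hN : m.nat 6 0 1 = N) {S : Finset ℕ}
    (hSN : ∀ p ∈ S, p < N)
    (hS : ∀ p < N, (p ∈ S ↔ m.nat 20 p (m.nat 10 p 0) = 1 ∨
      ((m.nat 20 p (m.nat 10 p 0) = 2 ∧ 0 < m.real 10 p (m.nat 10 p 0)) ∧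
        m.nat 41 0 0 ≤ p ∧ p < m.nat 42 0 0))) :
    marked N 21 (mark.exec m) = S ∧
    (mark.exec m).real 49 0 0 = ∑ p ∈ S, m.real 20 p (m.nat 10 p 0) * m.real 21 p (m.nat 10 p 0) ∧
    (mark.exec m).real 50 0 0 = m.real 40 0 0 + ∑ p ∈ S, m.real 21 p (m.nat 10 p 0) := by
  have he : mark.exec m = (Cmd.loop 26 1 markStep).exec
    ((block [setRV 49 (.const 0), setRV 50 (rvar 40)]).exec m) := rfl
  have F := exec_frame (block [setRV 49 (.const 0), setRV 50 (rvar 40)]) rfl m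
  have h49 : ((block [setRV 49 (.const 0), setRV 50 (rvar 40)]).exec m).real 49 0 0 = 0 := by
    simp [block, exec, NExpr.eval, RExpr.eval, Mem.setR_real]
  have h50 : ((block [setRV 49 (.const 0), setRV 50 (rvar 40)]).exec m).real 50 0 0 =
      m.real 40 0 0 := by
    simp [block, exec, NExpr.eval, RExpr.eval, Mem.setR_real]
  set m₁ := (block [setRV 49 (.const 0), setRV 50 (rvar 40)]).exec m
  have := loop_one_induction (x := 26) (p := markStep) rfl m₁ (F.len.trans hN)
    (fun i m' => (∀ p < i, m'.nat 21 p 0 = if p ∈ S then 1 else 0) ∧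
      m'.real 49 0 0 = ∑ p ∈ S.filter (fun p => p < i),
        m.real 20 p (m.nat 10 p 0) * m.real 21 p (m.nat 10 p 0) ∧
      m'.real 50 0 0 = m.real 40 0 0 + ∑ p ∈ S.filter (fun p => p < i), m.real 21 p (m.nat 10 p 0))
    ⟨by simp, by simpa using h49, by simpa using h50⟩ ?_
  · rw [he]
    have hk' : S.filter (fun p => p < N) = S := Finset.filter_true_of_mem hSN
    rw [hk'] at this
    refine ⟨?_, this.2⟩
    ext p
    simp only [marked, Finset.mem_filter, Finset.mem_range]
    constructor
    · rintro ⟨h1, h2⟩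
      rw [this.1 p h1] at h2
      by_contra h3
      simp [h3] at h2
    · intro h
      exact ⟨hSN p h, by rw [this.1 p (hSN p h), if_pos h]⟩
  · intro i hi m' hI hc hF
    obtain ⟨i1, i2, i3⟩ := hI
    have e10 : m'.nat 10 = m.nat 10 := (hF.nat 10 (by decide) rfl).trans (F.nat 10 (by decide) rfl)
    have e20 : m'.nat 20 = m.nat 20 := (hF.nat 20 (by decide) rfl).trans (F.nat 20 (by decide) rfl)
    have e41 : m'.nat 41 = m.nat 41 := (hF.nat 41 (by decide) rfl).trans (F.nat 41 (by decide) rfl)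
    have e42 : m'.nat 42 = m.nat 42 := (hF.nat 42 (by decide) rfl).trans (F.nat 42 (by decide) rfl)
    have r10 : m'.real 10 = m.real 10 := (hF.real 10 rfl).trans (F.real 10 rfl)
    have r20 : m'.real 20 = m.real 20 := (hF.real 20 rfl).trans (F.real 20 rfl)
    have r21 : m'.real 21 = m.real 21 := (hF.real 21 rfl).trans (F.real 21 rfl)
    rw [sum_filter_lt_succ, sum_filter_lt_succ, markStep]
    by_cases hiS : i ∈ S
    · rw [exec_ite_pos (by
        simpa [BExpr.holds, holds_bor, holds_natEq, holds_natLt, holds_realLt, NExpr.eval,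
          RExpr.eval, hc, e10, e20, e41, e42, r10] using (hS i hi).1 hiS), if_pos hiS, if_pos hiS]
      refine ⟨fun p hp => ?_, ?_, ?_⟩
      · by_cases hpi : p = i
        · simp [block, exec, NExpr.eval, Mem.setN_nat, hc, hpi, hiS]
        · simpa [block, exec, NExpr.eval, Mem.setN_nat, hc, hpi] using i1 p (by omega)
      · rw [← i2]
        simp [block, exec, NExpr.eval, RExpr.eval, Mem.setN_nat, Mem.setR_real, hc, e10, r20, r21]
      · rw [← add_assoc, ← i3]
        simp [block, exec, NExpr.eval, RExpr.eval, Mem.setN_nat, Mem.setR_real, hc, e10, r21]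
    · rw [exec_ite_neg (by
        simpa [BExpr.holds, holds_bor, holds_natEq, holds_natLt, holds_realLt, NExpr.eval,
          RExpr.eval, hc, e10, e20, e41, e42, r10] using fun h => hiS ((hS i hi).2 h)),
          if_neg hiS, if_neg hiS]
      refine ⟨fun p hp => ?_, ?_, ?_⟩
      · by_cases hpi : p = i
        · simp [exec, NExpr.eval, Mem.setN_nat, hc, hpi, hiS]
        · simpa [exec, NExpr.eval, Mem.setN_nat, hc, hpi] using i1 p (by omega)
      · rw [add_zero]; exact i2
      · rw [add_zero]; exact i3

theorem record_spec (m : Mem) {N : ℕ} (hN : m.nat 6 0 1 = N) :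
    ((record.exec m).nat 44 0 0 = m.nat 44 0 0 ∧ (record.exec m).real 51 0 0 = m.real 51 0 0 ∧
      (record.exec m).nat 22 = m.nat 22 ∧ (record.exec m).nat 23 = m.nat 23 ∧
      m.nat 44 0 0 ≠ 0 ∧ m.real 49 0 0 / m.real 50 0 0 ≤ m.real 51 0 0) ∨
    ((record.exec m).nat 44 0 0 = 1 ∧
      (record.exec m).real 51 0 0 = m.real 49 0 0 / m.real 50 0 0 ∧
      (∀ p < N, (record.exec m).nat 22 p 0 = m.nat 10 p 0 ∧
        (record.exec m).nat 23 p 0 = m.nat 21 p 0) ∧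
      (m.nat 44 0 0 = 0 ∨ m.real 51 0 0 < m.real 49 0 0 / m.real 50 0 0)) := by
  by_cases h : m.nat 44 0 0 = 0 ∨ m.real 51 0 0 < m.real 49 0 0 / m.real 50 0 0
  · rw [record, exec_ite_pos (by simpa [holds_bor, holds_natEq, holds_realLt, NExpr.eval, RExpr.eval]
      using h)]
    have he : (block [setNV 44 (.const 1), setRV 51 (.div (rvar 49) (rvar 50)),
      .loop 27 1 copyStep]).exec m = (Cmd.loop 27 1 copyStep).exec
      ((block [setNV 44 (.const 1), setRV 51 (.div (rvar 49) (rvar 50))]).exec m) := rfl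
    have F := exec_frame (block [setNV 44 (.const 1), setRV 51 (.div (rvar 49) (rvar 50))]) rfl m
    have h44 : ((block [setNV 44 (.const 1), setRV 51 (.div (rvar 49) (rvar 50))]).exec m).nat 44 0 0
        = 1 := by simp [block, exec, NExpr.eval, Mem.setN_nat]
    have h51 : ((block [setNV 44 (.const 1), setRV 51 (.div (rvar 49) (rvar 50))]).exec m).real 51 0 0
        = m.real 49 0 0 / m.real 50 0 0 := by
      simp [block, exec, NExpr.eval, RExpr.eval, Mem.setR_real]
    rw [he]
    set m₁ := (block [setNV 44 (.const 1), setRV 51 (.div (rvar 49) (rvar 50))]).exec m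
    have F₂ := exec_frame (Cmd.loop 27 1 copyStep) rfl m₁
    refine Or.inr ⟨by rw [F₂.nat 44 (by decide) rfl, h44], by rw [F₂.real 51 rfl, h51], ?_, h⟩
    refine loop_one_induction (x := 27) (p := copyStep) rfl m₁ (F.len.trans hN)
      (fun i m' => ∀ p < i, m'.nat 22 p 0 = m.nat 10 p 0 ∧ m'.nat 23 p 0 = m.nat 21 p 0)
      (by simp) ?_
    intro i hi m' hI hc hF p hp
    have e10 : m'.nat 10 = m.nat 10 := (hF.nat 10 (by decide) rfl).trans (F.nat 10 (by decide) rfl)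
    have e21 : m'.nat 21 = m.nat 21 := (hF.nat 21 (by decide) rfl).trans (F.nat 21 (by decide) rfl)
    by_cases hpi : p = i
    · simp [copyStep, block, exec, NExpr.eval, Mem.setN_nat, hc, hpi, e10, e21]
    · simpa [copyStep, block, exec, NExpr.eval, Mem.setN_nat, hc, hpi] using hI p (by omega)
  · rw [record, exec_ite_neg (by simpa [holds_bor, holds_natEq, holds_realLt, NExpr.eval, RExpr.eval]
      using h)]
    push Not at h
    exact Or.inl ⟨rfl, rfl, rfl, rfl, h⟩

theorem value_congr {T : Table} {f g : ℕ → ℕ} {S : Finset ℕ} (h : ∀ p ∈ S, f p = g p) :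
    T.value f S = T.value g S := by
  have h1 : ∑ p ∈ S, T.r p (f p) * T.w p (f p) = ∑ p ∈ S, T.r p (g p) * T.w p (g p) :=
    Finset.sum_congr rfl fun p hp => by rw [h p hp]
  have h2 : ∑ p ∈ S, T.w p (f p) = ∑ p ∈ S, T.w p (g p) :=
    Finset.sum_congr rfl fun p hp => by rw [h p hp]
  rw [value, value, h1, h2]

/-- The recorded copy of a permutation agrees with the computed one on the rows below `N` only. -/
theorem IsSol.congr {T : Table} {f g : ℕ → ℕ} {S : Finset ℕ} (hf : T.IsSol f S)
    (h : ∀ p < T.N, f p = g p) : T.IsSol g S := by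
  refine ⟨⟨⟨fun p hp => ?_, fun p hp q hq e => ?_⟩, fun p hp => ?_⟩, fun p hp e => ?_,
    fun p hp => ?_, ?_⟩
  · rw [← h p hp]; exact hf.allowed.1.1 p hp
  · rw [← h p hp, ← h q hq] at e; exact hf.allowed.1.2 p hp q hq e
  · rw [← h p hp]; exact hf.allowed.2 p hp
  · rw [← h p hp] at e; exact hf.forced p hp e
  · have := hf.counted p hp
    rwa [h p this.1] at this
  · refine le_trans (le_of_eq (Finset.sum_congr rfl fun p hp => ?_)) hf.budget
    rw [h p (hf.counted p hp).1]

/-- The best solution so far is a solution whose objective is stored in variable `51`. -/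
def BestOk (T : Table) (m : Mem) : Prop :=
  m.nat 44 0 0 = 0 ∨ (m.nat 44 0 0 = 1 ∧ T.IsSol (fun p => m.nat 22 p 0) (marked T.N 23 m) ∧
    m.real 51 0 0 = T.value (fun p => m.nat 22 p 0) (marked T.N 23 m))

/-- A solution of value at least `b` has been found. -/
def Found (b : ℝ) (m : Mem) : Prop := m.nat 44 0 0 = 1 ∧ b ≤ m.real 51 0 0

/-- Every price, suitable or not, produces a feasible solution, so unsuitable prices do no harm. For
suitable ones the value is bounded below by `le_value_of_optimal`. -/
theorem tryPrice_spec (m : Mem) (T : Table) (hT : ofMem m = T) (hv : T.Valid)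
    (hex : ∃ f, T.Allowed f) (z : ℝ) (hz : m.real 42 0 0 = z) (hbest : BestOk T m) :
    BestOk T (tryPrice.exec m) ∧ (∀ b, Found b m → Found b (tryPrice.exec m)) ∧
    (tryPrice.exec m).nat 44 0 0 = 1 ∧
    ∀ f S, T.IsSol f S → 0 < z → (3 * z ≤ T.value f S ∨ (T.C = 0 ∧ z ≤ T.value f S)) →
      Found z (tryPrice.exec m) := by
  have he : tryPrice.exec m = record.exec (mark.exec (pick.exec (solve.exec (prepare.exec m)))) :=
    rfl
  rw [he]
  obtain ⟨h40, μ₀, a1, a2, τ, a3, a4⟩ := prepare_spec m T hT hex z hz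
  have F₁ := exec_frame prepare rfl m
  set m₁ := prepare.exec m
  set lam := m₁.real 43 0 0 with hlam
  have T₁ : ofMem m₁ = T := (ofMem_frame F₁ rfl rfl rfl rfl rfl rfl rfl).trans hT
  have z₁ : m₁.real 42 0 0 = z := by rw [F₁.real 42 rfl, hz]
  obtain ⟨b1, b2, b3⟩ := solve_spec m₁ T T₁ (T.val z lam True) (by rw [z₁, h40]; simp [hlam]) hex
  have F₂ := exec_frame solve rfl m₁
  set m₂ := solve.exec m₁
  have T₂ : ofMem m₂ = T := (ofMem_frame F₂ rfl rfl rfl rfl rfl rfl rfl).trans T₁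
  have N₂ : m₂.nat 6 0 1 = T.N := by rw [← T₂]; rfl
  have z₂ : m₂.real 42 0 0 = z := by rw [F₂.real 42 rfl, z₁]
  have ty₂ : m₂.nat 20 = T.ty := by rw [← T₂]; rfl
  have c₂ : ∀ p, m₂.real 22 p 0 = T.c p := by rw [← T₂]; exact fun _ => rfl
  have C₂ : m₂.real 41 0 0 = T.C := by rw [← T₂]; rfl
  have r₂ : m₂.real 20 = T.r := by rw [← T₂]; rfl
  have w₂ : m₂.real 21 = T.w := by rw [← T₂]; rfl
  have v₂ : m₂.real 40 0 0 = T.v := by rw [← T₂]; rfl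
  set μ : ℕ → ℕ := fun p => m₂.nat 10 p 0 with hμ
  set P := T.positive z lam μ with hP
  have hPN : ∀ p ∈ P, p < T.N := fun p hp => by
    rw [hP, positive, Finset.mem_filter, Finset.mem_range] at hp; exact hp.1
  have hPiff : ∀ p < T.N, (p ∈ P ↔ m₂.nat 20 p (m₂.nat 10 p 0) = 2 ∧
      0 < m₂.real 10 p (m₂.nat 10 p 0)) := by
    intro p hp
    rw [hP, positive, Finset.mem_filter, Finset.mem_range, b3 p hp, ty₂]
    exact ⟨fun h => h.2, fun h => ⟨hp, h⟩⟩
  have hP2 : ∀ p ∈ P, T.ty p (μ p) = 2 := fun p hp => by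
    have := ((hPiff p (hPN p hp)).1 hp).1
    rwa [ty₂] at this
  obtain ⟨d1, d2⟩ := pick_spec (m := m₂) N₂ (P := P) (c := T.c) (g := fun p => T.gain z p (μ p))
    (C := T.C) hPN hPiff c₂ (fun p hp => hv.c_le p (hPN p hp) _ (b1.1.1 p (hPN p hp)) (hP2 p hp)) C₂
    hv.C_nonneg (fun p => by rw [z₂, r₂, w₂, gain])
  have F₃ := exec_frame pick rfl m₂
  set m₃ := pick.exec m₂
  set K := kept P m₃ with hK
  have hKP : K ⊆ P := Finset.filter_subset _ _
  have hfixN : ∀ p, p ∈ T.fixedRows μ ↔ p < T.N ∧ T.ty p (μ p) = 1 := by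
    intro p; rw [fixedRows, Finset.mem_filter, Finset.mem_range]
  obtain ⟨e1, e2, e3⟩ := mark_spec (m := m₃) (N := T.N) (by rw [F₃.len, N₂])
    (S := T.fixedRows μ ∪ K)
    (fun p hp => by
      rcases Finset.mem_union.1 hp with h | h
      · exact ((hfixN p).1 h).1
      · exact hPN p (hKP h))
    (fun p hp => by
      rw [Finset.mem_union, hfixN, hK, kept, Finset.mem_filter, hPiff p hp,
        F₃.nat 20 (by decide) rfl, F₃.nat 10 (by decide) rfl, F₃.real 10 rfl, ty₂]
      exact ⟨fun h => h.imp (fun h => h.2) id, fun h => h.imp (fun h => ⟨hp, h⟩) id⟩)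
  rw [F₃.nat 10 (by decide) rfl, F₃.real 20 rfl, F₃.real 21 rfl, r₂, w₂] at e2
  rw [F₃.nat 10 (by decide) rfl, F₃.real 40 rfl, F₃.real 21 rfl, w₂, v₂] at e3
  have F₄ := exec_frame mark rfl m₃
  set m₄ := mark.exec m₃
  have hval : m₄.real 49 0 0 / m₄.real 50 0 0 = T.value μ (T.fixedRows μ ∪ K) := by
    rw [e2, e3, value]
  have hsol : T.IsSol μ (T.fixedRows μ ∪ K) := by
    refine ⟨b1, fun p hp h => Finset.mem_union_left _ ((hfixN p).2 ⟨hp, h⟩), fun p hp => ?_, ?_⟩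
    · rcases Finset.mem_union.1 hp with h | h
      · exact ⟨((hfixN p).1 h).1, Or.inl ((hfixN p).1 h).2⟩
      · exact ⟨hPN p (hKP h), Or.inr (hP2 p (hKP h))⟩
    · have hdisj : Disjoint (T.fixedRows μ) K := by
        rw [Finset.disjoint_left]
        intro p hp hpK
        have h1 := hP2 p (hKP hpK)
        have h2 := ((hfixN p).1 hp).2
        omega
      rw [Finset.sum_union hdisj]
      have h1 : ∑ p ∈ T.fixedRows μ, (if T.ty p (μ p) = 2 then T.c p else 0) = 0 :=
        Finset.sum_eq_zero fun p hp => by simp [((hfixN p).1 hp).2]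
      have h2 : ∑ p ∈ K, (if T.ty p (μ p) = 2 then T.c p else 0) = ∑ p ∈ K, T.c p :=
        Finset.sum_congr rfl fun p hp => by simp [hP2 p (hKP hp)]
      rw [h1, h2, zero_add]; exact d1
  have g10 : m₄.nat 10 = m₂.nat 10 := (F₄.nat 10 (by decide) rfl).trans (F₃.nat 10 (by decide) rfl)
  have g44 : m₄.nat 44 = m.nat 44 := by
    rw [F₄.nat 44 (by decide) rfl, F₃.nat 44 (by decide) rfl, F₂.nat 44 (by decide) rfl,
      F₁.nat 44 (by decide) rfl]
  have g51 : m₄.real 51 = m.real 51 := by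
    rw [F₄.real 51 rfl, F₃.real 51 rfl, F₂.real 51 rfl, F₁.real 51 rfl]
  have g22 : m₄.nat 22 = m.nat 22 := by
    rw [F₄.nat 22 (by decide) rfl, F₃.nat 22 (by decide) rfl, F₂.nat 22 (by decide) rfl,
      F₁.nat 22 (by decide) rfl]
  have g23 : m₄.nat 23 = m.nat 23 := by
    rw [F₄.nat 23 (by decide) rfl, F₃.nat 23 (by decide) rfl, F₂.nat 23 (by decide) rfl,
      F₁.nat 23 (by decide) rfl]
  have hrec := record_spec m₄ (N := T.N) (by rw [F₄.len, F₃.len, N₂])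
  rw [hval, g44, g51, g22, g23, g10] at hrec
  set m₅ := record.exec m₄
  have hz_le : ∀ f S, T.IsSol f S → 0 < z →
      (3 * z ≤ T.value f S ∨ (T.C = 0 ∧ z ≤ T.value f S)) →
      z ≤ T.value μ (T.fixedRows μ ∪ K) := fun f S hS hz0 hzS =>
    le_value_of_optimal hv hz0 a1 b1 a2 b2 a3 a4 d2 hKP hS hzS
  rcases hrec with ⟨k1, k2, k3, k4, k5, k6⟩ | ⟨k1, k2, k3, k4⟩
  · have hb1 := hbest.resolve_left k5
    refine ⟨Or.inr ?_, fun b hb => ⟨by rw [k1]; exact hb.1, by rw [k2]; exact hb.2⟩,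
      by rw [k1]; exact hb1.1, fun f S hS hz0 hzS => ⟨by rw [k1]; exact hb1.1, ?_⟩⟩
    · simpa only [marked, k1, k2, k3, k4] using hb1
    · rw [k2]; exact (hz_le f S hS hz0 hzS).trans k6
  · have hmk : marked T.N 23 m₅ = T.fixedRows μ ∪ K := by
      rw [← e1]
      refine Finset.filter_congr fun p hp => ?_
      rw [(k3 p (Finset.mem_range.1 hp)).2]
    have hmu : ∀ p < T.N, μ p = m₅.nat 22 p 0 := fun p hp => (k3 p hp).1.symm
    refine ⟨Or.inr ⟨k1, ?_, ?_⟩, fun b hb => ⟨k1, ?_⟩, k1, fun f S hS hz0 hzS => ⟨k1, ?_⟩⟩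
    · rw [hmk]; exact hsol.congr hmu
    · rw [hmk, k2]
      exact value_congr fun p hp => hmu p (hsol.counted p hp).1
    · rw [k2]
      rcases k4 with h | h
      · exact absurd hb.1 (by rw [h]; decide)
      · exact hb.2.trans h.le
    · rw [k2]; exact hz_le f S hS hz0 hzS

end Table

/-! ### Search over prices -/

namespace Table

/-- The first price for the pairs given by the loop counters `1`, …, `4`. -/
def startPrice : Cmd :=
  setRV 42 (.div (.div (.div (.mul (.read 20 (ctr 1) (ctr 2)) (.read 21 (ctr 1) (ctr 2)))
    (.add (rvar 40) (.read 21 (ctr 3) (ctr 4)))) (.ofNat len)) (.const 3))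

/-- Try the current price and raise it. -/
def priceStep (k : ℕ) : Cmd := block [tryPrice, setRV 42 (.mul (rvar 42) (.const (1 + 1 / k)))]

/-- Try the prices that belong to two pairs. -/
def priceLoop (k : ℕ) : Cmd := .seq startPrice (.loop 5 (4 * k) (priceStep k))

/-- Try all prices. -/
def search (k : ℕ) : Cmd := .loop 1 1 (.loop 2 1 (.loop 3 1 (.loop 4 1 (priceLoop k))))

variable {T : Table}

/-- The state of the search: the table, and the best solution so far. -/
def SearchOk (T : Table) (m : Mem) : Prop := ofMem m = T ∧ BestOk T m

theorem SearchOk.setCtr {m : Mem} (h : SearchOk T m) (x i : ℕ) : SearchOk T (m.setN 6 x 0 i) := by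
  refine ⟨?_, ?_⟩
  · rw [← h.1]
    simp [ofMem, Mem.setN_nat, funext_iff]
  · simpa [BestOk, marked, Mem.setN_nat] using h.2

theorem Found.setCtr {m : Mem} {b : ℝ} (h : Found b m) (x i : ℕ) : Found b (m.setN 6 x 0 i) := by
  simpa [Found, Mem.setN_nat] using h

/-- The price `z` is small compared with some solution. -/
def Good (T : Table) (z : ℝ) : Prop :=
  0 < z ∧ ∃ f S, T.IsSol f S ∧ (3 * z ≤ T.value f S ∨ (T.C = 0 ∧ z ≤ T.value f S))

/-- The program `p` preserves the state of the search, and loses no solution. -/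
def Keeps (T : Table) (p : Cmd) : Prop :=
  ∀ m, SearchOk T m → SearchOk T (p.exec m) ∧ ∀ b, Found b m → Found b (p.exec m)

theorem Keeps.loop {x c : ℕ} {p : Cmd} (hp : (Cmd.loop x c p).ok = true) (h : Keeps T p) :
    Keeps T (.loop x c p) := by
  intro m hm
  refine loop_induction hp m (fun _ m' => SearchOk T m' ∧ ∀ b, Found b m → Found b m')
    ⟨hm.setCtr _ _, fun b hb => hb.setCtr _ _⟩ ?_
  intro i _ m' hI _ _
  exact ⟨(h m' hI.1).1.setCtr _ _, fun b hb => ((h m' hI.1).2 b (hI.2 b hb)).setCtr _ _⟩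

/-- This treats nested loops as guessing: if the round whose counter is the right guess finds a
solution, later rounds do not lose it. -/
theorem Keeps.reaches {x c : ℕ} {p : Cmd} (hp : (Cmd.loop x c p).ok = true) (h : Keeps T p)
    {m : Mem} (hm : SearchOk T m) {b : ℝ} {i : ℕ} (hi : i < c * m.nat 6 0 1)
    (hhit : ∀ m', SearchOk T m' → m'.nat 6 x 0 = i → (Cmd.loop x c p).Frame m m' →
      Found b (p.exec m')) : Found b ((Cmd.loop x c p).exec m) :=
  (loop_reaches hp m (SearchOk T) (Found b) hm (fun _ _ h => h.setCtr _ _)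
    (fun _ _ h => h.setCtr _ _) (fun m' h' _ => ⟨(h m' h').1, (h m' h').2 b⟩) i hi hhit).2

/-- `Found 0` holds for every price, since some solution is recorded and values are nonnegative. It
settles the case of optimum `0`, where no positive price is suitable. -/
theorem priceStep_spec (hv : T.Valid) (hex : ∃ f, T.Allowed f) (k : ℕ) {m : Mem}
    (hm : SearchOk T m) :
    SearchOk T ((priceStep k).exec m) ∧ (∀ b, Found b m → Found b ((priceStep k).exec m)) ∧
    Found 0 ((priceStep k).exec m) ∧
    (Good T (m.real 42 0 0) → Found (m.real 42 0 0) ((priceStep k).exec m)) ∧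
    ((priceStep k).exec m).real 42 0 0 = m.real 42 0 0 * (1 + 1 / k) := by
  obtain ⟨h1, h2, h3, h4⟩ := tryPrice_spec m T hm.1 hv hex _ rfl hm.2
  have F := exec_frame tryPrice rfl m
  have he : (priceStep k).exec m =
    (setRV 42 (.mul (rvar 42) (.const (1 + 1 / k)))).exec (tryPrice.exec m) := rfl
  have hT : ofMem (tryPrice.exec m) = T := (ofMem_frame F rfl rfl rfl rfl rfl rfl rfl).trans hm.1
  have h42 : (tryPrice.exec m).real 42 = m.real 42 := F.real 42 rfl
  rw [he]
  set m₁ := tryPrice.exec m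
  have F₂ := exec_frame (setRV 42 (.mul (rvar 42) (.const (1 + 1 / k)))) rfl m₁
  have hB : BestOk T ((setRV 42 (.mul (rvar 42) (.const (1 + 1 / k)))).exec m₁) := by
    have e : ((setRV 42 (.mul (rvar 42) (.const (1 + 1 / k)))).exec m₁).nat = m₁.nat := rfl
    simpa only [BestOk, marked, e, F₂.real 51 rfl] using h1
  have hF : ∀ b, Found b m₁ → Found b ((setRV 42 (.mul (rvar 42) (.const (1 + 1 / k)))).exec m₁) := by
    intro b hb
    refine ⟨hb.1, ?_⟩
    rw [F₂.real 51 rfl]; exact hb.2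
  refine ⟨⟨(ofMem_frame F₂ rfl rfl rfl rfl rfl rfl rfl).trans hT, hB⟩, fun b hb => hF b (h2 b hb),
    hF 0 ⟨h3, ?_⟩, fun ⟨hz, f, S, hS, h⟩ => hF _ (h4 f S hS hz h), ?_⟩
  · have := h1.resolve_left (by rw [h3]; decide)
    rw [this.2.2]
    exact value_nonneg hv this.2.1
  · simp [exec, NExpr.eval, RExpr.eval, Mem.setR_real, h42]

/-- The first price for two given pairs. -/
noncomputable def firstPrice (T : Table) (p q p' q' : ℕ) : ℝ :=
  T.r p q * T.w p q / (T.v + T.w p' q') / T.N / 3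

theorem priceLoop_spec (hv : T.Valid) (hex : ∃ f, T.Allowed f) (k : ℕ) {m : Mem}
    (hm : SearchOk T m) :
    (SearchOk T ((priceLoop k).exec m) ∧ ∀ b, Found b m → Found b ((priceLoop k).exec m)) ∧
    ∀ j < 4 * k * T.N, Found 0 ((priceLoop k).exec m) ∧
      ∀ z, z = T.firstPrice (m.nat 6 1 0) (m.nat 6 2 0) (m.nat 6 3 0) (m.nat 6 4 0) *
        (1 + 1 / k) ^ j → Good T z → Found z ((priceLoop k).exec m) := by
  have he : (priceLoop k).exec m = (Cmd.loop 5 (4 * k) (priceStep k)).exec (startPrice.exec m) := rfl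
  have F := exec_frame startPrice rfl m
  set z₀ := T.firstPrice (m.nat 6 1 0) (m.nat 6 2 0) (m.nat 6 3 0) (m.nat 6 4 0) with hz₀
  have h42 : (startPrice.exec m).real 42 0 0 = z₀ := by
    rw [hz₀, ← hm.1]
    simp [startPrice, exec, NExpr.eval, RExpr.eval, Mem.setR_real, firstPrice, ofMem]
  have hT : ofMem (startPrice.exec m) = T := (ofMem_frame F rfl rfl rfl rfl rfl rfl rfl).trans hm.1
  have hB : BestOk T (startPrice.exec m) := by
    have e : (startPrice.exec m).nat = m.nat := rfl
    simpa only [BestOk, marked, e, F.real 51 rfl] using hm.2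
  have hFd : ∀ b, Found b m → Found b (startPrice.exec m) := by
    intro b hb
    refine ⟨hb.1, ?_⟩
    rw [F.real 51 rfl]; exact hb.2
  rw [he]
  set m₁ := startPrice.exec m
  have N₁ : m₁.nat 6 0 1 = T.N := by rw [← hT]; rfl
  have := loop_induction (x := 5) (c := 4 * k) (p := priceStep k) rfl m₁
    (fun i m' => SearchOk T m' ∧ (∀ b, Found b m → Found b m') ∧
      m'.real 42 0 0 = z₀ * (1 + 1 / k) ^ i ∧ ∀ j < i, Found 0 m' ∧
        (∀ z, z = z₀ * (1 + 1 / k) ^ j → Good T z → Found z m'))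
    ⟨SearchOk.setCtr ⟨hT, hB⟩ _ _, fun b hb => (hFd b hb).setCtr _ _, by simpa using h42, by simp⟩ ?_
  · rw [N₁] at this
    exact ⟨⟨this.1, this.2.1⟩, this.2.2.2⟩
  · intro i _ m' ⟨i1, i2, i3, i4⟩ _ _
    obtain ⟨s1, s2, s3, s4, s5⟩ := priceStep_spec hv hex k i1
    refine ⟨s1.setCtr _ _, fun b hb => (s2 b (i2 b hb)).setCtr _ _, ?_, fun j hj =>
      ⟨s3.setCtr _ _, fun z hz hg => Found.setCtr ?_ _ _⟩⟩
    · rw [Mem.setN_real, s5, i3, pow_succ, mul_assoc]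
    · rcases Nat.lt_succ_iff_lt_or_eq.1 hj with h | rfl
      · exact s2 z ((i4 j h).2 z hz hg)
      · rw [← i3] at hz
        subst hz
        exact s4 hg

/-- The four outer counters run through all choices of two pairs, among them the two that determine
the price range of a given solution. -/
theorem search_spec (hv : T.Valid) (hex : ∃ f, T.Allowed f) (k : ℕ) {m : Mem}
    (hm : SearchOk T m) :
    SearchOk T ((search k).exec m) ∧
    ∀ p < T.N, ∀ q < T.N, ∀ p' < T.N, ∀ q' < T.N, ∀ j < 4 * k * T.N, ∀ z,
      z = T.firstPrice p q p' q' * (1 + 1 / k) ^ j →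
      Found 0 ((search k).exec m) ∧ (Good T z → Found z ((search k).exec m)) := by
  have K4 : Keeps T (priceLoop k) := fun m hm => (priceLoop_spec hv hex k hm).1
  have K3 : Keeps T (.loop 4 1 (priceLoop k)) := K4.loop rfl
  have K2 : Keeps T (.loop 3 1 (.loop 4 1 (priceLoop k))) := K3.loop rfl
  have K1 : Keeps T (.loop 2 1 (.loop 3 1 (.loop 4 1 (priceLoop k)))) := K2.loop rfl
  refine ⟨(K1.loop (x := 1) (c := 1) rfl m hm).1, fun p hp q hq p' hp' q' hq' j hj z hz => ?_⟩
  have hN : ∀ m', SearchOk T m' → m'.nat 6 0 1 = T.N := fun m' h => by rw [← h.1]; rfl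
  have key : ∀ b, (b = 0 ∨ (b = z ∧ Good T z)) → Found b ((search k).exec m) := by
    intro b hb
    refine K1.reaches (x := 1) (c := 1) rfl hm (i := p) (by rw [hN m hm]; omega) ?_
    intro m₁ h₁ c₁ _
    refine K2.reaches rfl h₁ (i := q) (by rw [hN _ h₁]; omega) ?_
    intro m₂ h₂ c₂ F₂
    refine K3.reaches rfl h₂ (i := p') (by rw [hN _ h₂]; omega) ?_
    intro m₃ h₃ c₃ F₃
    refine K4.reaches rfl h₃ (i := q') (by rw [hN _ h₃]; omega) ?_
    intro m₄ h₄ c₄ F₄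
    have d1 : m₄.nat 6 1 0 = p := by rw [F₄.ctr 1 rfl, F₃.ctr 1 rfl, F₂.ctr 1 rfl, c₁]
    have d2 : m₄.nat 6 2 0 = q := by rw [F₄.ctr 2 rfl, F₃.ctr 2 rfl, c₂]
    have d3 : m₄.nat 6 3 0 = p' := by rw [F₄.ctr 3 rfl, c₃]
    have := (priceLoop_spec hv hex k h₄).2 j hj
    rw [d1, d2, d3, c₄] at this
    rcases hb with rfl | ⟨rfl, hg⟩
    · exact this.1
    · exact this.2 _ hz hg
  exact ⟨key 0 (Or.inl rfl), fun hg => key z (Or.inr ⟨rfl, hg⟩)⟩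

/-- Bernoulli's inequality gives `(1 + 1 / k) ^ (k * N) ≥ 1 + N`, and the fourth power of `1 + N`
exceeds `3 * N ^ 2`, the width of the range of prices to be covered. This is the origin of the loop
length `4 * k`. -/
theorem three_sq_lt_pow {k N : ℕ} (hk : 0 < k) (hN : 0 < N) :
    3 * (N : ℝ) ^ 2 < (1 + 1 / (k : ℝ)) ^ (4 * k * N) := by
  have hk' : (0 : ℝ) < k := by exact_mod_cast hk
  have h1 : (1 : ℝ) + N ≤ (1 + 1 / (k : ℝ)) ^ (k * N) := by
    have := one_add_mul_le_pow (a := 1 / (k : ℝ)) (by have := div_pos one_pos hk'; linarith) (k * N)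
    refine le_trans (le_of_eq ?_) this
    push_cast; field_simp
  have h2 : (1 + 1 / (k : ℝ)) ^ (4 * k * N) = ((1 + 1 / (k : ℝ)) ^ (k * N)) ^ 4 := by
    rw [← pow_mul]; congr 1; ring
  have h3 : ((1 : ℝ) + N) ^ 4 ≤ ((1 + 1 / (k : ℝ)) ^ (k * N)) ^ 4 :=
    pow_le_pow_left₀ (by positivity) h1 4
  have h4 : (1 : ℝ) ≤ N := by exact_mod_cast hN
  rw [h2]
  refine lt_of_lt_of_le ?_ h3
  nlinarith [sq_nonneg ((N : ℝ)), pow_pos (show (0 : ℝ) < N by linarith) 3,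
    pow_pos (show (0 : ℝ) < N by linarith) 4]

theorem exists_geometric_near {z q y : ℝ} {n : ℕ} (hzy : z ≤ y) (hy : y < z * q ^ n) :
    ∃ j < n, z * q ^ j ≤ y ∧ y < z * q ^ (j + 1) := by
  induction n with
  | zero => simp at hy; linarith
  | succ n ih =>
    by_cases h : y < z * q ^ n
    · obtain ⟨j, hj, h'⟩ := ih h
      exact ⟨j, by omega, h'⟩
    · exact ⟨n, by omega, not_lt.1 h, hy⟩

/-- The search finds a solution whose value is at least `y / (1 + 1 / k)`, if `y` is a third of the
value of some solution, or the whole of it in case the budget is zero. -/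
theorem search_approx (hv : T.Valid) (hN : 0 < T.N) {k : ℕ} (hk : 0 < k) {m : Mem}
    (hm : ofMem m = T) (h44 : m.nat 44 0 0 = 0) {f : ℕ → ℕ} {S : Finset ℕ} (hS : T.IsSol f S)
    {y : ℝ} (hy : 3 * y = T.value f S ∨ (T.C = 0 ∧ y = T.value f S)) :
    T.IsSol (fun p => ((search k).exec m).nat 22 p 0) (marked T.N 23 ((search k).exec m)) ∧
    y / (1 + 1 / k) ≤
      T.value (fun p => ((search k).exec m).nat 22 p 0) (marked T.N 23 ((search k).exec m)) := by
  obtain ⟨⟨_, hB⟩, hall⟩ := search_spec hv ⟨f, hS.allowed⟩ k (m := m) ⟨hm, Or.inl h44⟩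
  have hJ : 0 < 4 * k * T.N := by positivity
  have hk' : (0 : ℝ) < k := by exact_mod_cast hk
  have hq : (0 : ℝ) < 1 + 1 / k := by positivity
  have h0 := (hall 0 hN 0 hN 0 hN 0 hN 0 hJ _ rfl).1
  set m' := (search k).exec m
  obtain ⟨_, hB1, hB2⟩ := hB.resolve_left (by rw [h0.1]; decide)
  refine ⟨hB1, ?_⟩
  rw [← hB2]
  have hval0 := value_nonneg hv hS
  rcases hval0.eq_or_lt with hz | hpos
  · have : y = 0 := by rcases hy with h | h <;> linarith
    rw [this, zero_div]; exact h0.2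
  have hlt : ∀ p ∈ S, p < T.N ∧ f p < T.N := fun p hp =>
    ⟨(hS.counted p hp).1, hS.allowed.1.1 p (hS.counted p hp).1⟩
  have hSne : S.Nonempty := by
    rw [Finset.nonempty_iff_ne_empty]
    rintro rfl
    simp [value] at hpos
  -- `e` has the largest revenue term and `e'` the largest weight. They determine numerator and
  -- denominator of the value up to factors of `N`, so the value lies between `3 * z₀` and `3 * N ^
  -- 2 * z₀`.
  obtain ⟨e, heS, he⟩ := S.exists_max_image (fun p => T.r p (f p) * T.w p (f p)) hSne
  obtain ⟨e', heS', he'⟩ := S.exists_max_image (fun p => T.w p (f p)) hSne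
  set A := ∑ p ∈ S, T.r p (f p) * T.w p (f p) with hA
  set W := ∑ p ∈ S, T.w p (f p) with hW
  set a := T.r e (f e) * T.w e (f e) with ha
  set d := T.v + T.w e' (f e') with hd
  have hcard : (S.card : ℝ) ≤ T.N := by
    have : S ⊆ Finset.range T.N := fun p hp => Finset.mem_range.2 (hlt p hp).1
    exact_mod_cast (Finset.card_le_card this).trans (Finset.card_range T.N).le
  have hw : ∀ p ∈ S, 0 ≤ T.w p (f p) := fun p hp => hv.w_nonneg p (hlt p hp).1 _ (hlt p hp).2
  have haw : ∀ p ∈ S, 0 ≤ T.r p (f p) * T.w p (f p) := fun p hp =>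
    mul_nonneg (hv.r_nonneg p (hlt p hp).1 _ (hlt p hp).2) (hw p hp)
  have hN1 : (1 : ℝ) ≤ T.N := by exact_mod_cast hN
  have hAa : A ≤ T.N * a := by
    have := Finset.sum_le_card_nsmul S _ a he
    rw [nsmul_eq_mul] at this
    exact this.trans (mul_le_mul_of_nonneg_right hcard (haw e heS))
  have haA : a ≤ A := Finset.single_le_sum haw heS
  have hWw : W ≤ T.N * T.w e' (f e') := by
    have := Finset.sum_le_card_nsmul S _ _ he'
    rw [nsmul_eq_mul] at this
    exact this.trans (mul_le_mul_of_nonneg_right hcard (hw e' heS'))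
  have hwW : T.w e' (f e') ≤ W := Finset.single_le_sum hw heS'
  have hvp := hv.v_pos
  have hd0 : 0 < d := by have := hw e' heS'; linarith
  have hD0 : 0 < T.v + W := by have := hw e' heS'; linarith
  have hval : T.value f S = A / (T.v + W) := rfl
  have hA0 : 0 < A := by
    rw [hval] at hpos
    by_contra h
    exact absurd hpos (not_lt.2 (div_nonpos_of_nonpos_of_nonneg (not_lt.1 h) hD0.le))
  have ha0 : 0 < a := by
    by_contra h
    have : (T.N : ℝ) * a ≤ 0 := mul_nonpos_of_nonneg_of_nonpos (by linarith) (not_lt.1 h)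
    linarith
  have hfp : T.firstPrice e (f e) e' (f e') = a / d / T.N / 3 := rfl
  set z₀ := T.firstPrice e (f e) e' (f e') with hz₀
  have hz0 : 0 < z₀ := by rw [hfp]; positivity
  have hlow : 3 * z₀ ≤ T.value f S := by
    have h1 : 3 * z₀ = a / (T.N * d) := by rw [hfp]; field_simp
    rw [h1, hval, div_le_div_iff₀ (by positivity) hD0]
    have : T.v + W ≤ T.N * d := by rw [hd]; nlinarith
    exact mul_le_mul haA this hD0.le hA0.le
  have hhigh : T.value f S ≤ z₀ * (3 * (T.N : ℝ) ^ 2) := by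
    have h1 : z₀ * (3 * (T.N : ℝ) ^ 2) = T.N * a / d := by
      rw [hfp]; field_simp
    rw [h1, hval, div_le_div_iff₀ hD0 hd0]
    have : d ≤ T.v + W := by rw [hd]; linarith
    exact mul_le_mul hAa this hd0.le (by positivity)
  have hy1 : z₀ ≤ y := by rcases hy with h | h <;> linarith
  have hy2 : y ≤ T.value f S := by rcases hy with h | h <;> linarith
  obtain ⟨j, hj, hj1, hj2⟩ := exists_geometric_near (n := 4 * k * T.N) (q := 1 + 1 / (k : ℝ)) hy1
    (lt_of_le_of_lt (hy2.trans hhigh) (mul_lt_mul_of_pos_left (three_sq_lt_pow hk hN) hz0))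
  have hg : Good T (z₀ * (1 + 1 / (k : ℝ)) ^ j) := by
    refine ⟨by positivity, f, S, hS, ?_⟩
    rcases hy with h | ⟨h, h'⟩
    · left; linarith
    · right; exact ⟨h, by linarith⟩
  have hfound := (hall e (hlt e heS).1 (f e) (hlt e heS).2 e' (hlt e' heS').1 (f e')
    (hlt e' heS').2 j hj _ rfl).2 hg
  refine le_trans ?_ hfound.2
  rw [div_le_iff₀ hq, mul_assoc, ← pow_succ]
  exact hj2.le

end Table

/-! ### Plans as solutions of an assignment problem -/

theorem table1_lt {α : Type} [Zero α] {n : ℕ} (f : Fin n → α) {i : ℕ} (h : i < n) :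
    table1 f i = f ⟨i, h⟩ := by simp [table1, h]

@[simp] theorem table1_fin {α : Type} [Zero α] {n : ℕ} (f : Fin n → α) (i : Fin n) :
    table1 f i = f i := by simp [table1]

theorem table1_ge {α : Type} [Zero α] {n : ℕ} (f : Fin n → α) {i : ℕ} (h : n ≤ i) :
    table1 f i = 0 := by simp [table1, Nat.not_lt.2 h]

@[simp] theorem table2_fin {α : Type} [Zero α] {n k : ℕ} (f : Fin n → Fin k → α) (i : Fin n)
    (t : Fin k) : table2 f i t = f i t := by simp [table2]

theorem table1_nonneg {n : ℕ} {f : Fin n → ℝ} (hf : ∀ i, 0 ≤ f i) (i : ℕ) : 0 ≤ table1 f i := by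
  rw [table1]; split_ifs
  · exact hf _
  · exact le_rfl

theorem table2_nonneg {n k : ℕ} {f : Fin n → Fin k → ℝ} (hf : ∀ i t, 0 ≤ f i t) (i t : ℕ) :
    0 ≤ table2 f i t :=
  table1_nonneg (fun _ => table1_nonneg (hf _) _) _

/-- A market with a budget, group quotas and a lower bound on the revenues of the organic products.
The sponsored products are displayed if `full`, and left out otherwise. -/
structure PlanData where
  M : Market
  full : Bool
  ρ : ℝ
  v : ℝ
  C : ℝ
  cost : Fin M.nO → ℝ
  group : Fin M.nO → ℕ
  γ : ℕ → ℕ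
  v_pos : 0 < v
  C_nonneg : 0 ≤ C
  cost_nonneg : ∀ j, 0 ≤ cost j

namespace PlanData

variable (D : PlanData)

/-- The number of rows for sponsored products. -/
def n₁ : ℕ := if D.full then D.M.nS else 0

/-- The number of rows and columns. -/
def N : ℕ := D.M.nO + D.M.k

/-- The group of a product. -/
def grp (j : ℕ) : ℕ := table1 D.group j

/-- The number of earlier products in the same group. -/
def rank (d : ℕ) : ℕ := ((Finset.range d).filter fun e => D.grp e = D.grp d).card

/-- The type of a pair. The columns below `k` are the positions, the others are places for the
organic products that are not displayed; the rows from `n₁ + nO` on stand for no product. -/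
noncomputable def ty (p q : ℕ) : ℕ :=
  open Classical in
  if p < D.n₁ then table2 (fun i t => if t ∈ D.M.valid i then 1 else 0) p q
  else if p < D.n₁ + D.M.nO then
    if q < D.M.k then
      if table1 (fun t => if t ∈ D.M.reserved then 1 else 0) q = 0 ∧
        D.ρ ≤ table1 (fun j => D.M.r (Sum.inr j)) (p - D.n₁) ∧
        table1 D.cost (p - D.n₁) ≤ D.C then 2 else 3
    else if D.grp (p - D.n₁) = D.grp (q - D.M.k) then 3 else 0
  else if q < D.M.k then 3
  else if D.rank (q - D.M.k) < D.γ (D.grp (q - D.M.k)) then 3 else 0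

/-- The revenue of a row. -/
noncomputable def rev (p : ℕ) : ℝ :=
  if p < D.n₁ then table1 (fun i => D.M.r (Sum.inl i)) p
  else table1 (fun j => D.M.r (Sum.inr j)) (p - D.n₁)

/-- The weight of a pair. -/
noncomputable def wt (p q : ℕ) : ℝ :=
  if p < D.n₁ then table2 (fun i t => D.M.w (Sum.inl i) t) p q
  else table2 (fun j t => D.M.w (Sum.inr j) t) (p - D.n₁) q

/-- The cost of a row. -/
noncomputable def cst (p : ℕ) : ℝ := if p < D.n₁ then 0 else table1 D.cost (p - D.n₁)

/-- The assignment problem. -/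
noncomputable def table : Table where
  N := D.N
  n₁ := D.n₁
  ty p q := if p < D.N ∧ q < D.N then D.ty p q else 0
  r p q := if p < D.N ∧ q < D.N then D.rev p else 0
  w p q := if p < D.N ∧ q < D.N then D.wt p q else 0
  c p := if p < D.N then D.cst p else 0
  v := D.v
  C := D.C

/-- The feasible plans. -/
structure Feasible (π : D.M.Plan) : Prop where
  seq : D.M.IsSequence π
  places : D.full = true → D.M.PlacesSponsored π
  noSponsored : D.full = false → ∀ t i, π t ≠ some (Sum.inl i)
  organic : ∀ t j, π t = some (Sum.inr j) → t ∉ D.M.reserved ∧ D.ρ ≤ D.M.r (Sum.inr j)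
  budget : ∑ j ∈ D.M.organicSet π, D.cost j ≤ D.C
  quota : ∀ q, ((D.M.organicSet π).filter fun j => D.group j = q).card ≤ D.γ q

/-- The row of a product. -/
def row : D.M.Product → ℕ
  | Sum.inl i => i
  | Sum.inr j => D.n₁ + j

variable {D}

theorem nS_le_k : D.M.nS ≤ D.M.k := by
  rw [← D.M.card_reserved]
  simpa using Finset.card_le_univ D.M.reserved

theorem n₁_le : D.n₁ ≤ D.M.k := by
  unfold n₁; split_ifs
  · exact nS_le_k
  · exact Nat.zero_le _

theorem n₁_full (h : D.full = true) : D.n₁ = D.M.nS := by simp [n₁, h]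

theorem n₁_not (h : D.full = false) : D.n₁ = 0 := by simp [n₁, h]

theorem full_of_lt {p : ℕ} (h : p < D.n₁) : D.full = true ∧ p < D.M.nS := by
  unfold n₁ at h
  split_ifs at h with h1
  · exact ⟨h1, h⟩
  · omega

theorem ty_sponsored {p q : ℕ} (hp : p < D.n₁) :
    (D.ty p q = 1 ∧ ∃ (h : p < D.M.nS) (t : Fin D.M.k), (t : ℕ) = q ∧ t ∈ D.M.valid ⟨p, h⟩) ∨
    (D.ty p q = 0 ∧ ∀ (h : p < D.M.nS) (t : Fin D.M.k), (t : ℕ) = q → t ∉ D.M.valid ⟨p, h⟩) := by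
  have h := (full_of_lt hp).2
  rw [ty, if_pos hp, table2, table1_lt _ h]
  by_cases hq : q < D.M.k
  · rw [table1_lt _ hq]
    by_cases hv : (⟨q, hq⟩ : Fin D.M.k) ∈ D.M.valid ⟨p, h⟩
    · exact Or.inl ⟨by simp [hv], h, ⟨q, hq⟩, rfl, hv⟩
    · refine Or.inr ⟨by simp [hv], fun _ t ht => ?_⟩
      subst ht; exact hv
  -- Outside the positions the tabulated validity is `0`, which is also the type of a forbidden
  -- pair: a sponsored row cannot move to a place for undisplayed products.
  · rw [table1_ge _ (not_lt.1 hq)]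
    exact Or.inr ⟨rfl, fun _ t ht => absurd (ht ▸ t.2) hq⟩

theorem ty_organic (j : Fin D.M.nO) (t : Fin D.M.k) : D.ty (D.n₁ + j) t =
    open Classical in
    if t ∉ D.M.reserved ∧ D.ρ ≤ D.M.r (Sum.inr j) ∧ D.cost j ≤ D.C then 2 else 3 := by
  classical
  have h1 : ¬ (D.n₁ + j < D.n₁) := by omega
  have h2 : D.n₁ + (j : ℕ) < D.n₁ + D.M.nO := by omega
  rw [ty, if_neg h1, if_pos h2, if_pos t.2]
  simp only [Nat.add_sub_cancel_left, table1_fin]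
  by_cases ht : t ∈ D.M.reserved <;> simp [ht]

theorem ty_organic_ge (j : Fin D.M.nO) {q : ℕ} (hq : D.M.k ≤ q) : D.ty (D.n₁ + j) q =
    if D.group j = D.grp (q - D.M.k) then 3 else 0 := by
  have h1 : ¬ (D.n₁ + j < D.n₁) := by omega
  have h2 : D.n₁ + (j : ℕ) < D.n₁ + D.M.nO := by omega
  rw [ty, if_neg h1, if_pos h2, if_neg (by omega)]
  simp only [grp, Nat.add_sub_cancel_left, table1_fin]
  by_cases h : D.group j = table1 D.group (q - D.M.k) <;> simp [h]

theorem ty_null {p q : ℕ} (hp : D.n₁ + D.M.nO ≤ p) : D.ty p q =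
    if q < D.M.k then 3 else if D.rank (q - D.M.k) < D.γ (D.grp (q - D.M.k)) then 3 else 0 := by
  rw [ty, if_neg (by omega), if_neg (by omega)]

theorem table_ty {p q : ℕ} (hp : p < D.N) (hq : q < D.N) : D.table.ty p q = D.ty p q := by
  simp [table, hp, hq]

/-- The row is a sponsored, an organic or an empty one. -/
theorem row_cases (D : PlanData) (p : ℕ) : p < D.n₁ ∨ (∃ j : Fin D.M.nO, p = D.n₁ + j) ∨
    D.n₁ + D.M.nO ≤ p := by
  by_cases h1 : p < D.n₁
  · exact Or.inl h1
  by_cases h2 : p < D.n₁ + D.M.nO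
  · exact Or.inr (Or.inl ⟨⟨p - D.n₁, by omega⟩, by simp; omega⟩)
  · exact Or.inr (Or.inr (by omega))

theorem row_lt (j : Fin D.M.nO) : D.n₁ + j < D.N := by
  have := D.n₁_le
  have := j.2
  unfold N; omega

theorem col_lt (t : Fin D.M.k) : (t : ℕ) < D.N := by
  have := t.2
  unfold N; omega

/-- An allowed permutation maps the sponsored rows onto the reserved positions. -/
theorem lt_n₁_iff {f : ℕ → ℕ} (hf : D.table.Allowed f) (hfull : D.full = true) {p : ℕ}
    (hp : p < D.N) : p < D.n₁ ↔ ∃ t ∈ D.M.reserved, (t : ℕ) = f p := by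
  have hn : D.n₁ ≤ D.N := by have := D.n₁_le; unfold N; omega
  have h1 : ∀ p < D.n₁, ∃ t ∈ D.M.reserved, (t : ℕ) = f p := by
    intro p hp
    have hpN := hp.trans_le hn
    have h0 := hf.2 p hpN
    rw [table_ty hpN (hf.1.1 p hpN)] at h0
    rcases ty_sponsored (q := f p) hp with ⟨_, h, t, ht, hv⟩ | h
    · exact ⟨t, D.M.valid_subset _ hv, ht⟩
    · exact absurd h.1 h0
  refine ⟨h1 p, fun ⟨t, ht, htp⟩ => ?_⟩
  -- An injection of the sponsored rows into the reserved positions is onto, because the two sets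
  -- have the same cardinality.
  have hsub : (Finset.range D.n₁).image f ⊆ D.M.reserved.image (fun t : Fin D.M.k => (t : ℕ)) := by
    intro q hq
    obtain ⟨p, hp, rfl⟩ := Finset.mem_image.1 hq
    obtain ⟨t, ht, e⟩ := h1 p (Finset.mem_range.1 hp)
    exact Finset.mem_image.2 ⟨t, ht, e⟩
  have hcard : (D.M.reserved.image (fun t : Fin D.M.k => (t : ℕ))).card ≤
      ((Finset.range D.n₁).image f).card := by
    rw [Finset.card_image_of_injective _ Fin.val_injective, D.M.card_reserved,
      Finset.card_image_of_injOn, Finset.card_range, n₁_full hfull]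
    intro a ha b hb e
    exact hf.1.2 a ((by simpa using ha : a < D.n₁).trans_le hn) b
      ((by simpa using hb : b < D.n₁).trans_le hn) e
  have heq := Finset.eq_of_subset_of_card_le hsub hcard
  have : f p ∈ (Finset.range D.n₁).image f := by
    rw [heq]; exact Finset.mem_image.2 ⟨t, ht, htp⟩
  obtain ⟨a, ha, e⟩ := Finset.mem_image.1 this
  rw [Finset.mem_range] at ha
  rw [hf.1.2 p hp a (ha.trans_le hn) e.symm]; exact ha

/-- The substantial condition is `mix`. Every allowed permutation sends the sponsored rows onto the
same set, the reserved positions. Hence the sponsored part of one and the remainder of another never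
collide. -/
theorem table_valid : D.table.Valid := by
  have hn : D.n₁ ≤ D.N := by have := D.n₁_le; unfold N; omega
  refine ⟨D.v_pos, D.C_nonneg, ?_, ?_, ?_, ?_, ?_, ?_, ?_⟩
  · intro p hp q hq
    have : D.table.r p q = D.rev p := if_pos ⟨hp, hq⟩
    rw [this, rev]; split_ifs
    · exact table1_nonneg (fun i => D.M.r_nonneg _) _
    · exact table1_nonneg (fun i => D.M.r_nonneg _) _
  · intro p hp q hq
    have : D.table.w p q = D.wt p q := if_pos ⟨hp, hq⟩
    rw [this, wt]; split_ifs
    · exact table2_nonneg (fun i t => D.M.w_nonneg _ _) _ _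
    · exact table2_nonneg (fun i t => D.M.w_nonneg _ _) _ _
  · intro p hp
    have : D.table.c p = D.cst p := if_pos hp
    rw [this, cst]; split_ifs
    · exact le_rfl
    · exact table1_nonneg D.cost_nonneg _
  · intro p hp q hq h
    have hc : D.table.c p = D.cst p := if_pos hp
    rw [table_ty hp hq] at h
    rw [hc, cst]
    rcases D.row_cases p with h1 | ⟨j, rfl⟩ | h1
    · rw [if_pos h1]; exact D.C_nonneg
    · rw [if_neg (by omega), Nat.add_sub_cancel_left, table1_fin]
      by_cases hqk : q < D.M.k
      · have := ty_organic j ⟨q, hqk⟩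
        simp only at this
        rw [this] at h
        split_ifs at h with h2
        · exact h2.2.2
        · omega
      · rw [ty_organic_ge j (not_lt.1 hqk)] at h
        split_ifs at h
        all_goals omega
    · rw [ty_null h1] at h
      split_ifs at h
      all_goals omega
  · intro p hp q hq
    rw [table_ty (show p < D.N from (show p < D.n₁ from hp).trans_le hn) hq]
    rcases ty_sponsored (q := q) hp with h | h <;> rw [h.1] <;> decide
  · intro p hp hp1 q hq
    rw [table_ty hp hq]
    rcases D.row_cases p with h1 | ⟨j, rfl⟩ | h1
    · exact absurd hp1 (not_le.2 h1)
    · by_cases hqk : q < D.M.k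
      · have := ty_organic j ⟨q, hqk⟩
        simp only at this
        rw [this]; split_ifs <;> decide
      · rw [ty_organic_ge j (not_lt.1 hqk)]; split_ifs <;> decide
    · rw [ty_null h1]; split_ifs <;> decide
  · intro f g hf hg
    rcases hfull : D.full with _ | _
    · have : D.table.n₁ = 0 := n₁_not hfull
      simpa [this] using hg
    · refine ⟨⟨fun p hp => ?_, fun p hp q hq e => ?_⟩, fun p hp => ?_⟩
      · dsimp only; split_ifs
        · exact hf.1.1 p hp
        · exact hg.1.1 p hp
      · have key : ∀ p < D.N, ∀ q < D.N, p < D.n₁ → ¬ q < D.n₁ → f p ≠ g q := by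
          intro p hp q hq hp1 hq1 e
          obtain ⟨t, ht, e'⟩ := (lt_n₁_iff hf hfull hp).1 hp1
          exact hq1 ((lt_n₁_iff hg hfull hq).2 ⟨t, ht, e'.trans e⟩)
        dsimp only at e
        split_ifs at e with h1 h2 h2
        · exact hf.1.2 p hp q hq e
        · exact absurd e (key p hp q hq h1 h2)
        · exact absurd e.symm (key q hq p hp h2 h1)
        · exact hg.1.2 p hp q hq e
      · dsimp only; split_ifs
        · exact hf.2 p hp
        · exact hg.2 p hp

/-- The plan `π` displays the counted rows in the positions given by `f`. -/
structure Rel (D : PlanData) (f : ℕ → ℕ) (S : Finset ℕ) (π : D.M.Plan) : Prop where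
  shown : ∀ t x, π t = some x → D.row x ∈ S ∧ f (D.row x) = t ∧ (x.isLeft = true → D.full = true)
  counted : ∀ p ∈ S, ∃ (t : Fin D.M.k) (x : D.M.Product), f p = t ∧ D.row x = p ∧ π t = some x

/-- `f` is a bijection between the counted rows and the occupied positions. Weights, revenues and
costs are all compared through this one identity. -/
theorem Rel.sum_eq {f : ℕ → ℕ} {S : Finset ℕ} {π : D.M.Plan} (h : Rel D f S π)
    (hf : ∀ p ∈ S, ∀ q ∈ S, f p = f q → p = q) (F : ℕ → ℕ → ℝ) :
    ∑ p ∈ S, F p (f p) = ∑ t, (π t).elim 0 (fun x => F (D.row x) t) := by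
  have h1 : ∀ t : Fin D.M.k, (π t).elim 0 (fun x => F (D.row x) t) =
      ∑ p ∈ S, if f p = t then F p (f p) else 0 := by
    intro t
    cases hπ : π t with
    | none =>
      refine (Finset.sum_eq_zero fun p hp => ?_).symm
      rw [if_neg]
      intro e
      obtain ⟨t', x, e', _, hx⟩ := h.counted p hp
      have : t = t' := Fin.ext (e.symm.trans e')
      rw [← this, hπ] at hx
      exact absurd hx (by simp)
    | some x =>
      obtain ⟨hxS, hxt, _⟩ := h.shown t x hπ
      rw [Finset.sum_eq_single (D.row x)]
      · simp [hxt]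
      · intro p hp hne
        rw [if_neg]
        intro e
        exact hne (hf p hp _ hxS (e.trans hxt.symm))
      · exact fun h => absurd hxS h
  simp only [h1]
  rw [Finset.sum_comm]
  refine Finset.sum_congr rfl fun p hp => ?_
  obtain ⟨t, x, e, _, _⟩ := h.counted p hp
  rw [Finset.sum_eq_single t]
  · simp [e]
  · intro t' _ hne
    rw [if_neg]
    intro e'
    exact hne (Fin.ext (e'.symm.trans e))
  · simp

theorem table_w_row {x : D.M.Product} (hx : x.isLeft = true → D.full = true) (t : Fin D.M.k) :
    D.table.w (D.row x) t = D.M.w x t ∧ D.table.r (D.row x) t = D.M.r x := by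
  cases x with
  | inl i =>
    have hn := n₁_full (hx rfl)
    have hi : (i : ℕ) < D.n₁ := by rw [hn]; exact i.2
    have hiN : (i : ℕ) < D.N := hi.trans_le (by have := D.n₁_le; unfold N; omega)
    simp [table, row, hiN, col_lt t, wt, rev, hi]
  | inr j =>
    simp [table, row, row_lt j, col_lt t, wt, rev]

theorem Rel.value_eq {f : ℕ → ℕ} {S : Finset ℕ} {π : D.M.Plan} (h : Rel D f S π)
    (hS : D.table.IsSol f S) : D.table.value f S = D.M.revenue D.v π := by
  have hf : ∀ p ∈ S, ∀ q ∈ S, f p = f q → p = q := fun p hp q hq e =>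
    hS.allowed.1.2 p (hS.counted p hp).1 q (hS.counted q hq).1 e
  have hw : ∑ p ∈ S, D.table.w p (f p) = D.M.totalWeight π := by
    rw [h.sum_eq hf, Market.totalWeight]
    refine Finset.sum_congr rfl fun t _ => ?_
    cases hπ : π t with
    | none => rfl
    | some x => exact (table_w_row (h.shown t x hπ).2.2 t).1
  have hrw : ∑ p ∈ S, D.table.r p (f p) * D.table.w p (f p) =
      ∑ t, (π t).elim 0 (fun x => D.M.r x * D.M.w x t) := by
    rw [h.sum_eq hf (fun p q => D.table.r p q * D.table.w p q)]
    refine Finset.sum_congr rfl fun t _ => ?_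
    cases hπ : π t with
    | none => rfl
    | some x =>
      have := table_w_row (h.shown t x hπ).2.2 t
      simp [this.1, this.2]
  rw [Table.value, hw, hrw, Market.revenue, Finset.sum_div]
  refine Finset.sum_congr rfl fun t _ => ?_
  cases π t with
  | none => simp
  | some x => exact mul_div_assoc _ _ _

/-- Among the first `n` products, `min (γ q) _` products of the group `q` have rank below `γ q`. -/
theorem card_rank_lt (D : PlanData) (q g n : ℕ) :
    ((Finset.range n).filter fun d => D.grp d = q ∧ D.rank d < g).card =
      min g ((Finset.range n).filter fun d => D.grp d = q).card := by
  induction n with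
  | zero => simp
  | succ n ih =>
    rw [Finset.range_add_one, Finset.filter_insert, Finset.filter_insert]
    by_cases hq : D.grp n = q
    · have hr : D.rank n = ((Finset.range n).filter fun d => D.grp d = q).card := by
        rw [rank, hq]
      rw [if_pos hq, Finset.card_insert_of_notMem (by simp)]
      by_cases hg : D.rank n < g
      · rw [if_pos ⟨hq, hg⟩, Finset.card_insert_of_notMem (by simp), ih]
        omega
      · rw [if_neg (by tauto), ih]
        omega
    · rw [if_neg (by tauto), if_neg hq, ih]

end PlanData

/-! ### Feasible plans correspond to solutions of the assignment problem. -/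

namespace PlanData

variable {D : PlanData}

/-- Without sponsored rows the organic rows start at `0` and would clash with the numbers of the
sponsored products; the hypotheses exclude these products in that case. -/
theorem row_injective {x y : D.M.Product} (hx : x.isLeft = true → D.full = true)
    (hy : y.isLeft = true → D.full = true) (h : D.row x = D.row y) : x = y := by
  cases x with
  | inl i =>
    have hi := i.2
    have hn := n₁_full (hx rfl)
    cases y with
    | inl i' => exact congrArg Sum.inl (Fin.ext h)
    | inr j => simp only [row] at h; omega
  | inr j =>
    cases y with
    | inl i =>
      have hi := i.2
      have hn := n₁_full (hy rfl)
      simp only [row] at h; omega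
    | inr j' => exact congrArg Sum.inr (Fin.ext (by simp only [row] at h; omega))

theorem row_lt_N {x : D.M.Product} (hx : x.isLeft = true → D.full = true) : D.row x < D.N := by
  cases x with
  | inl i =>
    have hi := i.2
    have hn := n₁_full (hx rfl)
    have := D.n₁_le
    simp only [row, N]; omega
  | inr j => exact row_lt j

theorem table_c_row (j : Fin D.M.nO) : D.table.c (D.row (Sum.inr j)) = D.cost j := by
  simp [table, row, row_lt j, cst]

theorem sum_organicSet {M : Market} {π : M.Plan} (h : M.IsSequence π) (c : Fin M.nO → ℝ) :
    ∑ t, (π t).elim 0 (Sum.elim (fun _ => 0) c) = ∑ j ∈ M.organicSet π, c j := by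
  have h1 : ∀ t, (π t).elim 0 (Sum.elim (fun _ => 0) c) =
      ∑ j, if π t = some (Sum.inr j) then c j else 0 := by
    intro t
    cases hπ : π t with
    | none => simp
    | some x =>
      cases x with
      | inl i => simp
      | inr j => simp
  simp only [h1]
  rw [Finset.sum_comm, Market.organicSet, Finset.sum_filter]
  refine Finset.sum_congr rfl fun j _ => ?_
  split_ifs with h2
  · obtain ⟨t, ht⟩ := h2
    rw [Finset.sum_eq_single t]
    · rw [if_pos ht]
    · intro t' _ hne
      exact if_neg fun e => hne (h _ _ _ e ht)
    · simp
  · exact Finset.sum_eq_zero fun t _ => if_neg fun e => h2 ⟨t, e⟩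

/-- Sponsored rows have no pairs of type `2`, so exactly the displayed organic products are charged.
-/
theorem Rel.budget_eq {f : ℕ → ℕ} {S : Finset ℕ} {π : D.M.Plan} (h : Rel D f S π)
    (hf : ∀ p ∈ S, ∀ q ∈ S, f p = f q → p = q) (hseq : D.M.IsSequence π)
    (hty : ∀ t j, π t = some (Sum.inr j) → D.table.ty (D.n₁ + j) t = 2) :
    ∑ p ∈ S, (if D.table.ty p (f p) = 2 then D.table.c p else 0) =
      ∑ j ∈ D.M.organicSet π, D.cost j := by
  rw [h.sum_eq hf (fun p q => if D.table.ty p q = 2 then D.table.c p else 0),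
    ← sum_organicSet hseq]
  refine Finset.sum_congr rfl fun t _ => ?_
  cases hπ : π t with
  | none => rfl
  | some x =>
    cases x with
    | inl i =>
      have hg := h.shown t _ hπ
      have hn := n₁_full (hg.2.2 rfl)
      have hlow := table_valid.low (T := D.table) i
        (by rw [show D.table.n₁ = D.M.nS from hn]; exact i.2) t (col_lt t)
      exact if_neg hlow
    | inr j =>
      have := hty t j hπ
      exact (if_pos this).trans (table_c_row j)

/-- The counted rows of a solution stand for products in usable positions. -/
theorem counted_cases {f : ℕ → ℕ} {S : Finset ℕ} (hS : D.table.IsSol f S) {p : ℕ} (hp : p ∈ S) :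
    ∃ (x : D.M.Product) (t : Fin D.M.k), (x.isLeft = true → D.full = true) ∧ D.row x = p ∧
      f p = t ∧ ∀ j, x = Sum.inr j → t ∉ D.M.reserved ∧ D.ρ ≤ D.M.r (Sum.inr j) ∧
        D.table.ty (D.n₁ + j) t = 2 := by
  obtain ⟨hpN, hty⟩ := hS.counted p hp
  have hfp := hS.allowed.1.1 p hpN
  rcases D.row_cases p with h1 | ⟨j, rfl⟩ | h1
  · rw [table_ty hpN hfp] at hty
    rcases ty_sponsored (q := f p) h1 with ⟨_, h, t, ht, hv⟩ | h
    · exact ⟨Sum.inl ⟨p, h⟩, t, fun _ => (full_of_lt h1).1, rfl, ht.symm, fun j hj => by simp at hj⟩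
    · omega
  · have h2 : D.table.ty (D.n₁ + j) (f (D.n₁ + j)) = 2 :=
      hty.resolve_left (table_valid.high _ hpN (Nat.le_add_right _ _) _ hfp)
    have h3 := h2
    rw [table_ty hpN hfp] at h2
    by_cases hk : f (D.n₁ + j) < D.M.k
    · refine ⟨Sum.inr j, ⟨_, hk⟩, by simp, rfl, rfl, fun j' hj' => ?_⟩
      obtain rfl := Sum.inr_injective hj'
      have h4 := ty_organic j ⟨_, hk⟩
      simp only at h4
      rw [h4] at h2
      split_ifs at h2 with h5
      · exact ⟨h5.1, h5.2.1, h3⟩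
      · omega
    · rw [ty_organic_ge j (not_lt.1 hk)] at h2
      split_ifs at h2
      all_goals omega
  · rw [table_ty hpN hfp, ty_null h1] at hty
    rcases hty with h | h <;> split_ifs at h <;> omega

/-- Every solution of the assignment problem comes from a feasible plan. -/
theorem exists_plan {f : ℕ → ℕ} {S : Finset ℕ} (hS : D.table.IsSol f S) :
    ∃ π, Rel D f S π ∧ D.Feasible π := by
  classical
  have hinj : ∀ p ∈ S, ∀ q ∈ S, f p = f q → p = q := fun p hp q hq e =>
    hS.allowed.1.2 p (hS.counted p hp).1 q (hS.counted q hq).1 e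
  let P : Fin D.M.k → D.M.Product → Prop := fun t x =>
    (x.isLeft = true → D.full = true) ∧ D.row x ∈ S ∧ f (D.row x) = t
  let π : D.M.Plan := fun t => if h : ∃ x, P t x then some h.choose else none
  have hπ : ∀ t x, π t = some x ↔ P t x := by
    intro t x
    by_cases h : ∃ x, P t x
    · have e : π t = some h.choose := dif_pos h
      have hc := h.choose_spec
      rw [e, Option.some_inj]
      refine ⟨fun e => e ▸ hc, fun hx => row_injective hc.1 hx.1 ?_⟩
      exact hinj _ hc.2.1 _ hx.2.1 (hc.2.2.trans hx.2.2.symm)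
    · have e : π t = none := dif_neg h
      rw [e]
      exact ⟨fun h => by simp at h, fun hx => absurd ⟨x, hx⟩ h⟩
  have hrel : Rel D f S π := by
    refine ⟨fun t x h => ?_, fun p hp => ?_⟩
    · have := (hπ t x).1 h
      exact ⟨this.2.1, this.2.2, this.1⟩
    · obtain ⟨x, t, hg, hx, ht, _⟩ := counted_cases hS hp
      exact ⟨t, x, ht, hx, (hπ t x).2 ⟨hg, by rwa [hx], by rw [hx, ht]⟩⟩
  have horg : ∀ t j, π t = some (Sum.inr j) → t ∉ D.M.reserved ∧ D.ρ ≤ D.M.r (Sum.inr j) ∧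
        D.table.ty (D.n₁ + j) t = 2 := by
    intro t j h
    obtain ⟨hg, hS', ht⟩ := (hπ t _).1 h
    obtain ⟨x, t', hg', hx, ht', hj⟩ := counted_cases hS hS'
    have : t = t' := Fin.ext (ht.symm.trans ht')
    subst this
    exact hj j (row_injective hg' hg hx)
  have hseq : D.M.IsSequence π := by
    intro t t' x h h'
    exact Fin.ext (((hπ t x).1 h).2.2.symm.trans ((hπ t' x).1 h').2.2)
  refine ⟨π, hrel, hseq, fun hfull i => ?_, fun hfull t i h => ?_, fun t j h => ?_, ?_, fun q => ?_⟩
  · have hi : (i : ℕ) < D.n₁ := by rw [n₁_full hfull]; exact i.2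
    have hiN : (i : ℕ) < D.N := row_lt_N (x := Sum.inl i) fun _ => hfull
    have hfi := hS.allowed.1.1 i hiN
    rcases ty_sponsored (q := f i) hi with ⟨h1, _, t, ht, hv⟩ | h
    · refine ⟨t, hv, (hπ _ _).2 ⟨fun _ => hfull, hS.forced i hiN ?_, ht.symm⟩⟩
      rw [table_ty hiN hfi]; exact h1
    · have := hS.allowed.2 i hiN
      rw [table_ty hiN hfi] at this
      exact absurd h.1 this
  · have := ((hπ _ _).1 h).1 rfl
    rw [hfull] at this; exact absurd this (by decide)
  · exact ⟨(horg t j h).1, (horg t j h).2.1⟩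
  · rw [← hrel.budget_eq hinj hseq fun t j h => (horg t j h).2.2]
    exact hS.budget
  -- The quota: a place of rank at least `γ q` in group `q` is closed to empty rows and to other
  -- groups, so it holds an undisplayed product of the group. Counting these places leaves at most
  -- `γ q` displayed products.
  · set A := ((D.M.organicSet π).filter fun j => D.group j = q).image (fun j : Fin D.M.nO => (j : ℕ))
      with hA
    set G := (Finset.range D.M.nO).filter fun d => D.grp d = q
    have hAcard : A.card = ((D.M.organicSet π).filter fun j => D.group j = q).card :=
      Finset.card_image_of_injective _ Fin.val_injective
    have hAG : A ⊆ G := by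
      intro d hd
      obtain ⟨j, hj, rfl⟩ := Finset.mem_image.1 hd
      exact Finset.mem_filter.2 ⟨Finset.mem_range.2 j.2, by
        rw [grp, table1_fin]; exact (Finset.mem_filter.1 hj).2⟩
    have hsplit := Finset.card_filter_add_card_filter_not (s := G) (fun d => D.rank d < D.γ q)
    rw [Finset.filter_filter, card_rank_lt] at hsplit
    have hle : (G.filter fun d => ¬ D.rank d < D.γ q).card ≤ (G \ A).card := by
      apply Finset.card_le_card_of_surjOn (fun j => f (D.n₁ + j) - D.M.k)
      intro d hd
      simp only [Finset.coe_filter, Set.mem_ofPred_eq, G, Finset.mem_filter, Finset.mem_range] at hd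
      obtain ⟨⟨hd1, hd2⟩, hd3⟩ := hd
      have hdN : D.M.k + d < D.N := by unfold N; omega
      obtain ⟨p, hp, hfp⟩ := hS.allowed.1.surj hdN
      have h0 := hS.allowed.2 p hp
      rw [hfp, table_ty hp hdN] at h0
      rcases D.row_cases p with h1 | ⟨j, rfl⟩ | h1
      · rcases ty_sponsored (q := D.M.k + d) h1 with ⟨_, _, t, ht, _⟩ | h
        · have := t.2; omega
        · exact absurd h.1 h0
      · rw [ty_organic_ge j (Nat.le_add_right _ _), Nat.add_sub_cancel_left] at h0
        have hjq : D.group j = q := by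
          by_contra hne
          exact h0 (if_neg (by rw [hd2]; exact hne))
        refine ⟨j, ?_, by simp [hfp]⟩
        simp only [Finset.coe_sdiff, Set.mem_sdiff, Finset.mem_coe]
        refine ⟨Finset.mem_filter.2 ⟨Finset.mem_range.2 j.2, by rw [grp, table1_fin]; exact hjq⟩, ?_⟩
        intro hjA
        obtain ⟨j', hj', e⟩ := Finset.mem_image.1 hjA
        obtain rfl := Fin.ext e
        obtain ⟨t, ht⟩ := (Finset.mem_filter.1 (Finset.mem_filter.1 hj').1).2
        have := ((hπ _ _).1 ht).2.2
        have ht2 := t.2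
        simp only [row] at this; omega
      · rw [ty_null h1, if_neg (by omega), Nat.add_sub_cancel_left, hd2, if_neg hd3] at h0
        exact absurd rfl h0
    rw [Finset.card_sdiff_of_subset hAG] at hle
    have := Finset.card_le_card hAG
    omega

/-- A permutation that preserves the classes of `g` and maps `A` into `B`. -/
theorem exists_injective_mapsTo {α : Type} [Fintype α] [DecidableEq α] (g : α → ℕ)
    (A B : Finset α)
    (h : ∀ q, (A.filter fun a => g a = q).card ≤ (B.filter fun a => g a = q).card) :
    ∃ σ : α → α, Function.Injective σ ∧ (∀ a, g (σ a) = g a) ∧ ∀ a ∈ A, σ a ∈ B := by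
  have key : ∀ q, ∃ σ : {a // g a = q} → {a // g a = q}, Function.Injective σ ∧
      ∀ a, a.1 ∈ A → (σ a).1 ∈ B := by
    intro q
    have e : ∀ X : Finset α, Fintype.card {a : {a // g a = q} // a.1 ∈ X} =
        (X.filter fun a => g a = q).card := by
      intro X
      rw [Fintype.card_subtype, ← Finset.card_map (Function.Embedding.subtype _)]
      congr 1
      ext a
      simp
    obtain ⟨i⟩ := Function.Embedding.nonempty_of_card_le
      (α := {a : {a // g a = q} // a.1 ∈ A}) (β := {a : {a // g a = q} // a.1 ∈ B})
      (by rw [e, e]; exact h q)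
    -- Within one class, the injection of the members of `A` into those of `B` extends to a
    -- permutation of the class.
    obtain ⟨F, hF⟩ := Finset.exists_equiv_extend_of_card_eq (α := {a // g a = q})
      (β := {a // g a = q}) (t := Finset.univ) (by simp)
      (s := Finset.univ.filter fun a => a.1 ∈ A)
      (f := fun a => if h : a.1 ∈ A then (i ⟨a, h⟩).1 else a) (Finset.subset_univ _) (by
        intro a ha b hb hab
        simp only [Finset.coe_filter, Finset.mem_univ, true_and, Set.mem_ofPred_eq] at ha hb
        simp only [dif_pos ha, dif_pos hb] at hab
        have := i.injective (Subtype.ext hab)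
        exact congrArg Subtype.val this)
    refine ⟨fun a => (F a).1, fun a b hab => F.injective (Subtype.ext hab), fun a ha => ?_⟩
    have := hF a (by simpa using ha)
    simp only [dif_pos ha] at this
    simp only [this]
    exact (i ⟨a, ha⟩).2
  choose σ hσ hσ' using key
  refine ⟨fun a => (σ (g a) ⟨a, rfl⟩).1, ?_, fun a => (σ (g a) ⟨a, rfl⟩).2, fun a ha => hσ' _ _ ha⟩
  intro a b hab
  have hab' : (σ (g a) ⟨a, rfl⟩).1 = (σ (g b) ⟨b, rfl⟩).1 := hab
  have hg : g b = g a := by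
    rw [← (σ (g a) ⟨a, rfl⟩).2, hab', (σ (g b) ⟨b, rfl⟩).2]
  have : ∀ q (hq : g b = q), (σ (g b) ⟨b, rfl⟩).1 = (σ q ⟨b, hq⟩).1 := by
    rintro q rfl; rfl
  rw [this _ hg] at hab'
  exact congrArg Subtype.val (hσ _ (Subtype.ext hab'))

/-- Every feasible plan comes from a solution of the assignment problem. -/
theorem exists_isSol {π : D.M.Plan} (hπ : D.Feasible π) :
    ∃ f S, D.table.IsSol f S ∧ Rel D f S π := by
  classical
  have hgrp : ∀ j : Fin D.M.nO, D.grp j = D.group j := fun j => table1_fin _ _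
  -- places for the products that are not displayed
  obtain ⟨σ, hσ, hσg, hσA⟩ := exists_injective_mapsTo D.group (D.M.organicSet π)
    (Finset.univ.filter fun d : Fin D.M.nO => D.rank d < D.γ (D.group d)) (by
      intro q
      have e : ((Finset.univ.filter fun d : Fin D.M.nO => D.rank d < D.γ (D.group d)).filter
          fun a => D.group a = q).card =
          ((Finset.range D.M.nO).filter fun d => D.grp d = q ∧ D.rank d < D.γ q).card := by
        rw [← Finset.card_image_of_injective _ (Fin.val_injective (n := D.M.nO))]
        congr 1
        ext d
        simp only [Finset.mem_image, Finset.mem_filter, Finset.mem_univ, true_and,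
          Finset.mem_range]
        constructor
        · rintro ⟨j, ⟨h1, h2⟩, rfl⟩
          rw [h2] at h1
          exact ⟨j.2, by rw [hgrp]; exact h2, h1⟩
        · rintro ⟨h1, h2, h3⟩
          have h4 : D.group ⟨d, h1⟩ = q := by rw [← hgrp]; exact h2
          exact ⟨⟨d, h1⟩, ⟨by rw [h4]; exact h3, h4⟩, rfl⟩
      have e' : ((Finset.univ : Finset (Fin D.M.nO)).filter fun j => D.group j = q).card =
          ((Finset.range D.M.nO).filter fun d => D.grp d = q).card := by
        rw [← Finset.card_image_of_injective _ (Fin.val_injective (n := D.M.nO))]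
        congr 1
        ext d
        simp only [Finset.mem_image, Finset.mem_filter, Finset.mem_univ, true_and,
          Finset.mem_range]
        constructor
        · rintro ⟨j, h1, rfl⟩
          exact ⟨j.2, by rw [hgrp]; exact h1⟩
        · rintro ⟨h1, h2⟩
          exact ⟨⟨d, h1⟩, by rw [← hgrp]; exact h2, rfl⟩
      rw [e, card_rank_lt, ← e']
      exact le_min (hπ.quota q)
        (Finset.card_le_card (Finset.filter_subset_filter _ (Finset.subset_univ _))))
  have hσs : Function.Surjective σ := Finite.surjective_of_injective hσ
  -- An undisplayed product `j` goes to the place `σ j`. The places left over are the images of the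
  -- displayed products, and `σ` was chosen so that these have rank below the quota and may stay
  -- empty.
  let F : D.M.Product → ℕ := fun x => if h : ∃ t, π t = some x then h.choose
    else x.elim (fun _ => 0) (fun j => D.M.k + σ j)
  have hF : ∀ t x, π t = some x → F x = t := by
    intro t x h
    have h' : ∃ t, π t = some x := ⟨t, h⟩
    have e : F x = h'.choose := dif_pos h'
    rw [e, hπ.seq _ _ _ h'.choose_spec h]
  have hF' : ∀ j, j ∉ D.M.organicSet π → F (Sum.inr j) = D.M.k + σ j := by
    intro j h
    exact dif_neg fun h' => h (Finset.mem_filter.2 ⟨Finset.mem_univ _, h'⟩)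
  have hcase : ∀ x : D.M.Product, (x.isLeft = true → D.full = true) →
      (∃ t, π t = some x) ∨ ∃ j, x = Sum.inr j ∧ j ∉ D.M.organicSet π := by
    intro x hx
    cases x with
    | inl i =>
      obtain ⟨t, _, h⟩ := hπ.places (hx rfl) i
      exact Or.inl ⟨t, h⟩
    | inr j =>
      by_cases h : ∃ t, π t = some (Sum.inr j)
      · exact Or.inl h
      · exact Or.inr ⟨j, rfl, fun h' => h (Finset.mem_filter.1 h').2⟩
  have hshown : ∀ t x, π t = some x → x.isLeft = true → D.full = true := by
    intro t x h hx
    cases x with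
    | inl i =>
      by_contra hfull
      exact hπ.noSponsored (by simpa using hfull) t i h
    | inr j => simp at hx
  have hFlt : ∀ x : D.M.Product, (x.isLeft = true → D.full = true) → F x < D.N := by
    intro x hx
    rcases hcase x hx with ⟨t, h⟩ | ⟨j, rfl, h⟩
    · rw [hF t x h]; exact col_lt t
    · rw [hF' j h]
      have := (σ j).2
      unfold N; omega
  have hFinj : ∀ x y : D.M.Product, (x.isLeft = true → D.full = true) →
      (y.isLeft = true → D.full = true) → F x = F y → x = y := by
    intro x y hx hy e
    rcases hcase x hx with ⟨t, h⟩ | ⟨j, rfl, h⟩ <;> rcases hcase y hy with ⟨t', h'⟩ | ⟨j', rfl, h'⟩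
    · rw [hF t x h, hF t' y h'] at e
      rw [Fin.ext e, h'] at h
      exact (Option.some_inj.1 h).symm
    · rw [hF t x h, hF' j' h'] at e
      have := t.2; omega
    · rw [hF' j h, hF t' y h'] at e
      have := t'.2; omega
    · rw [hF' j h, hF' j' h'] at e
      exact congrArg Sum.inr (hσ (Fin.ext (by omega)))
  have hrow : ∀ p, p < D.n₁ + D.M.nO → ∃ x : D.M.Product, (x.isLeft = true → D.full = true) ∧
      D.row x = p := by
    intro p hp
    rcases D.row_cases p with h | ⟨j, rfl⟩ | h
    · exact ⟨Sum.inl ⟨p, (full_of_lt h).2⟩, fun _ => (full_of_lt h).1, rfl⟩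
    · exact ⟨Sum.inr j, by simp, rfl⟩
    · omega
  let f₀ : ℕ → ℕ := fun p =>
    if h : ∃ x : D.M.Product, (x.isLeft = true → D.full = true) ∧ D.row x = p then F h.choose else 0
  have hf₀ : ∀ x : D.M.Product, (x.isLeft = true → D.full = true) → f₀ (D.row x) = F x := by
    intro x hx
    have h : ∃ y : D.M.Product, (y.isLeft = true → D.full = true) ∧ D.row y = D.row x := ⟨x, hx, rfl⟩
    have e : f₀ (D.row x) = F h.choose := dif_pos h
    rw [e, row_injective h.choose_spec.1 hx h.choose_spec.2]
  -- The columns of the product rows are prescribed; the empty rows share the remaining columns in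
  -- any order.
  obtain ⟨E, hE⟩ := Finset.exists_equiv_extend_of_card_eq (α := Fin D.N) (β := ℕ)
    (t := Finset.range D.N) (by simp)
    (s := Finset.univ.filter fun p => (p : ℕ) < D.n₁ + D.M.nO) (f := fun p => f₀ p) (by
      intro q hq
      obtain ⟨p, hp, rfl⟩ := Finset.mem_image.1 hq
      obtain ⟨x, hx, e⟩ := hrow p (Finset.mem_filter.1 hp).2
      rw [← e, hf₀ x hx, Finset.mem_range]
      exact hFlt x hx) (by
      intro p hp q hq e
      obtain ⟨x, hx, ex⟩ := hrow p (Finset.mem_filter.1 hp).2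
      obtain ⟨y, hy, ey⟩ := hrow q (Finset.mem_filter.1 hq).2
      dsimp only at e
      rw [← ex, ← ey, hf₀ x hx, hf₀ y hy] at e
      exact Fin.ext (by rw [← ex, ← ey, hFinj x y hx hy e]))
  let f : ℕ → ℕ := fun p => if h : p < D.N then (E ⟨p, h⟩ : ℕ) else 0
  have hfE : ∀ p (h : p < D.N), f p = E ⟨p, h⟩ := fun p h => dif_pos h
  have hperm : IsPerm D.N f := by
    refine ⟨fun p hp => ?_, fun p hp q hq e => ?_⟩
    · rw [hfE p hp]; exact Finset.mem_range.1 (E ⟨p, hp⟩).2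
    · rw [hfE p hp, hfE q hq] at e
      have := E.injective (Subtype.ext e)
      simpa using this
  have hf : ∀ x : D.M.Product, (x.isLeft = true → D.full = true) → f (D.row x) = F x := by
    intro x hx
    have hN := row_lt_N hx
    rw [hfE _ hN, hE, hf₀ x hx]
    refine Finset.mem_filter.2 ⟨Finset.mem_univ _, ?_⟩
    cases x with
    | inl i =>
      have := i.2
      have := n₁_full (hx rfl)
      simp only [row]; omega
    | inr j =>
      have := j.2
      simp only [row]; omega
  let S := (Finset.range D.N).filter fun p => ∃ t x, π t = some x ∧ D.row x = p
  have hcost : ∀ t j, π t = some (Sum.inr j) → D.cost j ≤ D.C := by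
    intro t j h
    refine le_trans ?_ hπ.budget
    exact Finset.single_le_sum (fun i _ => D.cost_nonneg i)
      (Finset.mem_filter.2 ⟨Finset.mem_univ _, t, h⟩)
  have hty1 : ∀ t i, π t = some (Sum.inl i) → D.table.ty i t = 1 := by
    intro t i h
    have hg := hshown t _ h
    obtain ⟨t', hv, h'⟩ := hπ.places (hg rfl) i
    obtain rfl := hπ.seq _ _ _ h h'
    rw [table_ty (show (i : ℕ) < D.N from row_lt_N hg) (col_lt t)]
    rcases ty_sponsored (D := D) (p := i) (q := t) (by rw [n₁_full (hg rfl)]; exact i.2) with h1 | h1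
    · exact h1.1
    · exact absurd hv (h1.2 i.2 t rfl)
  have hty2 : ∀ t j, π t = some (Sum.inr j) → D.table.ty (D.n₁ + j) t = 2 := by
    intro t j h
    obtain ⟨h1, h2⟩ := hπ.organic t j h
    rw [table_ty (row_lt j) (col_lt t), ty_organic, if_pos ⟨h1, h2, hcost t j h⟩]
  have hrel : Rel D f S π := by
    refine ⟨fun t x h => ?_, fun p hp => ?_⟩
    · have hg := hshown t x h
      exact ⟨Finset.mem_filter.2 ⟨Finset.mem_range.2 (row_lt_N hg), t, x, h, rfl⟩,
        (hf x hg).trans (hF t x h), hg⟩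
    · obtain ⟨t, x, h, rfl⟩ := (Finset.mem_filter.1 hp).2
      exact ⟨t, x, (hf x (hshown t x h)).trans (hF t x h), rfl, h⟩
  have hinj : ∀ p ∈ S, ∀ q ∈ S, f p = f q → p = q := fun p hp q hq e =>
    hperm.2 p (Finset.mem_range.1 (Finset.mem_filter.1 hp).1) q
      (Finset.mem_range.1 (Finset.mem_filter.1 hq).1) e
  refine ⟨f, S, ⟨⟨hperm, fun p hp => ?_⟩, fun p hp h1 => ?_, fun p hp => ?_, ?_⟩, hrel⟩
  · by_cases hlt : p < D.n₁ + D.M.nO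
    · obtain ⟨x, hx, rfl⟩ := hrow p hlt
      rw [hf x hx]
      rcases hcase x hx with ⟨t, h⟩ | ⟨j, rfl, h⟩
      · rw [hF t x h]
        cases x with
        | inl i => exact fun e => by have := (hty1 t i h).symm.trans e; omega
        | inr j => exact fun e => by have := (hty2 t j h).symm.trans e; omega
      · have hlt' := hFlt _ hx
        rw [hF' j h] at hlt' ⊢
        rw [table_ty (row_lt_N hx) hlt', row, ty_organic_ge j (Nat.le_add_right _ _),
          Nat.add_sub_cancel_left, hgrp, hσg, if_pos rfl]
        decide
    · have hfp := hperm.1 p hp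
      rw [table_ty hp hfp, ty_null (by omega)]
      by_cases hk : f p < D.M.k
      · rw [if_pos hk]; decide
      · have hd : f p - D.M.k < D.M.nO := by unfold N at hfp; omega
        obtain ⟨j, hj⟩ := hσs ⟨_, hd⟩
        rw [if_neg hk, if_pos]
        · decide
        -- The place taken by the empty row is `σ j`. It is optional if `j` is displayed; otherwise
        -- the row of `j` would have the same column.
        · by_cases hjA : j ∈ D.M.organicSet π
          · have := (Finset.mem_filter.1 (hσA j hjA)).2
            rw [← hgrp, hj] at this
            exact this
          · exfalso
            have e1 := hf (Sum.inr j) (by simp)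
            rw [hF' j hjA, hj] at e1
            have e2 := hperm.2 _ (row_lt j) p hp (e1.trans (by simp; omega))
            have := j.2
            omega
  · rcases Nat.lt_or_ge p D.n₁ with hlt | hge
    · have hfull := (full_of_lt hlt).1
      obtain ⟨t, _, h⟩ := hπ.places hfull ⟨p, (full_of_lt hlt).2⟩
      exact Finset.mem_filter.2 ⟨Finset.mem_range.2 hp, t, _, h, rfl⟩
    · exact absurd h1 (table_valid.high p hp hge _ (hperm.1 p hp))
  · obtain ⟨hpN, t, x, h, rfl⟩ := Finset.mem_filter.1 hp
    refine ⟨Finset.mem_range.1 hpN, ?_⟩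
    rw [hf x (hshown t x h), hF t x h]
    cases x with
    | inl i => exact Or.inl (hty1 t i h)
    | inr j => exact Or.inr (hty2 t j h)
  · rw [hrel.budget_eq hinj hπ.seq hty2]
    exact hπ.budget

end PlanData

/-! ### Reading the market and writing the result -/

namespace Cmd

/-- A loop that fills one cell per round. -/
theorem exec_fill {α : Type} {x : ℕ} {p : Cmd} (hp : (Cmd.loop x 1 p).ok = true) {m : Mem} {N : ℕ}
    (hN : m.nat 6 0 1 = N) (P : Mem → ℕ → α) (hP : ∀ m' i, P (Mem.setN m' 6 x 0 i) = P m')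
    (F : ℕ → α) (hs : ∀ i < N, ∀ m', m'.nat 6 x 0 = i → (Cmd.loop x 1 p).Frame m m' →
      ∀ j, P (p.exec m') j = if j = i then F i else P m' j) (j : ℕ) :
    P ((Cmd.loop x 1 p).exec m) j = if j < N then F j else P m j := by
  refine loop_one_induction hp m hN (fun i m' => ∀ j, P m' j = if j < i then F j else P m j)
    ?_ ?_ j
  · intro j; simp [hP]
  · intro i hi m' hI hc hF j
    rw [hP, hs i hi m' hc hF, hI]
    by_cases h1 : j = i
    · simp [h1]
    · simp only [if_neg h1, show j < i + 1 ↔ j < i by omega]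

/-- Two nested loops that fill a square table. -/
theorem exec_fill₂ {α : Type} {x y : ℕ} {p : Cmd}
    (hp : (Cmd.loop x 1 (Cmd.loop y 1 p)).ok = true) {m : Mem} {N : ℕ} (hN : m.nat 6 0 1 = N)
    (P : Mem → ℕ → ℕ → α) (hP : ∀ m' z i, P (Mem.setN m' 6 z 0 i) = P m') (F : ℕ → ℕ → α)
    (hs : ∀ i < N, ∀ j < N, ∀ m', m'.nat 6 x 0 = i → m'.nat 6 y 0 = j →
      (Cmd.loop x 1 (Cmd.loop y 1 p)).Frame m m' →
      ∀ i' j', P (p.exec m') i' j' = if i' = i ∧ j' = j then F i j else P m' i' j') (i j : ℕ) :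
    P ((Cmd.loop x 1 (Cmd.loop y 1 p)).exec m) i j =
      if i < N ∧ j < N then F i j else P m i j := by
  have hp' := hp
  simp only [ok, Bool.and_eq_true] at hp'
  have hy : (Cmd.loop y 1 p).ok = true := by simp only [ok, Bool.and_eq_true]; exact hp'.2
  refine loop_one_induction hp m hN
    (fun i m' => ∀ i' j', P m' i' j' = if i' < i ∧ j' < N then F i' j' else P m i' j') ?_ ?_ i j
  · intro i' j'; simp [hP]
  · intro i hi m₁ hI hc hF i' j'
    rw [hP]
    have key := loop_one_induction hy m₁ (hF.len.trans hN) (fun j m' => ∀ i' j', P m' i' j' =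
      if (i' < i ∧ j' < N) ∨ (i' = i ∧ j' < j) then F i' j' else P m i' j') ?_ ?_
    · rw [key]
      by_cases h : i' < i + 1 ∧ j' < N
      · rw [if_pos h, if_pos]
        omega
      · rw [if_neg h, if_neg]
        omega
    · intro i' j'
      rw [hP, hI]; simp
    · intro j hj m' hI' hc' hF' i' j'
      have hx : m'.nat 6 x 0 = i := (hF'.ctr x (by simpa using hp'.1)).trans hc
      rw [hP, hs i hi j hj m' hx hc' (hF.trans hF'.body), hI']
      by_cases h : i' = i ∧ j' = j
      · rw [if_pos h, if_pos (Or.inr ⟨h.1, by omega⟩), h.1, h.2]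
      · rw [if_neg h]
        by_cases h2 : (i' < i ∧ j' < N) ∨ (i' = i ∧ j' < j)
        · rw [if_pos h2, if_pos (by omega)]
        · rw [if_neg h2, if_neg (by omega)]

end Cmd

namespace PlanData

/-- The part of the input that describes the market and the costs. -/
structure Base (M : Market) (C : ℝ) (cost : Fin M.nO → ℝ) (m : Mem) : Prop where
  nS : m.nat 0 0 0 = M.nS
  nO : m.nat 0 0 1 = M.nO
  k : m.nat 0 0 2 = M.k
  valid : ∀ i t, m.nat 1 i t = table2 (fun i t => if t ∈ M.valid i then 1 else 0) i t
  reserved : ∀ t, m.nat 2 t 0 = table1 (fun t => if t ∈ M.reserved then 1 else 0) t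
  r_sponsored : ∀ i, m.real 1 i 0 = table1 (fun i => M.r (Sum.inl i)) i
  r_organic : ∀ i, m.real 2 i 0 = table1 (fun i => M.r (Sum.inr i)) i
  w_sponsored : ∀ i t, m.real 3 i t = table2 (fun i t => M.w (Sum.inl i) t) i t
  w_organic : ∀ i t, m.real 4 i t = table2 (fun i t => M.w (Sum.inr i) t) i t
  cost : ∀ j, m.real 5 j 0 = table1 cost j
  C : m.real 0 0 1 = C
  nat_zero : ∀ a ∈ [5, 20, 24, 25, 44], ∀ i j, m.nat a i j = 0
  real_zero : ∀ a ∈ [20, 21, 22], ∀ i j, m.real a i j = 0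

theorem Base.congr {M : Market} {C : ℝ} {cost : Fin M.nO → ℝ} {m m' : Mem} (h : Base M C cost m)
    (hn : ∀ a ∈ [0, 1, 2, 5, 20, 24, 25, 44], m'.nat a = m.nat a)
    (hr : ∀ a ∈ [1, 2, 3, 4, 5, 20, 21, 22], m'.real a = m.real a)
    (hC : m'.real 0 0 1 = m.real 0 0 1) : Base M C cost m' := by
  obtain ⟨h1, h2, h3, h4, h5, h6, h7, h8, h9, h10, h11, h12, h13⟩ := h
  simp only [List.mem_cons, List.not_mem_nil, or_false, forall_eq_or_imp, forall_eq] at *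
  obtain ⟨n0, n1, n2, n5, n20, n24, n25, n44⟩ := hn
  obtain ⟨r1, r2, r3, r4, r5, r20, r21, r22⟩ := hr
  constructor
  all_goals simp only [List.mem_cons, List.not_mem_nil, or_false, forall_eq_or_imp, forall_eq,
    n0, n1, n2, n5, n20, n24, n25, n44, r1, r2, r3, r4, r5, r20, r21, r22, hC]
  all_goals assumption

/-- The input of the table construction. -/
structure Input (D : PlanData) (m : Mem) : Prop where
  base : Base D.M D.C D.cost m
  group : ∀ j : Fin D.M.nO, m.nat 3 j 0 = D.group j
  quota : ∀ j : Fin D.M.nO, m.nat 4 (D.group j) 0 = D.γ (D.group j)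
  ρ : m.real 0 0 3 = D.ρ
  v : m.real 40 0 0 = D.v
  n₁ : m.nat 45 0 0 = D.n₁
  off : m.nat 46 0 0 = D.M.nS - D.n₁
  len : m.nat 6 0 1 = D.N

/-- The number of organic products in the input. -/
abbrev nOE : NExpr := .read 0 (.const 0) (.const 1)

/-- The number of positions in the input. -/
abbrev kE : NExpr := .read 0 (.const 0) (.const 2)

/-- Mark one place that may stay empty. -/
def optionalStep : Cmd :=
  whenever (natLt (ctr 32) nOE) (block [
    whenever (natLt (nat1 25 (nat1 3 (ctr 32))) (nat1 4 (nat1 3 (ctr 32))))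
      (.setNat 24 (ctr 32) (.const 0) (.const 1)),
    .setNat 25 (nat1 3 (ctr 32)) (.const 0) (.add (nat1 25 (nat1 3 (ctr 32))) (.const 1))])

/-- Compute the type of one pair. -/
def typeStep : Cmd :=
  .ite (natLt (ctr 33) (nvar 45)) (.setNat 20 (ctr 33) (ctr 34) (.read 1 (ctr 33) (ctr 34)))
    (.ite (natLt (ctr 33) (.add (nvar 45) nOE))
      (.ite (natLt (ctr 34) kE)
        (.ite (.and (natEq (nat1 2 (ctr 34)) (.const 0))
            (.and (.realLe (.read 0 (.const 0) (.const 3)) (real1 2 (.sub (ctr 33) (nvar 45))))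
              (.realLe (real1 5 (.sub (ctr 33) (nvar 45))) (.read 0 (.const 0) (.const 1)))))
          (.setNat 20 (ctr 33) (ctr 34) (.const 2)) (.setNat 20 (ctr 33) (ctr 34) (.const 3)))
        (.ite (natEq (nat1 3 (.sub (ctr 33) (nvar 45))) (nat1 3 (.sub (ctr 34) kE)))
          (.setNat 20 (ctr 33) (ctr 34) (.const 3)) (.setNat 20 (ctr 33) (ctr 34) (.const 0))))
      (.ite (natLt (ctr 34) kE) (.setNat 20 (ctr 33) (ctr 34) (.const 3))
        (.ite (natEq (nat1 24 (.sub (ctr 34) kE)) (.const 1))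
          (.setNat 20 (ctr 33) (ctr 34) (.const 3)) (.setNat 20 (ctr 33) (ctr 34) (.const 0)))))

/-- Compute the revenue and the weight of one pair. -/
def weightStep : Cmd :=
  .ite (natLt (ctr 33) (nvar 45))
    (block [.setReal 20 (ctr 33) (ctr 34) (real1 1 (ctr 33)),
      .setReal 21 (ctr 33) (ctr 34) (.read 3 (ctr 33) (ctr 34))])
    (block [.setReal 20 (ctr 33) (ctr 34) (real1 2 (.sub (ctr 33) (nvar 45))),
      .setReal 21 (ctr 33) (ctr 34) (.read 4 (.sub (ctr 33) (nvar 45)) (ctr 34))])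

/-- Compute the cost of one row. -/
def costStep : Cmd :=
  .ite (natLt (ctr 35) (nvar 45)) (.setReal 22 (ctr 35) (.const 0) (.const 0))
    (.setReal 22 (ctr 35) (.const 0) (real1 5 (.sub (ctr 35) (nvar 45))))

/-- Construct the assignment problem. -/
def build : Cmd :=
  block [.loop 32 1 optionalStep, .loop 33 1 (.loop 34 1 (.seq typeStep weightStep)),
    .loop 35 1 costStep, setRV 41 (.read 0 (.const 0) (.const 1))]

variable {D : PlanData}

/-- Array `25` counts by group the products met so far, so the entry read in round `i` is the rank
of `i`. Rounds from `nO` on do nothing, whence the `min` in the invariant. -/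
theorem optional_spec {m : Mem} (hm : D.Input m) (d : Fin D.M.nO) :
    ((Cmd.loop 32 1 optionalStep).exec m).nat 24 d 0 = 1 ↔ D.rank d < D.γ (D.grp d) := by
  have hz := hm.base.nat_zero
  have hgrp : ∀ j : Fin D.M.nO, D.grp j = D.group j := fun j => table1_fin _ _
  have := loop_one_induction (x := 32) (p := optionalStep) rfl m hm.len (fun i m' =>
    (∀ g, m'.nat 25 g 0 = ((Finset.range (min i D.M.nO)).filter fun e => D.grp e = g).card) ∧
    (∀ d : Fin D.M.nO, (m'.nat 24 d 0 = 1 ↔ (d : ℕ) < i ∧ D.rank d < D.γ (D.grp d)))) ?_ ?_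
  · rw [this.2 d]
    have := d.2
    exact and_iff_right (by unfold N; omega)
  · refine ⟨fun g => ?_, fun d => ?_⟩
    · simp [Mem.setN_nat, hz 25 (by simp)]
    · simp [Mem.setN_nat, hz 24 (by simp)]
  · intro i hi m' ⟨hI1, hI2⟩ hc hF
    have h0 := hF.nat 0 (by decide) rfl
    have h3 := hF.nat 3 (by decide) rfl
    have h4 := hF.nat 4 (by decide) rfl
    simp only [Mem.setN_nat_ne _ (show 25 ≠ 6 by decide), Mem.setN_nat_ne _ (show 24 ≠ 6 by decide)]
    by_cases hlt : i < D.M.nO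
    · have hg : m.nat 3 i 0 = D.grp i := (hm.group ⟨i, hlt⟩).trans (hgrp ⟨i, hlt⟩).symm
      have hq : m.nat 4 (D.grp i) 0 = D.γ (D.grp i) := by
        have := hm.quota ⟨i, hlt⟩
        rwa [← hgrp] at this
      have hr : m'.nat 25 (D.grp i) 0 = D.rank i := by
        rw [hI1, min_eq_left hlt.le]; rfl
      have hcard : ∀ g, ((Finset.range (min (i + 1) D.M.nO)).filter fun e => D.grp e = g).card =
          ((Finset.range (min i D.M.nO)).filter fun e => D.grp e = g).card +
            if g = D.grp i then 1 else 0 := by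
        intro g
        rw [min_eq_left hlt.le, min_eq_left hlt, Finset.range_add_one, Finset.filter_insert]
        by_cases h : D.grp i = g
        · rw [if_pos h, if_pos h.symm, Finset.card_insert_of_notMem (by simp)]
        · rw [if_neg h, if_neg (Ne.symm h)]; rfl
      rw [optionalStep, exec_ite_pos (by
        simp [holds_natLt, NExpr.eval, hc, h0, hm.base.nO, hlt])]
      simp only [block, exec.eq_4, exec.eq_1]
      by_cases hopt : D.rank i < D.γ (D.grp i)
      · rw [exec_ite_pos (by
          simp [holds_natLt, NExpr.eval, hc, h3, h4, hg, hq, hr, hopt])]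
        refine ⟨fun g => ?_, fun d => ?_⟩
        · rw [hcard, ← hI1]
          simp [exec, NExpr.eval, hc, Mem.setN_nat, h3, hg]
          split_ifs with h
          · rw [h]
          · rfl
        · simp [exec, NExpr.eval, hc, Mem.setN_nat, h3, hg]
          by_cases h : (d : ℕ) = i
          · simp [h, hopt]
          · simp only [h, not_false_eq_true, true_implies, hI2]
            have : (d : ℕ) < i ↔ (d : ℕ) ≤ i := by omega
            rw [this]
      · rw [exec_ite_neg (by
          simp [holds_natLt, NExpr.eval, hc, h3, h4, hg, hq, hr]; omega)]
        refine ⟨fun g => ?_, fun d => ?_⟩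
        · rw [hcard, ← hI1]
          simp [exec, NExpr.eval, hc, Mem.setN_nat, h3, hg]
          split_ifs with h
          · rw [h]
          · rfl
        · simp [exec, NExpr.eval, hc, Mem.setN_nat, h3, hg]
          rw [hI2]
          by_cases h : (d : ℕ) = i
          · simp [h, hopt]
          · have : (d : ℕ) < i ↔ (d : ℕ) ≤ i := by omega
            rw [this]
    · rw [optionalStep, exec_ite_neg (by
        simp [holds_natLt, NExpr.eval, hc, h0, hm.base.nO]; omega)]
      simp only [exec]
      refine ⟨fun g => ?_, fun d => ?_⟩
      · rw [hI1, min_eq_right (by omega), min_eq_right (by omega)]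
      · rw [hI2]
        have := d.2
        have : (d : ℕ) < i ↔ (d : ℕ) < i + 1 := by omega
        rw [this]

theorem typeStep_exec {m m' : Mem} (hm : D.Input m) {p q : ℕ} (hq : q < D.N)
    (hcp : m'.nat 6 33 0 = p) (hcq : m'.nat 6 34 0 = q)
    (hnat : ∀ a ∈ [0, 1, 2, 3, 45], m'.nat a = m.nat a)
    (hreal : ∀ a ∈ [0, 2, 5], m'.real a = m.real a)
    (hopt : ∀ d : Fin D.M.nO, m'.nat 24 d 0 = 1 ↔ D.rank d < D.γ (D.grp d)) :
    typeStep.exec m' = m'.setN 20 p q (D.ty p q) := by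
  classical
  simp only [List.mem_cons, List.not_mem_nil, or_false, forall_eq_or_imp, forall_eq] at hnat hreal
  obtain ⟨n0, n1, n2, n3, n45⟩ := hnat
  obtain ⟨r0, r2, r5⟩ := hreal
  have hgrp : ∀ j, j < D.M.nO → m.nat 3 j 0 = D.grp j := fun j hj =>
    (hm.group ⟨j, hj⟩).trans (table1_lt D.group hj).symm
  simp only [typeStep]
  rw [ty]
  by_cases h1 : p < D.n₁
  · rw [exec_ite_pos (by simp [holds_natLt, NExpr.eval, hcp, n45, hm.n₁, h1]), if_pos h1]
    simp only [exec, NExpr.eval, hcp, hcq, n1, hm.base.valid]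
  rw [exec_ite_neg (by simp [holds_natLt, NExpr.eval, hcp, n45, hm.n₁]; omega), if_neg h1]
  by_cases h2 : p < D.n₁ + D.M.nO
  · rw [exec_ite_pos (by
      simp [holds_natLt, NExpr.eval, hcp, n45, hm.n₁, n0, hm.base.nO, h2]), if_pos h2]
    by_cases h3 : q < D.M.k
    · rw [exec_ite_pos (by simp [holds_natLt, NExpr.eval, hcq, n0, hm.base.k, h3]), if_pos h3]
      have e : (BExpr.and (natEq (nat1 2 (ctr 34)) (.const 0))
            (.and (.realLe (.read 0 (.const 0) (.const 3)) (real1 2 (.sub (ctr 33) (nvar 45))))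
              (.realLe (real1 5 (.sub (ctr 33) (nvar 45)))
                (.read 0 (.const 0) (.const 1))))).holds m' ↔
          (table1 (fun t => if t ∈ D.M.reserved then 1 else 0) q = 0 ∧
            D.ρ ≤ table1 (fun j => D.M.r (Sum.inr j)) (p - D.n₁) ∧
            table1 D.cost (p - D.n₁) ≤ D.C) := by
        simp only [BExpr.holds, holds_natEq, NExpr.eval, RExpr.eval, hcp, hcq, n2, n45, r0, r2, r5,
          hm.base.reserved, hm.base.r_organic, hm.base.cost, hm.base.C, hm.ρ, hm.n₁]
      split_ifs with h4
      · rw [exec_ite_pos (e.2 h4)]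
        simp only [exec, NExpr.eval, hcp, hcq]
      · rw [exec_ite_neg (fun h => h4 (e.1 h))]
        simp only [exec, NExpr.eval, hcp, hcq]
    · rw [exec_ite_neg (by simp [holds_natLt, NExpr.eval, hcq, n0, hm.base.k]; omega), if_neg h3]
      have e : (natEq (nat1 3 (.sub (ctr 33) (nvar 45))) (nat1 3 (.sub (ctr 34) kE))).holds m' ↔
          D.grp (p - D.n₁) = D.grp (q - D.M.k) := by
        rw [holds_natEq]
        simp only [NExpr.eval, hcp, hcq, n3, n45, n0, hm.n₁, hm.base.k]
        rw [hgrp _ (by omega), hgrp _ (by unfold N at hq; omega)]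
      split_ifs with h4
      · rw [exec_ite_pos (e.2 h4)]
        simp only [exec, NExpr.eval, hcp, hcq]
      · rw [exec_ite_neg (fun h => h4 (e.1 h))]
        simp only [exec, NExpr.eval, hcp, hcq]
  · rw [exec_ite_neg (by
      simp [holds_natLt, NExpr.eval, hcp, n45, hm.n₁, n0, hm.base.nO]; omega), if_neg h2]
    by_cases h3 : q < D.M.k
    · rw [exec_ite_pos (by simp [holds_natLt, NExpr.eval, hcq, n0, hm.base.k, h3]), if_pos h3]
      simp only [exec, NExpr.eval, hcp, hcq]
    · rw [exec_ite_neg (by simp [holds_natLt, NExpr.eval, hcq, n0, hm.base.k]; omega), if_neg h3]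
      have e : (natEq (nat1 24 (.sub (ctr 34) kE)) (.const 1)).holds m' ↔
          D.rank (q - D.M.k) < D.γ (D.grp (q - D.M.k)) := by
        rw [holds_natEq]
        simp only [NExpr.eval, hcq, n0, hm.base.k]
        exact hopt ⟨q - D.M.k, by unfold N at hq; omega⟩
      split_ifs with h4
      · rw [exec_ite_pos (e.2 h4)]
        simp only [exec, NExpr.eval, hcp, hcq]
      · rw [exec_ite_neg (fun h => h4 (e.1 h))]
        simp only [exec, NExpr.eval, hcp, hcq]

theorem weightStep_exec {m m' : Mem} (hm : D.Input m) {p q : ℕ}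
    (hcp : m'.nat 6 33 0 = p) (hcq : m'.nat 6 34 0 = q) (hnat : m'.nat 45 = m.nat 45)
    (hreal : ∀ a ∈ [1, 2, 3, 4], m'.real a = m.real a) :
    weightStep.exec m' = (m'.setR 20 p q (D.rev p)).setR 21 p q (D.wt p q) := by
  simp only [List.mem_cons, List.not_mem_nil, or_false, forall_eq_or_imp, forall_eq] at hreal
  obtain ⟨r1, r2, r3, r4⟩ := hreal
  simp only [weightStep]
  rw [rev, wt]
  by_cases h1 : p < D.n₁
  · rw [exec_ite_pos (by simp [holds_natLt, NExpr.eval, hcp, hnat, hm.n₁, h1]), if_pos h1,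
      if_pos h1]
    simp only [block, exec, NExpr.eval, RExpr.eval, hcp, hcq, Mem.setR_nat, r1, r3,
      Mem.setR_real_ne _ (show 3 ≠ 20 by decide), hm.base.r_sponsored, hm.base.w_sponsored]
  · rw [exec_ite_neg (by simp [holds_natLt, NExpr.eval, hcp, hnat, hm.n₁]; omega), if_neg h1,
      if_neg h1]
    simp only [block, exec, NExpr.eval, RExpr.eval, hcp, hcq, Mem.setR_nat, r2, r4, hnat, hm.n₁,
      Mem.setR_real_ne _ (show 4 ≠ 20 by decide), hm.base.r_organic, hm.base.w_organic]

theorem costStep_exec {m m' : Mem} (hm : D.Input m) {p : ℕ} (hcp : m'.nat 6 35 0 = p)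
    (hnat : m'.nat 45 = m.nat 45) (hreal : m'.real 5 = m.real 5) :
    costStep.exec m' = m'.setR 22 p 0 (D.cst p) := by
  simp only [costStep]
  rw [cst]
  by_cases h1 : p < D.n₁
  · rw [exec_ite_pos (by simp [holds_natLt, NExpr.eval, hcp, hnat, hm.n₁, h1]), if_pos h1]
    simp [exec, NExpr.eval, RExpr.eval, hcp]
  · rw [exec_ite_neg (by simp [holds_natLt, NExpr.eval, hcp, hnat, hm.n₁]; omega), if_neg h1]
    simp only [exec, NExpr.eval, RExpr.eval, hcp, hnat, hm.n₁, hreal, hm.base.cost]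

/-- The tables agree everywhere and not only below `N`: unfilled cells of the memory are still `0`,
and this is why `table` is cut off to `0` there. -/
theorem ofMem_build {m : Mem} (hm : D.Input m) : Table.ofMem (build.exec m) = D.table := by
  classical
  simp only [build, block, exec.eq_4, exec.eq_1]
  set m₁ := (Cmd.loop 32 1 optionalStep).exec m with hm₁
  have F₁ : (Cmd.loop 32 1 optionalStep).Frame m m₁ := exec_frame _ rfl m
  set m₂ := (Cmd.loop 33 1 (Cmd.loop 34 1 (.seq typeStep weightStep))).exec m₁ with hm₂
  have F₂ : (Cmd.loop 33 1 (Cmd.loop 34 1 (.seq typeStep weightStep))).Frame m₁ m₂ :=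
    exec_frame _ rfl m₁
  set m₃ := (Cmd.loop 35 1 costStep).exec m₂ with hm₃
  have F₃ : (Cmd.loop 35 1 costStep).Frame m₂ m₃ := exec_frame _ rfl m₂
  have hfill := exec_fill₂ (x := 33) (y := 34) (p := .seq typeStep weightStep) rfl
    (F₁.len.trans hm.len) (fun m' i j => (m'.nat 20 i j, m'.real 20 i j, m'.real 21 i j))
    (fun m' z i => by
      simp only [Mem.setN_nat_ne _ (show 20 ≠ 6 by decide), Mem.setN_real])
    (fun i j => (D.ty i j, D.rev i, D.wt i j)) (by
      intro p hp q hq m' hcp hcq hF p' q'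
      have e1 : typeStep.exec m' = m'.setN 20 p q (D.ty p q) := by
        refine typeStep_exec hm hq hcp hcq ?_ ?_ ?_
        · intro a ha
          simp only [List.mem_cons, List.not_mem_nil, or_false] at ha
          rcases ha with rfl | rfl | rfl | rfl | rfl <;>
            exact (hF.nat _ (by decide) rfl).trans (F₁.nat _ (by decide) rfl)
        · intro a ha
          simp only [List.mem_cons, List.not_mem_nil, or_false] at ha
          rcases ha with rfl | rfl | rfl <;>
            exact (hF.real _ rfl).trans (F₁.real _ rfl)
        · intro d
          rw [hF.nat 24 (by decide) rfl]
          exact optional_spec hm d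
      have e2 : weightStep.exec (m'.setN 20 p q (D.ty p q)) =
          ((m'.setN 20 p q (D.ty p q)).setR 20 p q (D.rev p)).setR 21 p q (D.wt p q) := by
        refine weightStep_exec hm (by simpa [Mem.setN_nat] using hcp)
          (by simpa [Mem.setN_nat] using hcq) ?_ ?_
        · rw [Mem.setN_nat_ne _ (by decide)]
          exact (hF.nat _ (by decide) rfl).trans (F₁.nat _ (by decide) rfl)
        · intro a ha
          simp only [List.mem_cons, List.not_mem_nil, or_false] at ha
          rcases ha with rfl | rfl | rfl | rfl <;>
            exact (hF.real _ rfl).trans (F₁.real _ rfl)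
      simp only [exec.eq_4, e1, e2, Mem.setR_nat, Mem.setN_nat, Mem.setR_real, Mem.setN_real,
        true_and]
      by_cases h : p' = p ∧ q' = q
      · simp [h]
      · simp [h])
  have hcost := exec_fill (x := 35) (p := costStep) rfl
    (F₂.len.trans (F₁.len.trans hm.len)) (fun m' i => m'.real 22 i 0) (fun m' i => rfl) D.cst (by
      intro p hp m' hcp hF p'
      rw [costStep_exec hm hcp
        ((hF.nat _ (by decide) rfl).trans ((F₂.nat _ (by decide) rfl).trans
          (F₁.nat _ (by decide) rfl)))
        ((hF.real _ rfl).trans ((F₂.real _ rfl).trans (F₁.real _ rfl)))]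
      simp [Mem.setR_real])
  have hz := hm.base.nat_zero
  have hzr := hm.base.real_zero
  have t1 : ∀ p q, m₃.nat 20 p q = D.table.ty p q := by
    intro p q
    rw [F₃.nat 20 (by decide) rfl, show m₂.nat 20 p q = _ from congrArg Prod.fst (hfill p q),
      apply_ite Prod.fst]
    simp [table, F₁.nat 20 (by decide) rfl, hz 20 (by simp)]
  have t2 : ∀ p q, m₃.real 20 p q = D.table.r p q := by
    intro p q
    rw [F₃.real 20 rfl, show m₂.real 20 p q = _ from congrArg (fun a => a.2.1) (hfill p q),
      apply_ite (fun a : ℕ × ℝ × ℝ => a.2.1)]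
    simp [table, F₁.real 20 rfl, hzr 20 (by simp)]
  have t3 : ∀ p q, m₃.real 21 p q = D.table.w p q := by
    intro p q
    rw [F₃.real 21 rfl, show m₂.real 21 p q = _ from congrArg (fun a => a.2.2) (hfill p q),
      apply_ite (fun a : ℕ × ℝ × ℝ => a.2.2)]
    simp [table, F₁.real 21 rfl, hzr 21 (by simp)]
  have t4 : ∀ p, m₃.real 22 p 0 = D.table.c p := by
    intro p
    rw [hcost p, F₂.real 22 rfl, F₁.real 22 rfl, hzr 22 (by simp)]
    rfl
  simp only [Table.ofMem, exec, NExpr.eval, RExpr.eval,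
    Mem.setR_nat, Mem.setR_real_ne _ (show 20 ≠ 41 by decide),
    Mem.setR_real_ne _ (show 21 ≠ 41 by decide), Mem.setR_real_ne _ (show 22 ≠ 41 by decide),
    Mem.setR_real_ne _ (show 40 ≠ 41 by decide), t4]
  rw [show m₃.nat 20 = D.table.ty from funext fun p => funext (t1 p),
    show m₃.real 20 = D.table.r from funext fun p => funext (t2 p),
    show m₃.real 21 = D.table.w from funext fun p => funext (t3 p)]
  rw [F₃.len, F₂.len, F₁.len, hm.len, F₃.nat 45 (by decide) rfl, F₂.nat 45 (by decide) rfl,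
    F₁.nat 45 (by decide) rfl, hm.n₁, F₃.real 40 rfl, F₂.real 40 rfl, F₁.real 40 rfl, hm.v]
  simp only [Mem.setR_real, and_self, if_true]
  rw [F₃.real 0 rfl, F₂.real 0 rfl, F₁.real 0 rfl, hm.base.C]
  rfl

end PlanData

/-! ### The complete algorithms: preparation, search and output. -/

namespace PlanData

variable {D : PlanData}

/-- The search finds a plan that is nearly as good as a third of any plan, and nearly as good as any
plan if the budget is `0`. -/
theorem exists_search_plan {m : Mem} (hm : D.Input m) {k : ℕ} (hk : 0 < k)
    (hne : ∃ π, D.Feasible π) :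
    ∃ π, D.Feasible π ∧
      Rel D (fun p => ((Table.search k).exec (build.exec m)).nat 22 p 0)
        (Table.marked D.N 23 ((Table.search k).exec (build.exec m))) π ∧
      (∀ p < D.N, ∀ q < D.N, ((Table.search k).exec (build.exec m)).nat 22 p 0 =
        ((Table.search k).exec (build.exec m)).nat 22 q 0 → p = q) ∧
      ∀ π' y, D.Feasible π' → (3 * y = D.M.revenue D.v π' ∨
        (D.C = 0 ∧ y = D.M.revenue D.v π')) → y / (1 + 1 / k) ≤ D.M.revenue D.v π := by
  obtain ⟨π₀, hπ₀⟩ := hne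
  -- For `N = 0` no price is tried and nothing is recorded, but there are no positions either and
  -- every revenue is `0`.
  rcases Nat.eq_zero_or_pos D.N with hN | hN
  · have hk0 : D.M.k = 0 := by unfold N at hN; omega
    have hE : IsEmpty (Fin D.M.k) := by rw [hk0]; infer_instance
    have hrev : ∀ π, D.M.revenue D.v π = 0 := fun π => by
      rw [Market.revenue]; exact Finset.sum_eq_zero fun t _ => hE.elim t
    refine ⟨π₀, hπ₀, ⟨fun t => hE.elim t, fun p hp => ?_⟩, fun p hp => by omega, ?_⟩
    · have := Finset.mem_range.1 (Finset.mem_filter.1 hp).1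
      omega
    · intro π' y _ hy
      rw [hrev] at hy ⊢
      have : y = 0 := by rcases hy with h | h <;> linarith
      simp [this]
  · have h44 : (build.exec m).nat 44 0 0 = 0 := by
      rw [(exec_frame build rfl m).nat 44 (by decide) rfl]
      exact hm.base.nat_zero 44 (by simp) 0 0
    obtain ⟨f₀, S₀, hS₀, hrel₀⟩ := exists_isSol hπ₀
    have hsol := (Table.search_approx table_valid hN hk (ofMem_build hm) h44 hS₀
      (y := D.table.value f₀ S₀ / 3) (Or.inl (by ring))).1
    obtain ⟨π, hrel, hπ⟩ := exists_plan hsol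
    refine ⟨π, hπ, hrel, hsol.allowed.1.2, fun π' y hπ' hy => ?_⟩
    obtain ⟨f, S, hS, hrel'⟩ := exists_isSol hπ'
    rw [← hrel'.value_eq hS] at hy
    rw [← hrel.value_eq hsol]
    exact (Table.search_approx table_valid hN hk (ofMem_build hm) h44 hS hy).2

/-- Write the plan. -/
def writePlan : Cmd :=
  .loop 36 1 (whenever (natEq (nat1 23 (ctr 36)) (.const 1))
    (.setNat 5 (nat1 22 (ctr 36)) (.const 0) (.add (.add (nvar 46) (ctr 36)) (.const 1))))

/-- Write the set of pairs of a plan without sponsored products. -/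
def writeSet : Cmd :=
  .loop 36 1 (whenever (natEq (nat1 23 (ctr 36)) (.const 1))
    (.setNat 5 (ctr 36) (nat1 22 (ctr 36)) (.const 1)))

/-- The offset `nS - n₁` turns row numbers into product codes in both modes, since organic codes
start at `nS + 1` even when there are no sponsored rows. By injectivity no position is written
twice. -/
theorem writePlan_spec {m : Mem} (hN : m.nat 6 0 1 = D.N) (hoff : m.nat 46 0 0 = D.M.nS - D.n₁)
    (h5 : ∀ i j, m.nat 5 i j = 0) {π : D.M.Plan}
    (hrel : Rel D (fun p => m.nat 22 p 0) (Table.marked D.N 23 m) π)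
    (hinj : ∀ p < D.N, ∀ q < D.N, m.nat 22 p 0 = m.nat 22 q 0 → p = q) :
    D.M.IsPlanOutput (writePlan.exec m) π := by
  have key := loop_one_induction (x := 36) (p := whenever (natEq (nat1 23 (ctr 36)) (.const 1))
    (.setNat 5 (nat1 22 (ctr 36)) (.const 0) (.add (.add (nvar 46) (ctr 36)) (.const 1)))) rfl m hN
    (fun i m' => (∀ p < i, m.nat 23 p 0 = 1 → m'.nat 5 (m.nat 22 p 0) 0 = D.M.nS - D.n₁ + p + 1) ∧
      ∀ t, (∀ p < i, m.nat 23 p 0 = 1 → m.nat 22 p 0 ≠ t) → m'.nat 5 t 0 = 0) ?_ ?_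
  · intro t
    change ((Cmd.loop 36 1 _).exec m).nat 5 t 0 = _
    cases hπ : π t with
    | none =>
      rw [key.2]
      · rfl
      · intro p hp h1 e
        obtain ⟨t', x, ht', _, hx⟩ := hrel.counted p
          (Finset.mem_filter.2 ⟨Finset.mem_range.2 hp, h1⟩)
        obtain rfl : t = t' := Fin.ext (e.symm.trans ht')
        rw [hπ] at hx; simp at hx
    | some x =>
      obtain ⟨h1, h2, h3⟩ := hrel.shown t x hπ
      obtain ⟨h4, h5⟩ := Finset.mem_filter.1 h1
      have := key.1 _ (Finset.mem_range.1 h4) h5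
      rw [h2] at this
      rw [this]
      cases x with
      | inl i => simp [Market.code, row, n₁_full (h3 rfl)]
      | inr j =>
        have : D.n₁ ≤ D.M.nS := by unfold n₁; split_ifs <;> omega
        simp only [Market.code, row]; omega
  · exact ⟨fun p hp => by omega, fun t _ => by simp [Mem.setN_nat, h5]⟩
  · intro i hi m' ⟨hI1, hI2⟩ hc hF
    have h22 := hF.nat 22 (by decide) rfl
    have h23 := hF.nat 23 (by decide) rfl
    have h46 := hF.nat 46 (by decide) rfl
    simp only [Mem.setN_nat_ne _ (show 5 ≠ 6 by decide)]
    by_cases h1 : m.nat 23 i 0 = 1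
    · rw [exec_ite_pos (by simp [holds_natEq, NExpr.eval, hc, h23, h1])]
      simp only [exec, NExpr.eval, hc, h22, h46, hoff, Mem.setN_nat, true_and, and_true]
      refine ⟨fun p hp hp1 => ?_, fun t ht => ?_⟩
      · rcases Nat.lt_succ_iff_lt_or_eq.1 hp with h | rfl
        · rw [if_neg fun e => ?_, hI1 p h hp1]
          have := hinj p (by omega) i hi e
          omega
        · simp
      · rw [if_neg (fun e => ht i (by omega) h1 e.symm), hI2 t fun p hp => ht p (by omega)]
    · rw [exec_ite_neg (by simp [holds_natEq, NExpr.eval, hc, h23, h1])]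
      simp only [exec]
      refine ⟨fun p hp hp1 => ?_, fun t ht => hI2 t fun p hp => ht p (by omega)⟩
      rcases Nat.lt_succ_iff_lt_or_eq.1 hp with h | rfl
      · exact hI1 p h hp1
      · exact absurd hp1 h1

/-- The pairs of a plan. -/
def pairs {M : Market} (π : M.Plan) : Finset M.Elem :=
  Finset.univ.filter fun e => π e.2 = some (Sum.inr e.1)

theorem mem_pairs {M : Market} {π : M.Plan} {i : Fin M.nO} {t : Fin M.k} :
    (i, t) ∈ pairs π ↔ π t = some (Sum.inr i) := by simp [pairs]

/-- Without sponsored rows, row numbers are the numbers of the organic products. -/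
theorem writeSet_spec {m : Mem} (hN : m.nat 6 0 1 = D.N) (hfull : D.full = false)
    (h5 : ∀ i j, m.nat 5 i j = 0) {π : D.M.Plan}
    (hrel : Rel D (fun p => m.nat 22 p 0) (Table.marked D.N 23 m) π) :
    D.M.IsSetOutput (writeSet.exec m) (pairs π) := by
  have key := loop_one_induction (x := 36) (p := whenever (natEq (nat1 23 (ctr 36)) (.const 1))
    (.setNat 5 (ctr 36) (nat1 22 (ctr 36)) (.const 1))) rfl m hN
    (fun i m' => ∀ p t, m'.nat 5 p t =
      if p < i ∧ m.nat 23 p 0 = 1 ∧ m.nat 22 p 0 = t then 1 else 0) ?_ ?_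
  · intro i t
    change ((Cmd.loop 36 1 _).exec m).nat 5 i t = _
    rw [key]
    have hi : (i : ℕ) < D.N := by have := i.2; unfold N; omega
    have hrow : ∀ j : Fin D.M.nO, D.row (Sum.inr j) = j := fun j => by simp [row, n₁_not hfull]
    refine if_congr ?_ rfl rfl
    rw [mem_pairs]
    constructor
    · rintro ⟨_, h1, h2⟩
      obtain ⟨t', x, ht', hx, hπ⟩ := hrel.counted i
        (Finset.mem_filter.2 ⟨Finset.mem_range.2 hi, h1⟩)
      obtain rfl : t = t' := Fin.ext (h2.symm.trans ht')
      have hg := (hrel.shown t x hπ).2.2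
      rw [hπ, row_injective hg (by simp) (hx.trans (hrow i).symm)]
    · intro hπ
      obtain ⟨h1, h2, _⟩ := hrel.shown t _ hπ
      rw [hrow] at h1 h2
      exact ⟨hi, (Finset.mem_filter.1 h1).2, h2⟩
  · intro p t; simp [Mem.setN_nat, h5]
  · intro i hi m' hI hc hF p t
    have h22 := hF.nat 22 (by decide) rfl
    have h23 := hF.nat 23 (by decide) rfl
    simp only [Mem.setN_nat_ne _ (show 5 ≠ 6 by decide)]
    by_cases h1 : m.nat 23 i 0 = 1
    · rw [exec_ite_pos (by simp [holds_natEq, NExpr.eval, hc, h23, h1])]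
      simp only [exec, NExpr.eval, hc, h22, Mem.setN_nat, true_and, hI]
      by_cases h2 : p = i
      · subst h2
        by_cases h3 : m.nat 22 p 0 = t
        · simp [h1, h3]
        · simp [h1, h3, Ne.symm h3]
      · have : p < i + 1 ↔ p < i := by omega
        simp [h2, this]
    · rw [exec_ite_neg (by simp [holds_natEq, NExpr.eval, hc, h23, h1])]
      simp only [exec, hI]
      by_cases h2 : p = i
      · simp [h2, h1]
      · have : p < i + 1 ↔ p < i := by omega
        simp only [this]

/-- Set up the problem with all products. -/
def fullMode : Cmd :=
  block [setNV 45 (.read 0 (.const 0) (.const 0)), setRV 40 (.read 0 (.const 0) (.const 0)),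
    setNV 46 (.const 0)]

/-- Set up the problem with the organic products only. -/
def organicMode : Cmd :=
  block [setNV 45 (.const 0), setRV 40 (.read 0 (.const 0) (.const 2)),
    setNV 46 (.read 0 (.const 0) (.const 0))]

/-- Put every product into a group of its own. -/
def singletonGroups : Cmd :=
  .loop 31 1 (block [.setNat 3 (ctr 31) (.const 0) (ctr 31),
    .setNat 4 (ctr 31) (.const 0) (.const 1)])

/-- The input of the table construction, up to the selection of the products. -/
structure Prepared (D : PlanData) (m : Mem) : Prop where
  base : Base D.M D.C D.cost m
  group : ∀ j : Fin D.M.nO, m.nat 3 j 0 = D.group j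
  quota : ∀ j : Fin D.M.nO, m.nat 4 (D.group j) 0 = D.γ (D.group j)
  ρ : m.real 0 0 3 = D.ρ
  v : m.real 0 0 (if D.full then 0 else 2) = D.v
  len : m.nat 6 0 1 = D.N

theorem Prepared.fullMode {m : Mem} (h : D.Prepared m) (hfull : D.full = true) :
    D.Input (fullMode.exec m) := by
  have F := exec_frame PlanData.fullMode rfl m
  have hb := h.base
  have hv := h.v
  rw [if_pos hfull] at hv
  refine ⟨hb.congr ?_ ?_ ?_, ?_, ?_, ?_, ?_, ?_, ?_, ?_⟩
  · intro a ha
    simp only [List.mem_cons, List.not_mem_nil, or_false] at ha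
    rcases ha with rfl | rfl | rfl | rfl | rfl | rfl | rfl | rfl <;> exact F.nat _ (by decide) rfl
  · intro a ha
    simp only [List.mem_cons, List.not_mem_nil, or_false] at ha
    rcases ha with rfl | rfl | rfl | rfl | rfl | rfl | rfl | rfl <;> exact F.real _ rfl
  · rw [F.real 0 rfl]
  · rw [F.nat 3 (by decide) rfl]; exact h.group
  · rw [F.nat 4 (by decide) rfl]; exact h.quota
  · rw [F.real 0 rfl]; exact h.ρ
  · simp [PlanData.fullMode, block, exec, NExpr.eval, RExpr.eval, Mem.setR_real, hv]
  · simp [PlanData.fullMode, block, exec, NExpr.eval, Mem.setN_nat, hb.nS, n₁_full hfull]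
  · simp [PlanData.fullMode, block, exec, NExpr.eval, Mem.setN_nat, n₁_full hfull]
  · rw [F.len]; exact h.len

theorem Prepared.organicMode {m : Mem} (h : D.Prepared m) (hfull : D.full = false) :
    D.Input (organicMode.exec m) := by
  have F := exec_frame PlanData.organicMode rfl m
  have hb := h.base
  have hv := h.v
  rw [if_neg (by simp [hfull])] at hv
  refine ⟨hb.congr ?_ ?_ ?_, ?_, ?_, ?_, ?_, ?_, ?_, ?_⟩
  · intro a ha
    simp only [List.mem_cons, List.not_mem_nil, or_false] at ha
    rcases ha with rfl | rfl | rfl | rfl | rfl | rfl | rfl | rfl <;> exact F.nat _ (by decide) rfl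
  · intro a ha
    simp only [List.mem_cons, List.not_mem_nil, or_false] at ha
    rcases ha with rfl | rfl | rfl | rfl | rfl | rfl | rfl | rfl <;> exact F.real _ rfl
  · rw [F.real 0 rfl]
  · rw [F.nat 3 (by decide) rfl]; exact h.group
  · rw [F.nat 4 (by decide) rfl]; exact h.quota
  · rw [F.real 0 rfl]; exact h.ρ
  · simp [PlanData.organicMode, block, exec, NExpr.eval, RExpr.eval, Mem.setR_real, hv]
  · simp [PlanData.organicMode, block, exec, NExpr.eval, Mem.setN_nat, n₁_not hfull]
  · simp [PlanData.organicMode, block, exec, NExpr.eval, Mem.setN_nat, n₁_not hfull, hb.nS]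
  · rw [F.len]; exact h.len

/-- The algorithm for a plan with all products. -/
def fullPlan (pre : Cmd) (k : ℕ) : Cmd := block [pre, fullMode, build, Table.search k, writePlan]

/-- The algorithm for a plan of organic products. -/
def organicPlan (pre : Cmd) (k : ℕ) : Cmd :=
  block [pre, organicMode, build, Table.search k, writePlan]

/-- The algorithm for a set of pairs. -/
def pairSet (pre : Cmd) (k : ℕ) : Cmd := block [pre, organicMode, build, Table.search k, writeSet]

theorem Input.search_frame {m : Mem} (hm : D.Input m) (k : ℕ) :
    ((Table.search k).exec (build.exec m)).nat 6 0 1 = D.N ∧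
    ((Table.search k).exec (build.exec m)).nat 46 0 0 = D.M.nS - D.n₁ ∧
    ∀ i j, ((Table.search k).exec (build.exec m)).nat 5 i j = 0 := by
  have F₁ := exec_frame build rfl m
  have F₂ := exec_frame (Table.search k) rfl (build.exec m)
  refine ⟨F₂.len.trans (F₁.len.trans hm.len), ?_, fun i j => ?_⟩
  · rw [F₂.nat 46 (by decide) rfl, F₁.nat 46 (by decide) rfl, hm.off]
  · rw [F₂.nat 5 (by decide) rfl, F₁.nat 5 (by decide) rfl]
    exact hm.base.nat_zero 5 (by simp) i j

/-- What the algorithms guarantee. -/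
def Guarantee (D : PlanData) (k : ℕ) (π : D.M.Plan) : Prop :=
  D.Feasible π ∧ ∀ π' y, D.Feasible π' → (3 * y = D.M.revenue D.v π' ∨
    (D.C = 0 ∧ y = D.M.revenue D.v π')) → y / (1 + 1 / k) ≤ D.M.revenue D.v π

theorem fullPlan_spec {pre : Cmd} {m : Mem} (h : D.Prepared (pre.exec m)) (hfull : D.full = true)
    {k : ℕ} (hk : 0 < k) (hne : ∃ π, D.Feasible π) :
    ∃ π, D.M.IsPlanOutput ((fullPlan pre k).exec m) π ∧ D.Guarantee k π := by
  have hI := h.fullMode hfull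
  obtain ⟨π, h1, h2, h3, h4⟩ := exists_search_plan hI hk hne
  obtain ⟨e1, e2, e3⟩ := hI.search_frame k
  exact ⟨π, writePlan_spec e1 e2 e3 h2 h3, h1, h4⟩

theorem organicPlan_spec {pre : Cmd} {m : Mem} (h : D.Prepared (pre.exec m))
    (hfull : D.full = false) {k : ℕ} (hk : 0 < k) (hne : ∃ π, D.Feasible π) :
    ∃ π, D.M.IsPlanOutput ((organicPlan pre k).exec m) π ∧ D.Guarantee k π := by
  have hI := h.organicMode hfull
  obtain ⟨π, h1, h2, h3, h4⟩ := exists_search_plan hI hk hne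
  obtain ⟨e1, e2, e3⟩ := hI.search_frame k
  exact ⟨π, writePlan_spec e1 e2 e3 h2 h3, h1, h4⟩

theorem pairSet_spec {pre : Cmd} {m : Mem} (h : D.Prepared (pre.exec m))
    (hfull : D.full = false) {k : ℕ} (hk : 0 < k) (hne : ∃ π, D.Feasible π) :
    ∃ π, D.M.IsSetOutput ((pairSet pre k).exec m) (pairs π) ∧ D.Guarantee k π := by
  have hI := h.organicMode hfull
  obtain ⟨π, h1, h2, _, h4⟩ := exists_search_plan hI hk hne
  obtain ⟨e1, _, e3⟩ := hI.search_frame k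
  exact ⟨π, writeSet_spec e1 hfull e3 h2, h1, h4⟩

end PlanData

/-- A bounded program, with loops of length `nO + k`, as an approximation algorithm. -/
theorem MaxProblem.hasApproxAlgorithm_of_cmd {P : MaxProblem} {α : ℝ} (p : Cmd) (hp : p.ok = true)
    (hsize : ∀ x, (P.encode x).nat 0 0 1 + (P.encode x).nat 0 0 2 ≤ P.size x)
    (h : ∀ x m, m = (P.encode x).setN 6 0 1 ((P.encode x).nat 0 0 1 + (P.encode x).nat 0 0 2) →
      (∃ s, P.Feasible x s) → ∃ s, P.IsOutput x (p.exec m) s ∧ P.Feasible x s ∧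
        ∀ s', P.Feasible x s' → α * P.value x s' ≤ P.value x s) : P.HasApproxAlgorithm α := by
  refine ⟨.seq (.setNat 6 (.const 0) (.const 1) (.add PlanData.nOE PlanData.kE)) p.compile,
    1 + p.cost, fun x hx => ?_⟩
  set m := (P.encode x).setN 6 0 1 ((P.encode x).nat 0 0 1 + (P.encode x).nat 0 0 2) with hm
  obtain ⟨T, hT, hT'⟩ := compile_run p hp m
  have hlen : m.nat 6 0 1 = (P.encode x).nat 0 0 1 + (P.encode x).nat 0 0 2 := by
    simp [hm, Mem.setN_nat]
  rw [hlen] at hT'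
  refine ⟨1 + T, _, .seq (.setNat _ _ _ _ _) hT, ?_, h x m hm hx⟩
  rw [Polynomial.eval_add, Polynomial.eval_one]
  exact Nat.add_le_add_left (hT'.trans (natPolynomial_eval_mono _ (hsize x))) 1

/-! ### The set function on pairs -/

namespace Market

variable {M : Market}

theorem mem_productsOf {U : Finset M.Elem} {i : Fin M.nO} :
    i ∈ M.productsOf U ↔ ∃ t, (i, t) ∈ U := by
  simp [productsOf]

theorem filter_fst_nonempty {U : Finset M.Elem} {i : Fin M.nO} :
    (U.filter fun e => e.1 = i).Nonempty ↔ i ∈ M.productsOf U := by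
  rw [mem_productsOf]
  constructor
  · rintro ⟨⟨j, t⟩, h⟩
    obtain ⟨h1, rfl⟩ := Finset.mem_filter.1 h
    exact ⟨t, h1⟩
  · rintro ⟨t, h⟩
    exact ⟨(i, t), Finset.mem_filter.2 ⟨h, rfl⟩⟩

theorem bestWeight_of_notMem {U : Finset M.Elem} {i : Fin M.nO} (h : i ∉ M.productsOf U) :
    M.bestWeight U i = 0 :=
  dif_neg fun h' => h (filter_fst_nonempty.1 h')

theorem exists_bestWeight {U : Finset M.Elem} {i : Fin M.nO} (h : i ∈ M.productsOf U) :
    ∃ t, (i, t) ∈ U ∧ M.bestWeight U i = M.w (Sum.inr i) t := by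
  have h' := filter_fst_nonempty.2 h
  obtain ⟨⟨j, t⟩, he, hw⟩ := Finset.exists_mem_eq_sup' h' (fun e => M.w (Sum.inr e.1) e.2)
  obtain ⟨h1, rfl⟩ := Finset.mem_filter.1 he
  exact ⟨t, h1, (dif_pos h').trans hw⟩

theorem le_bestWeight {U : Finset M.Elem} {i : Fin M.nO} {t : Fin M.k} (h : (i, t) ∈ U) :
    M.w (Sum.inr i) t ≤ M.bestWeight U i := by
  have h' := filter_fst_nonempty.2 (mem_productsOf.2 ⟨t, h⟩)
  rw [bestWeight, dif_pos h']
  have hm : (i, t) ∈ U.filter fun e => e.1 = i := Finset.mem_filter.2 ⟨h, rfl⟩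
  exact Finset.le_sup' (fun e : M.Elem => M.w (Sum.inr e.1) e.2) hm

theorem bestWeight_nonneg (U : Finset M.Elem) (i : Fin M.nO) : 0 ≤ M.bestWeight U i := by
  by_cases h : i ∈ M.productsOf U
  · obtain ⟨t, _, e⟩ := exists_bestWeight h
    rw [e]; exact M.w_nonneg _ _
  · rw [bestWeight_of_notMem h]

theorem bestWeight_le {U : Finset M.Elem} {i : Fin M.nO} {c : ℝ} (hc : 0 ≤ c)
    (h : ∀ t, (i, t) ∈ U → M.w (Sum.inr i) t ≤ c) : M.bestWeight U i ≤ c := by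
  by_cases hi : i ∈ M.productsOf U
  · obtain ⟨t, ht, e⟩ := exists_bestWeight hi
    rw [e]; exact h t ht
  · rw [bestWeight_of_notMem hi]; exact hc

theorem bestWeight_mono {U V : Finset M.Elem} (h : U ⊆ V) (i : Fin M.nO) :
    M.bestWeight U i ≤ M.bestWeight V i :=
  bestWeight_le (bestWeight_nonneg V i) fun _ ht => le_bestWeight (h ht)

theorem bestWeight_insert (U : Finset M.Elem) (x : M.Elem) (i : Fin M.nO) :
    M.bestWeight (insert x U) i =
      if i = x.1 then max (M.bestWeight U i) (M.w (Sum.inr x.1) x.2) else M.bestWeight U i := by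
  split_ifs with h
  · subst h
    refine le_antisymm (bestWeight_le ((bestWeight_nonneg U _).trans (le_max_left _ _)) ?_)
      (max_le (bestWeight_mono (Finset.subset_insert _ _) _)
        (le_bestWeight (Finset.mem_insert_self _ _)))
    intro t ht
    rcases Finset.mem_insert.1 ht with e | ht
    · rw [← e]; exact le_max_right _ _
    · exact (le_bestWeight ht).trans (le_max_left _ _)
  · refine le_antisymm (bestWeight_le (bestWeight_nonneg U _) ?_)
      (bestWeight_mono (Finset.subset_insert _ _) _)
    intro t ht
    rcases Finset.mem_insert.1 ht with e | ht
    · exact absurd (congrArg Prod.fst e) h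
    · exact le_bestWeight ht

/-- The excess of the revenue over the price `z` per unit of weight. -/
noncomputable def excess (M : Market) (z : ℝ) (U : Finset M.Elem) : ℝ :=
  ∑ i, (M.r (Sum.inr i) - z) * M.bestWeight U i

/-- Best weights vanish off the products of `U`, so all sums may run over all products. Different
sets then become comparable term by term. -/
theorem setRevenue_eq (v : ℝ) (U : Finset M.Elem) : M.setRevenue v U =
    (∑ i, M.r (Sum.inr i) * M.bestWeight U i) / (v + ∑ i, M.bestWeight U i) := by
  have h1 : ∑ j ∈ M.productsOf U, M.bestWeight U j = ∑ j, M.bestWeight U j :=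
    Finset.sum_subset (Finset.subset_univ _) fun i _ hi => bestWeight_of_notMem hi
  have h2 : ∑ j ∈ M.productsOf U, M.r (Sum.inr j) * M.bestWeight U j =
      ∑ j, M.r (Sum.inr j) * M.bestWeight U j :=
    Finset.sum_subset (Finset.subset_univ _) fun i _ hi => by rw [bestWeight_of_notMem hi, mul_zero]
  rw [setRevenue, h1, ← Finset.sum_div, h2]

theorem excess_eq (z : ℝ) (U : Finset M.Elem) : M.excess z U =
    ∑ i, M.r (Sum.inr i) * M.bestWeight U i - z * ∑ i, M.bestWeight U i := by
  rw [excess, Finset.mul_sum, ← Finset.sum_sub_distrib]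
  exact Finset.sum_congr rfl fun i _ => by ring

/-- Multiplying by the positive denominator linearizes the revenue; what follows works with `excess`
instead of the fraction. -/
theorem le_setRevenue_iff {v z : ℝ} (hv : 0 < v) (U : Finset M.Elem) :
    z ≤ M.setRevenue v U ↔ z * v ≤ M.excess z U := by
  have hW : 0 ≤ ∑ i, M.bestWeight U i := Finset.sum_nonneg fun i _ => bestWeight_nonneg U i
  rw [setRevenue_eq, le_div_iff₀ (by linarith), excess_eq, mul_add]
  constructor <;> intro h <;> linarith

theorem setRevenue_le_iff {v z : ℝ} (hv : 0 < v) (U : Finset M.Elem) :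
    M.setRevenue v U ≤ z ↔ M.excess z U ≤ z * v := by
  have hW : 0 ≤ ∑ i, M.bestWeight U i := Finset.sum_nonneg fun i _ => bestWeight_nonneg U i
  rw [setRevenue_eq, div_le_iff₀ (by linarith), excess_eq, mul_add]
  constructor <;> intro h <;> linarith

theorem le_r_of_mem_productsOf {ρ : ℝ} {U : Finset M.Elem} (hU : U ⊆ M.ground ρ) {i : Fin M.nO}
    (hi : i ∈ M.productsOf U) : ρ ≤ M.r (Sum.inr i) := by
  obtain ⟨t, ht⟩ := mem_productsOf.1 hi
  exact (Finset.mem_filter.1 (hU ht)).2.2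

/-- For `z ≤ ρ` the coefficients `r - z` of the products in the ground set are nonnegative, and best
weights grow with the set. -/
theorem excess_mono {ρ z : ℝ} (hz : z ≤ ρ) {U V : Finset M.Elem} (hUV : U ⊆ V)
    (hV : V ⊆ M.ground ρ) : M.excess z U ≤ M.excess z V := by
  refine Finset.sum_le_sum fun i _ => ?_
  by_cases hi : i ∈ M.productsOf V
  · exact mul_le_mul_of_nonneg_left (bestWeight_mono hUV i)
      (by have := le_r_of_mem_productsOf hV hi; linarith)
  · have hi' : i ∉ M.productsOf U := fun h => hi (by
      obtain ⟨t, ht⟩ := mem_productsOf.1 h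
      exact mem_productsOf.2 ⟨t, hUV ht⟩)
    rw [bestWeight_of_notMem hi, bestWeight_of_notMem hi']

theorem setRevenue_le_best {v : ℝ} (U : Finset M.Elem) : M.setRevenue v U ≤ M.bestSetRevenue v U :=
  Finset.le_sup' (M.setRevenue v) (Finset.mem_powerset_self U)

/-- At prices up to `ρ` the whole set has the largest excess among its subsets, so the inner maximum
over subsets disappears. -/
theorem le_bestSetRevenue_iff {ρ v z : ℝ} (hv : 0 < v) (hz : z ≤ ρ) {U : Finset M.Elem}
    (hU : U ⊆ M.ground ρ) : z ≤ M.bestSetRevenue v U ↔ z * v ≤ M.excess z U := by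
  constructor
  · intro h
    obtain ⟨X, hX, e⟩ := Finset.exists_mem_eq_sup' (s := U.powerset)
      ⟨∅, Finset.empty_mem_powerset U⟩ (M.setRevenue v)
    rw [bestSetRevenue, e, le_setRevenue_iff hv] at h
    exact h.trans (excess_mono hz (Finset.mem_powerset.1 hX) hU)
  · intro h
    exact ((le_setRevenue_iff hv U).2 h).trans (setRevenue_le_best U)

/-- The objective: the best revenue, cut off at `ρ`. -/
noncomputable def cutRevenue (M : Market) (v ρ : ℝ) (U : Finset M.Elem) : ℝ :=
  min (M.bestSetRevenue v U) ρ

/-! ### Monotonicity and submodularity of the truncated revenue. -/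

section

variable {v ρ : ℝ}

/-- All properties of the objective are read off from this description of its superlevel sets. -/
theorem le_cutRevenue_iff (hv : 0 < v) {z : ℝ} {U : Finset M.Elem} (hU : U ⊆ M.ground ρ) :
    z ≤ M.cutRevenue v ρ U ↔ z ≤ ρ ∧ z * v ≤ M.excess z U := by
  rw [cutRevenue, le_min_iff]
  constructor
  · rintro ⟨h1, h2⟩
    exact ⟨h2, (le_bestSetRevenue_iff hv h2 hU).1 h1⟩
  · rintro ⟨h1, h2⟩
    exact ⟨(le_bestSetRevenue_iff hv h1 hU).2 h2, h1⟩

theorem cutRevenue_mono (hv : 0 < v) : MonotoneOnSubsets (M.ground ρ) (M.cutRevenue v ρ) := by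
  intro A B hAB hB
  obtain ⟨h1, h2⟩ := (le_cutRevenue_iff hv (hAB.trans hB)).1 (le_refl (M.cutRevenue v ρ A))
  exact (le_cutRevenue_iff hv hB).2 ⟨h1, h2.trans (excess_mono h1 hAB hB)⟩

theorem cutRevenue_le_setRevenue (hv : 0 < v) {U : Finset M.Elem} (hU : U ⊆ M.ground ρ) :
    M.cutRevenue v ρ U ≤ M.setRevenue v U :=
  (le_setRevenue_iff hv U).2 ((le_cutRevenue_iff hv hU).1 le_rfl).2

/-- Only best weights enter, so pairs that are not best for their product may be dropped. -/
theorem cutRevenue_congr (hv : 0 < v) {U V : Finset M.Elem} (hU : U ⊆ M.ground ρ)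
    (hV : V ⊆ M.ground ρ) (h : M.bestWeight U = M.bestWeight V) :
    M.cutRevenue v ρ U = M.cutRevenue v ρ V := by
  have e : ∀ z, M.excess z U = M.excess z V := fun z => by rw [excess, excess, h]
  apply le_antisymm
  · rw [le_cutRevenue_iff hv hV, ← e]; exact (le_cutRevenue_iff hv hU).1 le_rfl
  · rw [le_cutRevenue_iff hv hU, e]; exact (le_cutRevenue_iff hv hV).1 le_rfl

theorem excess_insert (z : ℝ) (U : Finset M.Elem) (x : M.Elem) :
    M.excess z (insert x U) = M.excess z U + (M.r (Sum.inr x.1) - z) *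
      (max (M.bestWeight U x.1) (M.w (Sum.inr x.1) x.2) - M.bestWeight U x.1) := by
  rw [excess, excess, ← sub_eq_iff_eq_add', ← Finset.sum_sub_distrib, Finset.sum_eq_single x.1]
  · rw [bestWeight_insert, if_pos rfl]; ring
  · intro i _ hi
    rw [bestWeight_insert, if_neg hi, sub_self]
  · simp

/-- Let `a`, `b`, `b'` be the values at `A`, `B` and `insert x B`. The price `a + (b' - b)` is
tested on `insert x A`. Raising the price by `b' - b` costs this amount times the total weight,
which is no larger for `insert x A` than for `insert x B`. The contribution of `x`, its revenue
minus the price times the increase of its best weight, is no smaller over `A`, where the price and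
the previous best weight are lower. So the rise that `x` pays for at `B` it also pays for at `A`. -/
theorem cutRevenue_submodular (hv : 0 < v) :
    SubmodularOnSubsets (M.ground ρ) (M.cutRevenue v ρ) := by
  intro A B hAB hB x hx _
  have hA := hAB.trans hB
  have hBx : insert x B ⊆ M.ground ρ := Finset.insert_subset hx hB
  have hAx : insert x A ⊆ M.ground ρ := Finset.insert_subset hx hA
  have hABx : insert x A ⊆ insert x B := Finset.insert_subset_insert x hAB
  have hab : M.cutRevenue v ρ A ≤ M.cutRevenue v ρ B := cutRevenue_mono hv A B hAB hB
  have hbb : M.cutRevenue v ρ B ≤ M.cutRevenue v ρ (insert x B) :=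
    cutRevenue_mono hv _ _ (Finset.subset_insert _ _) hBx
  have haa : M.cutRevenue v ρ A ≤ M.cutRevenue v ρ (insert x A) :=
    cutRevenue_mono hv _ _ (Finset.subset_insert _ _) hAx
  obtain ⟨ha1, ha2⟩ := (le_cutRevenue_iff hv hA).1 (le_refl (M.cutRevenue v ρ A))
  obtain ⟨hb1, hb2⟩ := (le_cutRevenue_iff hv hBx).1 (le_refl (M.cutRevenue v ρ (insert x B)))
  have hBρ : M.cutRevenue v ρ B ≤ ρ := min_le_right _ _
  -- At the cut-off the value of `B` cannot rise any more. Below it the value is the untruncated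
  -- maximum, so the excess of `B` at the price `b` is at most `b * v`.
  rcases eq_or_lt_of_le hBρ with hB1 | hB1
  · linarith
  have hB2 : M.excess (M.cutRevenue v ρ B) B ≤ M.cutRevenue v ρ B * v := by
    rw [← setRevenue_le_iff hv]
    refine (setRevenue_le_best B).trans (le_of_eq ?_)
    rw [cutRevenue] at hB1 ⊢
    rcases min_lt_iff.1 hB1 with h | h
    · exact (min_eq_left h.le).symm
    · exact absurd h (lt_irrefl _)
  set a := M.cutRevenue v ρ A
  set b := M.cutRevenue v ρ B
  set b' := M.cutRevenue v ρ (insert x B)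
  suffices h : a + (b' - b) ≤ M.cutRevenue v ρ (insert x A) by linarith
  rw [le_cutRevenue_iff hv hAx]
  refine ⟨by linarith, ?_⟩
  have hshift : ∀ (U : Finset M.Elem) (z d : ℝ),
      M.excess (z + d) U = M.excess z U - d * ∑ i, M.bestWeight U i := by
    intro U z d
    rw [excess_eq, excess_eq]; ring
  have hWle : ∑ i, M.bestWeight (insert x A) i ≤ ∑ i, M.bestWeight (insert x B) i :=
    Finset.sum_le_sum fun i _ => bestWeight_mono hABx i
  have hr : ρ ≤ M.r (Sum.inr x.1) := (Finset.mem_filter.1 hx).2.2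
  have hB3 : b' = b + (b' - b) := by ring
  have hb3 : (b + (b' - b)) * v ≤ M.excess (b + (b' - b)) (insert x B) := by rw [← hB3]; exact hb2
  rw [hshift, excess_insert] at hb3 ⊢
  have hδ : ∀ U : Finset M.Elem, 0 ≤
      max (M.bestWeight U x.1) (M.w (Sum.inr x.1) x.2) - M.bestWeight U x.1 := fun U =>
    sub_nonneg.2 (le_max_left _ _)
  have hδle : max (M.bestWeight B x.1) (M.w (Sum.inr x.1) x.2) - M.bestWeight B x.1 ≤
      max (M.bestWeight A x.1) (M.w (Sum.inr x.1) x.2) - M.bestWeight A x.1 := by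
    have := bestWeight_mono hAB x.1
    rcases le_total (M.bestWeight B x.1) (M.w (Sum.inr x.1) x.2) with h | h
    · rw [max_eq_right h, max_eq_right (this.trans h)]; linarith
    · rw [max_eq_left h, sub_self]; exact hδ A
  have hgain : (M.r (Sum.inr x.1) - b) *
      (max (M.bestWeight B x.1) (M.w (Sum.inr x.1) x.2) - M.bestWeight B x.1) ≤
      (M.r (Sum.inr x.1) - a) *
      (max (M.bestWeight A x.1) (M.w (Sum.inr x.1) x.2) - M.bestWeight A x.1) :=
    mul_le_mul (by linarith) hδle (hδ B) (by linarith)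
  have hd : (b' - b) * ∑ i, M.bestWeight (insert x A) i ≤
      (b' - b) * ∑ i, M.bestWeight (insert x B) i :=
    mul_le_mul_of_nonneg_left hWle (by linarith)
  linarith

end

/-- Every set contains a set with one best pair for each of its products. -/
theorem exists_best_pairs (U : Finset M.Elem) : ∃ V ⊆ U, Set.InjOn Prod.fst (V : Set M.Elem) ∧
    M.productsOf V = M.productsOf U ∧ M.bestWeight V = M.bestWeight U := by
  classical
  have h : ∀ i : Fin M.nO, ∃ t : Option (Fin M.k), i ∈ M.productsOf U → ∃ s, t = some s ∧
      (i, s) ∈ U ∧ M.bestWeight U i = M.w (Sum.inr i) s := by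
    intro i
    by_cases hi : i ∈ M.productsOf U
    · obtain ⟨s, hs⟩ := exists_bestWeight hi
      exact ⟨some s, fun _ => ⟨s, rfl, hs⟩⟩
    · exact ⟨none, fun h => absurd h hi⟩
  choose τ hτ using h
  have hmem : ∀ i t, (i, t) ∈ U.filter (fun e => τ e.1 = some e.2) ↔ (i, t) ∈ U ∧ τ i = some t :=
    fun i t => Finset.mem_filter
  have hprod : M.productsOf (U.filter fun e => τ e.1 = some e.2) = M.productsOf U := by
    ext i
    constructor
    · intro hi
      obtain ⟨t, ht⟩ := mem_productsOf.1 hi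
      exact mem_productsOf.2 ⟨t, ((hmem i t).1 ht).1⟩
    · intro hi
      obtain ⟨s, hs, hU, _⟩ := hτ i hi
      exact mem_productsOf.2 ⟨s, (hmem i s).2 ⟨hU, hs⟩⟩
  refine ⟨U.filter fun e => τ e.1 = some e.2, Finset.filter_subset _ _, ?_, hprod, ?_⟩
  · rintro ⟨i, t⟩ ht ⟨j, s⟩ hs (rfl : i = j)
    have h1 := ((hmem i t).1 ht).2
    have h2 := ((hmem i s).1 hs).2
    rw [h1] at h2
    rw [Option.some_inj.1 h2]
  · funext i
    by_cases hi : i ∈ M.productsOf U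
    · obtain ⟨s, hs, hU, hw⟩ := hτ i hi
      refine le_antisymm (bestWeight_mono (Finset.filter_subset _ _) i) ?_
      rw [hw]
      exact le_bestWeight ((hmem i s).2 ⟨hU, hs⟩)
    · rw [bestWeight_of_notMem hi, bestWeight_of_notMem (by rw [hprod]; exact hi)]

/-! ### Plans and sets of pairs -/

open PlanData in
theorem productsOf_pairs (π : M.Plan) : M.productsOf (pairs π) = M.organicSet π := by
  ext i
  simp [mem_productsOf, mem_pairs, organicSet]

open PlanData in
-- A displayed product has only one pair, so its best weight is its weight in the position it
-- occupies.
theorem revenue_eq_setRevenue {π : M.Plan} (hπ : M.IsSequence π)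
    (h : ∀ t i, π t ≠ some (Sum.inl i)) (v : ℝ) :
    M.revenue v π = M.setRevenue v (pairs π) := by
  have hw : ∀ t j, π t = some (Sum.inr j) → M.w (Sum.inr j) t = M.bestWeight (pairs π) j := by
    intro t j hj
    have hm := mem_pairs.2 hj
    obtain ⟨s, hs, e⟩ := exists_bestWeight (mem_productsOf.2 ⟨t, hm⟩)
    rw [e, hπ _ _ _ (mem_pairs.1 hs) hj]
  have hW : M.totalWeight π = ∑ j ∈ M.organicSet π, M.bestWeight (pairs π) j := by
    rw [totalWeight, ← sum_organicSet hπ]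
    refine Finset.sum_congr rfl fun t _ => ?_
    cases hx : π t with
    | none => rfl
    | some x =>
      cases x with
      | inl i => exact absurd hx (h t i)
      | inr j => exact hw t j hx
  rw [revenue, setRevenue, productsOf_pairs, hW, ← sum_organicSet hπ (fun i =>
    M.r (Sum.inr i) * M.bestWeight (pairs π) i /
      (v + ∑ j ∈ M.organicSet π, M.bestWeight (pairs π) j))]
  refine Finset.sum_congr rfl fun t _ => ?_
  cases hx : π t with
  | none => rfl
  | some x =>
    cases x with
    | inl i => exact absurd hx (h t i)
    | inr j => simp [hw t j hx, mul_div_assoc]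

open PlanData in
/-- A set with one pair per position and per product is the set of pairs of a plan. -/
theorem exists_pairs_eq {ρ : ℝ} {V : Finset M.Elem} (hV : M.OnePerPosition ρ V)
    (hinj : Set.InjOn Prod.fst (V : Set M.Elem)) : ∃ π : M.Plan, pairs π = V ∧ M.IsSequence π ∧
      ∀ t i, π t ≠ some (Sum.inl i) := by
  classical
  have huniq : ∀ i j t, (i, t) ∈ V → (j, t) ∈ V → i = j := by
    intro i j t hi hj
    have ht := (Finset.mem_filter.1 (hV.1 hi)).2.1
    have := Finset.card_le_one.1 (hV.2 t ht) (i, t)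
      (Finset.mem_inter.2 ⟨hi, Finset.mem_filter.2 ⟨hV.1 hi, rfl⟩⟩) (j, t)
      (Finset.mem_inter.2 ⟨hj, Finset.mem_filter.2 ⟨hV.1 hj, rfl⟩⟩)
    exact congrArg Prod.fst this
  let π : M.Plan := fun t => if h : ∃ i, (i, t) ∈ V then some (Sum.inr h.choose) else none
  have hπ : ∀ t x, π t = some x ↔ ∃ i, x = Sum.inr i ∧ (i, t) ∈ V := by
    intro t x
    by_cases h : ∃ i, (i, t) ∈ V
    · have e : π t = some (Sum.inr h.choose) := dif_pos h
      rw [e, Option.some_inj]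
      constructor
      · rintro rfl; exact ⟨_, rfl, h.choose_spec⟩
      · rintro ⟨i, rfl, hi⟩
        rw [huniq _ _ _ h.choose_spec hi]
    · have e : π t = none := dif_neg h
      rw [e]
      exact ⟨fun h => by simp at h, fun ⟨i, _, hi⟩ => absurd ⟨i, hi⟩ h⟩
  refine ⟨π, ?_, ?_, ?_⟩
  · ext ⟨i, t⟩
    rw [mem_pairs, hπ]
    constructor
    · rintro ⟨j, hj, h⟩
      rwa [Sum.inr_injective hj]
    · exact fun h => ⟨i, rfl, h⟩
  · intro t t' x h h'
    obtain ⟨i, rfl, hi⟩ := (hπ t x).1 h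
    obtain ⟨j, hj, hj'⟩ := (hπ t' _).1 h'
    obtain rfl := Sum.inr_injective hj
    exact congrArg Prod.snd (hinj hi hj' rfl)
  · intro t i h
    obtain ⟨j, hj, _⟩ := (hπ t _).1 h
    exact absurd hj (by simp)

end Market

/-! ### Constrained markets -/

theorem Market.totalWeight_nonneg (M : Market) (π : M.Plan) : 0 ≤ M.totalWeight π := by
  refine Finset.sum_nonneg fun t _ => ?_
  cases π t with
  | none => exact le_rfl
  | some x => exact M.w_nonneg x t

theorem Market.revenue_nonneg (M : Market) {v : ℝ} (hv : 0 < v) (π : M.Plan) :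
    0 ≤ M.revenue v π := by
  have := M.totalWeight_nonneg π
  refine Finset.sum_nonneg fun t _ => ?_
  cases π t with
  | none => exact le_rfl
  | some x =>
    exact mul_nonneg (M.r_nonneg x) (div_nonneg (M.w_nonneg x t) (by linarith))

/-- In a plan that places the sponsored products, the organic products are in organic positions. -/
theorem Market.notMem_reserved {M : Market} {π : M.Plan} (hpl : M.PlacesSponsored π)
    {t : Fin M.k} {j : Fin M.nO} (h : π t = some (Sum.inr j)) : t ∉ M.reserved := by
  intro ht
  choose τ hτ hτ' using hpl
  have hinj : Function.Injective τ := by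
    intro i i' e
    have h1 := hτ' i
    rw [e, hτ' i'] at h1
    exact (Sum.inl_injective (Option.some_inj.1 h1)).symm
  have himg : Finset.univ.image τ = M.reserved := by
    apply Finset.eq_of_subset_of_card_le
    · intro t ht
      obtain ⟨i, _, rfl⟩ := Finset.mem_image.1 ht
      exact M.valid_subset i (hτ i)
    · rw [Finset.card_image_of_injective _ hinj, M.card_reserved]; simp
  rw [← himg] at ht
  obtain ⟨i, _, rfl⟩ := Finset.mem_image.1 ht
  rw [hτ' i] at h
  simp at h

/-- A description of the feasible sets of a class of constraints by a budget and by quotas, and a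
program that prepares the groups. -/
structure BudgetModel (K : ConstraintClass) where
  C : K.Inst → ℝ
  cost : (x : K.Inst) → Fin (K.market x).nO → ℝ
  group : (x : K.Inst) → Fin (K.market x).nO → ℕ
  γ : K.Inst → ℕ → ℕ
  C_nonneg : ∀ x, 0 ≤ C x
  cost_nonneg : ∀ x j, 0 ≤ cost x j
  mem_family : ∀ x A, A ∈ K.family x ↔
    ∑ j ∈ A, cost x j ≤ C x ∧ ∀ q, (A.filter fun j => group x j = q).card ≤ γ x q
  size : ∀ x, (K.market x).nO + (K.market x).k ≤ K.size x
  base : ∀ x, PlanData.Base (K.market x) (C x) (cost x) (K.encode x)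
  w0 : ∀ x, (K.encode x).real 0 0 0 = (K.market x).w0
  real_zero : ∀ x, (K.encode x).real 0 0 3 = 0
  pre : Cmd
  pre_ok : pre.ok = true
  pre_nat : ∀ a, a ≠ 3 → a ≠ 4 → pre.natWrites.contains a = false
  pre_real : pre.realWrites = []
  pre_spec : ∀ x m, (∀ a, a ≠ 6 → m.nat a = (K.encode x).nat a) →
    m.nat 6 0 1 = (K.market x).nO + (K.market x).k → ∀ j : Fin (K.market x).nO,
      (pre.exec m).nat 3 j 0 = group x j ∧ (pre.exec m).nat 4 (group x j) 0 = γ x (group x j)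

/-! ### Algorithms for constraints given by a budget and quotas; the problem `P2`. -/

namespace BudgetModel

variable {K : ConstraintClass} (B : BudgetModel K)

/-- The plans of an instance. -/
def data (x : K.Inst) (full : Bool) (ρ v : ℝ) (hv : 0 < v) : PlanData where
  M := K.market x
  full := full
  ρ := ρ
  v := v
  C := B.C x
  cost := B.cost x
  group := B.group x
  γ := B.γ x
  v_pos := hv
  C_nonneg := B.C_nonneg x
  cost_nonneg := B.cost_nonneg x

variable {B}

/-- The preparing program writes only group labels, quotas and loop counters, so the rest of the
input survives it. -/
theorem prepared {x : K.Inst} {full : Bool} {ρ v : ℝ} {hv : 0 < v} {m : Mem}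
    (hnat : ∀ a, a ≠ 6 → m.nat a = (K.encode x).nat a)
    (hlen : m.nat 6 0 1 = (K.market x).nO + (K.market x).k)
    (hreal : ∀ a, a ≠ 0 → m.real a = (K.encode x).real a)
    (hC : m.real 0 0 1 = (K.encode x).real 0 0 1) (hρ : m.real 0 0 3 = ρ)
    (hv' : m.real 0 0 (if full then 0 else 2) = v) :
    (B.data x full ρ v hv).Prepared (B.pre.exec m) := by
  have F := exec_frame B.pre B.pre_ok m
  have hr : ∀ a, (B.pre.exec m).real a = m.real a := fun a => F.real a (by rw [B.pre_real]; rfl)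
  have hs := B.pre_spec x m hnat hlen
  refine ⟨(B.base x).congr ?_ ?_ ?_, fun j => (hs j).1, fun j => (hs j).2, ?_, ?_, ?_⟩
  · intro a ha
    have h3 : a ≠ 3 ∧ a ≠ 4 ∧ a ≠ 6 := by
      simp only [List.mem_cons, List.not_mem_nil, or_false] at ha; omega
    rw [F.nat a h3.2.2 (B.pre_nat a h3.1 h3.2.1), hnat a h3.2.2]
  · intro a ha
    rw [hr, hreal]
    rintro rfl
    simp at ha
  · rw [hr, hC]
  · rw [hr, hρ]; rfl
  · rw [hr]; exact hv'
  · rw [F.len, hlen]; rfl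

/-- The ratio achieved with `k` prices per factor `(1 + 1 / k) ^ k`. -/
def Ratio (B : BudgetModel K) (k : ℕ) (α : ℝ) : Prop :=
  0 < k ∧ 0 ≤ α ∧ α ≤ 1 ∧
    (α * (1 + 1 / k) * 3 ≤ 1 ∨ ((∀ x, B.C x = 0) ∧ α * (1 + 1 / k) ≤ 1))

theorem Ratio.mono {k : ℕ} {α α' : ℝ} (h : B.Ratio k α) (h0 : 0 ≤ α') (hle : α' ≤ α) :
    B.Ratio k α' := by
  obtain ⟨h1, h2, h3, h4⟩ := h
  have hp : (0 : ℝ) ≤ 1 + 1 / k := by positivity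
  have := mul_le_mul_of_nonneg_right hle hp
  refine ⟨h1, h0, hle.trans h3, ?_⟩
  rcases h4 with h | ⟨h, h'⟩
  · left; linarith
  · right; exact ⟨h, by linarith⟩

/-- The guarantee is used with `y` equal to a third of the revenue of `π'`, or to the whole of it
when the class has budget `0`. -/
theorem Ratio.le {k : ℕ} {α : ℝ} (h : B.Ratio k α) {x : K.Inst} {full : Bool} {ρ v : ℝ}
    {hv : 0 < v} {π π' : (K.market x).Plan} (hπ : (B.data x full ρ v hv).Guarantee k π)
    (hπ' : (B.data x full ρ v hv).Feasible π') :
    α * (K.market x).revenue v π' ≤ (K.market x).revenue v π := by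
  obtain ⟨h1, h2, h3, h4⟩ := h
  have hR := (K.market x).revenue_nonneg hv π'
  have hp : (0 : ℝ) < 1 + 1 / k := by positivity
  rcases h4 with h | ⟨h, h'⟩
  · refine le_trans ?_ (hπ.2 π' ((K.market x).revenue v π' / 3) hπ' (Or.inl ?_))
    · rw [le_div_iff₀ hp]
      have := mul_le_mul_of_nonneg_right h hR
      linarith
    · change 3 * ((K.market x).revenue v π' / 3) = (K.market x).revenue v π'
      ring
  · refine le_trans ?_ (hπ.2 π' ((K.market x).revenue v π') hπ' (Or.inr ⟨h x, rfl⟩))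
    rw [le_div_iff₀ hp]
    have := mul_le_mul_of_nonneg_right h' hR
    linarith

/-- `P2` does not ask organic products to avoid the reserved positions, but the sponsored products
fill these completely. The lower bound `0` on revenues is void. -/
theorem feasible_full_iff {x : K.Inst} {v : ℝ} {hv : 0 < v} {π : (K.market x).Plan} :
    (B.data x true 0 v hv).Feasible π ↔ (K.market x).P2Feasible (K.family x) π := by
  constructor
  · intro h
    exact ⟨h.seq, h.places rfl, (B.mem_family x _).2 ⟨h.budget, h.quota⟩⟩
  · rintro ⟨h1, h2, h3⟩
    obtain ⟨h4, h5⟩ := (B.mem_family x _).1 h3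
    exact ⟨h1, fun _ => h2, fun h => absurd h (by simp [data]), fun t j h =>
      ⟨Market.notMem_reserved h2 h, (K.market x).r_nonneg _⟩, h4, h5⟩

theorem feasible_organic_iff {x : K.Inst} {v : ℝ} {hv : 0 < v} {π : (K.market x).Plan} :
    (B.data x false 0 v hv).Feasible π ↔ (K.market x).P5Feasible (K.family x) π := by
  constructor
  · intro h
    refine ⟨h.seq, fun t p hp => ?_, (B.mem_family x _).2 ⟨h.budget, h.quota⟩⟩
    cases p with
    | inl i => exact absurd hp (h.noSponsored rfl t i)
    | inr j => exact ⟨rfl, (h.organic t j hp).1⟩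
  · rintro ⟨h1, h2, h3⟩
    obtain ⟨h4, h5⟩ := (B.mem_family x _).1 h3
    refine ⟨h1, fun h => absurd h (by simp [data]), fun _ t i h => ?_, fun t j h =>
      ⟨(h2 t _ h).2, (K.market x).r_nonneg _⟩, h4, h5⟩
    exact absurd (h2 t _ h).1 Bool.false_ne_true

/-- Sponsored products are rows of forced pairs in the same assignment problem, so they need not be
placed in advance and the ratio is the same as for organic products alone. -/
theorem hasApproxAlgorithm_P2 (B : BudgetModel K) {k : ℕ} {α : ℝ} (h : B.Ratio k α) :
    K.P2.HasApproxAlgorithm α := by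
  refine MaxProblem.hasApproxAlgorithm_of_cmd (PlanData.fullPlan B.pre k)
    (by simp [PlanData.fullPlan, block, ok, B.pre_ok]; exact ⟨rfl, rfl, rfl, rfl⟩) (fun x => ?_)
    (fun x m hm hx => ?_)
  · change (K.encode x).nat 0 0 1 + (K.encode x).nat 0 0 2 ≤ K.size x
    rw [(B.base x).nO, (B.base x).k]; exact B.size x
  · have hv := (K.market x).w0_pos
    change m = (K.encode x).setN 6 0 1 ((K.encode x).nat 0 0 1 + (K.encode x).nat 0 0 2) at hm
    have hp : (B.data x true 0 _ hv).Prepared (B.pre.exec m) := by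
      refine prepared ?_ ?_ ?_ ?_ ?_ ?_ <;> rw [hm]
      · exact fun a ha => Mem.setN_nat_ne _ ha
      · simp [Mem.setN_nat, (B.base x).nO, (B.base x).k]
      · exact fun a _ => rfl
      · rfl
      · exact B.real_zero x
      · exact B.w0 x
    obtain ⟨s, hs⟩ := hx
    obtain ⟨π, hπ, hg⟩ := PlanData.fullPlan_spec hp rfl h.1 ⟨s, feasible_full_iff.2 hs⟩
    generalize (PlanData.fullPlan B.pre k).exec m = m' at hπ ⊢
    exact ⟨π, hπ, feasible_full_iff.1 hg.1, fun s' hs' => h.le hg (feasible_full_iff.2 hs')⟩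

end BudgetModel

theorem ConstraintClass.P5Inst.w0'_pos {K : ConstraintClass} (y : K.P5Inst) : 0 < y.w0' := by
  have := y.M.totalWeight_nonneg y.σ
  have := y.M.w0_pos
  unfold w0' Market.residualW0
  linarith

theorem setCell_ne {α : Type} (m : ℕ → ℕ → ℕ → α) {a i j : ℕ} {v : α} {a' : ℕ} (h : a' ≠ a) :
    setCell m a i j v a' = m a' := by
  funext i' j'; simp [setCell, h]

/-! ### The problem `P5`. -/

namespace BudgetModel

variable {K : ConstraintClass} {B : BudgetModel K}

theorem hasApproxAlgorithm_P5 (B : BudgetModel K) {k : ℕ} {α : ℝ} (h : B.Ratio k α) :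
    K.P5.HasApproxAlgorithm α := by
  refine MaxProblem.hasApproxAlgorithm_of_cmd (PlanData.organicPlan B.pre k)
    (by simp [PlanData.organicPlan, block, ok, B.pre_ok]; exact ⟨rfl, rfl, rfl, rfl⟩) (fun y => ?_)
    (fun y m hm hy => ?_)
  · change (K.encode y.base).nat 0 0 1 + (K.encode y.base).nat 0 0 2 ≤ K.size y.base
    rw [(B.base _).nO, (B.base _).k]; exact B.size _
  · change m = y.encode.setN 6 0 1 (y.encode.nat 0 0 1 + y.encode.nat 0 0 2) at hm
    have hp : (B.data y.base false 0 _ y.w0'_pos).Prepared (B.pre.exec m) := by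
      have h1 : y.encode.nat 0 0 1 = _ := (B.base y.base).nO
      have h2 : y.encode.nat 0 0 2 = _ := (B.base y.base).k
      refine prepared ?_ ?_ ?_ ?_ ?_ ?_ <;> rw [hm]
      · exact fun a ha => Mem.setN_nat_ne _ ha
      · simp [Mem.setN_nat, h1, h2]
      · exact fun a ha => setCell_ne _ ha
      · rfl
      · exact B.real_zero y.base
      · rfl
    obtain ⟨s, hs⟩ := hy
    obtain ⟨π, hπ, hg⟩ := PlanData.organicPlan_spec hp rfl h.1 ⟨s, feasible_organic_iff.2 hs⟩
    generalize (PlanData.organicPlan B.pre k).exec m = m' at hπ ⊢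
    exact ⟨π, hπ, feasible_organic_iff.1 hg.1, fun s' hs' => h.le hg (feasible_organic_iff.2 hs')⟩

end BudgetModel

/-! ### Objective and constraints of `P6`. -/

namespace ConstraintClass.P6Inst

variable {K : ConstraintClass}

theorem rMin_nonneg (y : K.P6Inst) : 0 ≤ y.rMin :=
  Finset.le_inf' _ _ fun _ _ => y.M.r_nonneg _

theorem OnePerPosition.mono {y : K.P6Inst} {U V : Finset y.M.Elem} (h : y.OnePerPosition U)
    (hV : V ⊆ U) : y.OnePerPosition V :=
  ⟨hV.trans h.1, fun t ht => (Finset.card_le_card (Finset.inter_subset_inter_right hV)).trans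
    (h.2 t ht)⟩

theorem monotone_objective (y : K.P6Inst) : MonotoneOnSubsets y.ground y.objective :=
  Market.cutRevenue_mono y.w0'_pos

theorem submodular_objective (y : K.P6Inst) : SubmodularOnSubsets y.ground y.objective :=
  Market.cutRevenue_submodular y.w0'_pos

/-- There is one part per position; the parts of reserved positions are empty, so a capacity of `1`
imposes nothing there. -/
theorem isPartitionMatroid_onePerPosition (y : K.P6Inst) :
    IsPartitionMatroid y.ground y.OnePerPosition := by
  refine ⟨y.M.k, fun t => y.ground.filter fun e => e.2 = t, fun _ => 1, ?_, ?_, fun U => ?_⟩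
  · intro p q hpq
    refine Finset.disjoint_left.2 fun e h h' => hpq ?_
    rw [← (Finset.mem_filter.1 h).2, ← (Finset.mem_filter.1 h').2]
  · ext e; simp
  · refine ⟨fun h => ⟨h.1, fun t => ?_⟩, fun h => ⟨h.1, fun t _ => h.2 t⟩⟩
    by_cases ht : t ∈ y.M.reserved
    · have : y.ground.filter (fun e => e.2 = t) = ∅ := by
        refine Finset.filter_eq_empty_iff.2 fun e he h => ?_
        exact (Finset.mem_filter.1 he).2.1 (h ▸ ht)
      simp only [this]; simp
    · exact h.2 t ht

/-- Every feasible set contains one with a single pair per product and the same value. -/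
theorem Feasible.exists_injOn {y : K.P6Inst} {U : Finset y.M.Elem} (h : y.Feasible U) :
    ∃ V ⊆ U, Set.InjOn Prod.fst (V : Set y.M.Elem) ∧ y.Feasible V ∧
      y.objective V = y.objective U := by
  obtain ⟨V, hVU, hinj, hprod, hw⟩ := Market.exists_best_pairs U
  exact ⟨V, hVU, hinj, ⟨h.1.mono hVU, by rw [hprod]; exact h.2⟩,
    Market.cutRevenue_congr y.w0'_pos (hVU.trans h.1.1) h.1.1 hw⟩

end ConstraintClass.P6Inst

/-! ### Approximation of `P6` through plans. -/

namespace BudgetModel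

open ConstraintClass PlanData

variable {K : ConstraintClass} {B : BudgetModel K}

theorem exists_feasible_pairs (B : BudgetModel K) {y : K.P6Inst} {V : Finset y.M.Elem}
    (hV : y.Feasible V) (hinj : Set.InjOn Prod.fst (V : Set y.M.Elem)) :
    ∃ π, (B.data y.base false y.rMin y.w0' y.w0'_pos).Feasible π ∧ pairs π = V := by
  obtain ⟨π, rfl, hseq, hno⟩ := Market.exists_pairs_eq hV.1 hinj
  have hf := hV.2
  rw [Market.productsOf_pairs] at hf
  obtain ⟨h4, h5⟩ := (B.mem_family _ _).1 hf
  exact ⟨π, ⟨hseq, fun h => absurd h (by simp [data]), fun _ => hno,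
    fun t j h => (Finset.mem_filter.1 (hV.1.1 (mem_pairs.2 h))).2, h4, h5⟩, rfl⟩

theorem feasible_pairs {y : K.P6Inst} {π : y.M.Plan}
    (hπ : (B.data y.base false y.rMin y.w0' y.w0'_pos).Feasible π) :
    y.Feasible (pairs π) ∧ Set.InjOn Prod.fst (pairs π : Set y.M.Elem) := by
  refine ⟨⟨⟨?_, fun t _ => Finset.card_le_one.2 ?_⟩, ?_⟩, ?_⟩
  · rintro ⟨j, t⟩ h
    exact Finset.mem_filter.2 ⟨Finset.mem_univ _, hπ.organic t j (mem_pairs.1 h)⟩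
  · rintro ⟨i, s⟩ h ⟨i', s'⟩ h'
    obtain ⟨h1, h2⟩ := Finset.mem_inter.1 h
    obtain ⟨h1', h2'⟩ := Finset.mem_inter.1 h'
    obtain rfl : s = t := (Finset.mem_filter.1 h2).2
    obtain rfl : s' = s := (Finset.mem_filter.1 h2').2
    have e := (mem_pairs.1 h1).symm.trans (mem_pairs.1 h1')
    rw [Sum.inr_injective (Option.some_inj.1 e)]
  · rw [Market.productsOf_pairs]
    exact (B.mem_family _ _).2 ⟨hπ.budget, hπ.quota⟩
  · rintro ⟨i, t⟩ h ⟨i', t'⟩ h' (rfl : i = i')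
    rw [hπ.seq _ _ _ (mem_pairs.1 h) (mem_pairs.1 h')]

/-- Any notion of feasibility between that of `P6` and its restriction to one pair per product is
covered, so `P6` and the converted problems are settled together. The program approximates the plain
revenue over products of revenue at least `rMin`, and the pairs of its plan are the output. -/
theorem hasApproxAlgorithm_P6With (B : BudgetModel K) {k : ℕ} {α : ℝ} (h : B.Ratio k α)
    {Feas : (y : K.P6Inst) → Finset y.M.Elem → Prop} (h1 : ∀ y U, Feas y U → y.Feasible U)
    (h2 : ∀ y V, y.Feasible V → Set.InjOn Prod.fst (V : Set y.M.Elem) → Feas y V) :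
    (K.P6With Feas).HasApproxAlgorithm α := by
  refine MaxProblem.hasApproxAlgorithm_of_cmd (pairSet B.pre k)
    (by simp [pairSet, block, ok, B.pre_ok]; exact ⟨rfl, rfl, rfl, rfl⟩) (fun y => ?_)
    (fun y m hm hy => ?_)
  · change (K.encode y.base).nat 0 0 1 + (K.encode y.base).nat 0 0 2 ≤ K.size y.base
    rw [(B.base _).nO, (B.base _).k]; exact B.size _
  · change K.P6Inst at y
    change m = y.encode.setN 6 0 1 (y.encode.nat 0 0 1 + y.encode.nat 0 0 2) at hm
    have hp : (B.data y.base false y.rMin _ y.w0'_pos).Prepared (B.pre.exec m) := by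
      have h1 : y.encode.nat 0 0 1 = _ := (B.base y.base).nO
      have h2 : y.encode.nat 0 0 2 = _ := (B.base y.base).k
      refine prepared ?_ ?_ ?_ ?_ ?_ ?_ <;> rw [hm]
      · exact fun a ha => Mem.setN_nat_ne _ ha
      · simp [Mem.setN_nat, h1, h2]
      · exact fun a ha => (setCell_ne _ ha).trans (setCell_ne _ ha)
      · rfl
      · rfl
      · rfl
    obtain ⟨U, hU⟩ := hy
    obtain ⟨V, _, hVinj, hV, _⟩ := (h1 y U hU).exists_injOn
    obtain ⟨π₀, hπ₀, _⟩ := B.exists_feasible_pairs hV hVinj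
    obtain ⟨π, hπ, hg⟩ := pairSet_spec hp rfl h.1 ⟨π₀, hπ₀⟩
    obtain ⟨hf, hinj⟩ := feasible_pairs hg.1
    generalize (pairSet B.pre k).exec m = m' at hπ ⊢
    refine ⟨pairs π, hπ, h2 y _ hf hinj, fun U' hU' => ?_⟩
    change α * y.objective U' ≤ y.objective (pairs π)
    obtain ⟨V', _, hVinj', hV', e⟩ := (h1 y U' hU').exists_injOn
    obtain ⟨π', hπ', rfl⟩ := B.exists_feasible_pairs hV' hVinj'
    rw [← e]
    have hα := h.2.1
    have hle := h.le hg hπ'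
    have e₁ : y.M.revenue y.w0' π' = y.M.setRevenue y.w0' (pairs π') :=
      Market.revenue_eq_setRevenue hπ'.seq (hπ'.noSponsored rfl) _
    have e₂ : y.M.revenue y.w0' π = y.M.setRevenue y.w0' (pairs π) :=
      Market.revenue_eq_setRevenue hg.1.seq (hg.1.noSponsored rfl) _
    rw [e₁, e₂] at hle
    have h3 : y.objective (pairs π') ≤ y.M.setRevenue y.w0' (pairs π') :=
      Market.cutRevenue_le_setRevenue y.w0'_pos hV'.1.1
    have h4 : y.objective (pairs π') ≤ y.rMin := min_le_right _ _
    -- The revenue bound gives the first part of the minimum. For the cut-off, `α * rMin ≤ rMin`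
    -- because `α ≤ 1`.
    refine le_min ?_ ?_
    · exact (mul_le_mul_of_nonneg_left h3 hα).trans (hle.trans (Market.setRevenue_le_best _))
    · exact (mul_le_mul_of_nonneg_left h4 hα).trans
        (mul_le_of_le_one_left y.rMin_nonneg h.2.2.1)

end BudgetModel

/-! ### Knapsack and group constraints -/

theorem PlanData.singletonGroups_spec {m : Mem} {N : ℕ} (hN : m.nat 6 0 1 = N) {j : ℕ}
    (hj : j < N) :
    (singletonGroups.exec m).nat 3 j 0 = j ∧ (singletonGroups.exec m).nat 4 j 0 = 1 := by
  have := exec_fill (x := 31) (p := block [.setNat 3 (ctr 31) (.const 0) (ctr 31),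
    .setNat 4 (ctr 31) (.const 0) (.const 1)]) rfl hN (fun m' i => (m'.nat 3 i 0, m'.nat 4 i 0))
    (fun m' i => by
      simp only [Mem.setN_nat_ne _ (show 3 ≠ 6 by decide),
        Mem.setN_nat_ne _ (show 4 ≠ 6 by decide)])
    (fun i => (i, 1)) (fun i _ m' hc _ j => by
      by_cases h : j = i <;> simp [block, exec, NExpr.eval, Mem.setN_nat, hc, h]) j
  rw [if_pos hj] at this
  exact ⟨congrArg Prod.fst this, congrArg Prod.snd this⟩

theorem Market.base_encode (M : Market) : PlanData.Base M 0 (fun _ => 0) M.encode where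
  nS := rfl
  nO := rfl
  k := rfl
  valid _ _ := rfl
  reserved _ := rfl
  r_sponsored _ := rfl
  r_organic _ := rfl
  w_sponsored _ _ := rfl
  w_organic _ _ := rfl
  cost j := by simp [Market.encode, table1]
  C := rfl
  nat_zero a ha i j := by
    simp only [List.mem_cons, List.not_mem_nil, or_false] at ha
    rcases ha with rfl | rfl | rfl | rfl | rfl <;> rfl
  real_zero a ha i j := by
    simp only [List.mem_cons, List.not_mem_nil, or_false] at ha
    rcases ha with rfl | rfl | rfl <;> rfl

/-- The knapsack constraints: every product is a group of its own. -/
def knapsackModel : BudgetModel knapsackClass where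
  C x := KnapsackInst.capacity x
  cost x := KnapsackInst.cost x
  group _ j := j
  γ _ _ := 1
  C_nonneg x := KnapsackInst.capacity_nonneg x
  cost_nonneg x := KnapsackInst.cost_nonneg x
  mem_family x A := by
    refine ⟨fun h => ⟨h, fun q => Finset.card_le_one.2 fun a ha b hb => Fin.ext ?_⟩, fun h => h.1⟩
    rw [(Finset.mem_filter.1 ha).2, (Finset.mem_filter.1 hb).2]
  size x := by
    change _ ≤ (KnapsackInst.M x).nS + (KnapsackInst.M x).nO + (KnapsackInst.M x).k
    change (KnapsackInst.M x).nO + (KnapsackInst.M x).k ≤ _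
    omega
  base x := by
    have h := (KnapsackInst.M x).base_encode
    exact ⟨h.nS, h.nO, h.k, h.valid, h.reserved, h.r_sponsored, h.r_organic, h.w_sponsored,
      h.w_organic, fun _ => rfl, rfl, h.nat_zero, fun a ha i j => by
        simp only [List.mem_cons, List.not_mem_nil, or_false] at ha
        rcases ha with rfl | rfl | rfl <;> rfl⟩
  w0 _ := rfl
  real_zero _ := rfl
  pre := PlanData.singletonGroups
  pre_ok := rfl
  pre_nat a h3 h4 := by simp [PlanData.singletonGroups, block, natWrites, h3, h4]
  pre_real := rfl
  pre_spec x m _ hlen j := PlanData.singletonGroups_spec hlen (Nat.lt_add_right _ j.2)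

/-- Labels from `m` on belong to empty groups, so quota `0` is harmless there, and the budget is
void because all costs are `0`. -/
theorem GroupInst.quota_iff (x : GroupInst) (A : Finset (Fin x.M.nO)) :
    (∀ q, (A.filter fun i => x.group i = q).card ≤ x.γ q) ↔ ∑ _j ∈ A, (0 : ℝ) ≤ 0 ∧
      ∀ q, (A.filter fun j => (x.group j : ℕ) = q).card ≤ table1 x.γ q := by
  refine ⟨fun h => ⟨by simp, fun q => ?_⟩, fun h q => ?_⟩
  · by_cases hq : q < x.m
    · rw [table1_lt _ hq]
      refine le_trans (Finset.card_le_card fun j hj => ?_) (h ⟨q, hq⟩)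
      exact Finset.mem_filter.2 ⟨(Finset.mem_filter.1 hj).1, Fin.ext (Finset.mem_filter.1 hj).2⟩
    · rw [Finset.filter_false_of_mem]
      · exact Nat.zero_le _
      · exact fun j _ e => hq (e ▸ (x.group j).2)
  · have := h.2 q
    rw [table1_fin] at this
    refine le_trans (Finset.card_le_card fun j hj => ?_) this
    exact Finset.mem_filter.2 ⟨(Finset.mem_filter.1 hj).1,
      congrArg Fin.val (Finset.mem_filter.1 hj).2⟩

/-- The group constraints: the products cost nothing. -/
def groupModel : BudgetModel groupClass where
  C _ := 0
  cost _ _ := 0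
  group x j := GroupInst.group x j
  γ x := table1 (GroupInst.γ x)
  C_nonneg _ := le_rfl
  cost_nonneg _ _ := le_rfl
  mem_family x A := GroupInst.quota_iff x A
  size x := by
    change (GroupInst.M x).nO + (GroupInst.M x).k ≤
      (GroupInst.M x).nS + (GroupInst.M x).nO + (GroupInst.M x).k + GroupInst.m x
    omega
  base x := by
    have h := (GroupInst.M x).base_encode
    exact ⟨rfl, rfl, rfl, fun _ _ => rfl, fun _ => rfl, h.r_sponsored, h.r_organic, h.w_sponsored,
      h.w_organic, h.cost, h.C, fun a ha i j => by
        simp only [List.mem_cons, List.not_mem_nil, or_false] at ha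
        rcases ha with rfl | rfl | rfl | rfl | rfl <;> rfl, h.real_zero⟩
  w0 _ := rfl
  real_zero _ := rfl
  pre := .skip
  pre_ok := rfl
  pre_nat _ _ _ := rfl
  pre_real := rfl
  pre_spec x m h _ j := by
    change m.nat 3 j 0 = _ ∧ m.nat 4 _ 0 = _
    rw [h 3 (by decide), h 4 (by decide)]
    exact ⟨table1_fin (fun i => (GroupInst.group x i : ℕ)) j, rfl⟩

/-! ### The constraints counted by pairs instead of products. -/

namespace ConstraintClass.P6Inst

theorem sum_productsOf {M : Market} {V : Finset M.Elem}
    (hV : Set.InjOn Prod.fst (V : Set M.Elem)) (c : Fin M.nO → ℝ) :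
    ∑ i ∈ M.productsOf V, c i = ∑ e ∈ V, c e.1 :=
  Finset.sum_image hV

/-- A product with several pairs pays once on the left and once per pair on the right, so the
constraint on pairs is the stricter one. -/
theorem sum_productsOf_le {M : Market} (V : Finset M.Elem) {c : Fin M.nO → ℝ}
    (hc : ∀ i, 0 ≤ c i) : ∑ i ∈ M.productsOf V, c i ≤ ∑ e ∈ V, c e.1 := by
  obtain ⟨W, hW, hinj, hprod, _⟩ := Market.exists_best_pairs V
  rw [← hprod, sum_productsOf hinj]
  exact Finset.sum_le_sum_of_subset_of_nonneg hW fun e _ _ => hc _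

theorem KnapsackFeasible.feasible {y : knapsackClass.P6Inst} {U : Finset y.M.Elem}
    (h : y.KnapsackFeasible U) : y.Feasible U :=
  ⟨h.1, (sum_productsOf_le U (KnapsackInst.cost_nonneg y.base)).trans h.2⟩

theorem Feasible.knapsackFeasible {y : knapsackClass.P6Inst} {V : Finset y.M.Elem}
    (h : y.Feasible V) (hV : Set.InjOn Prod.fst (V : Set y.M.Elem)) : y.KnapsackFeasible V :=
  ⟨h.1, (sum_productsOf hV (KnapsackInst.cost y.base)).symm.le.trans h.2⟩

theorem card_filter_productsOf_le {M : Market} (V : Finset M.Elem) {m : ℕ} (g : Fin M.nO → Fin m)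
    (q : Fin m) : ((M.productsOf V).filter fun i => g i = q).card ≤
      (V.filter fun e => g e.1 = q).card := by
  rw [Market.productsOf, Finset.filter_image]
  exact Finset.card_image_le

theorem card_filter_productsOf {M : Market} {V : Finset M.Elem}
    (hV : Set.InjOn Prod.fst (V : Set M.Elem)) {m : ℕ} (g : Fin M.nO → Fin m) (q : Fin m) :
    ((M.productsOf V).filter fun i => g i = q).card = (V.filter fun e => g e.1 = q).card := by
  rw [Market.productsOf, Finset.filter_image, Finset.card_image_of_injOn]
  exact hV.mono fun e he => (Finset.mem_filter.1 he).1

theorem GroupFeasible.feasible {y : groupClass.P6Inst} {U : Finset y.M.Elem}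
    (h : y.GroupFeasible U) : y.Feasible U :=
  ⟨h.1, fun q => (card_filter_productsOf_le U (GroupInst.group y.base) q).trans (h.2.2 q)⟩

theorem Feasible.groupFeasible {y : groupClass.P6Inst} {V : Finset y.M.Elem}
    (h : y.Feasible V) (hV : Set.InjOn Prod.fst (V : Set y.M.Elem)) : y.GroupFeasible V :=
  ⟨h.1, h.1.1, fun q =>
    (card_filter_productsOf hV (GroupInst.group y.base) q).symm.le.trans (h.2 q)⟩

/-- Thinning a feasible set to one best pair per product keeps its value, and on thinned sets
counting pairs is the same as counting products. -/
theorem reducesTo_of_injOn {K : ConstraintClass} {y : K.P6Inst} {F : Finset y.M.Elem → Prop}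
    (h1 : ∀ V, F V → y.Feasible V)
    (h2 : ∀ V, y.Feasible V → Set.InjOn Prod.fst (V : Set y.M.Elem) → F V) :
    ReducesTo y.objective y.Feasible F := by
  refine ⟨h1, fun U hU => ?_⟩
  obtain ⟨V, hVU, hinj, hV, e⟩ := hU.exists_injOn
  exact ⟨V, hVU, h2 V hV hinj, e⟩

theorem isKnapsackConstraint_pairBudget (y : knapsackClass.P6Inst) :
    IsKnapsackConstraint y.ground y.PairBudget :=
  ⟨fun e => KnapsackInst.cost y.base e.1, KnapsackInst.capacity y.base,
    fun e _ => KnapsackInst.cost_nonneg y.base e.1, fun _ _ => Iff.rfl⟩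

theorem isPartitionMatroid_pairQuota (y : groupClass.P6Inst) :
    IsPartitionMatroid y.ground y.PairQuota := by
  refine ⟨GroupInst.m y.base, fun q => y.ground.filter fun e => GroupInst.group y.base e.1 = q,
    GroupInst.γ y.base, ?_, ?_, fun U => ?_⟩
  · intro p q hpq
    refine Finset.disjoint_left.2 fun e h h' => hpq ?_
    rw [← (Finset.mem_filter.1 h).2, ← (Finset.mem_filter.1 h').2]
  · ext e; simp
  · refine and_congr_right fun hU => forall_congr' fun q => ?_
    have : U ∩ y.ground.filter (fun e => GroupInst.group y.base e.1 = q) =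
        U.filter fun e => GroupInst.group y.base e.1 = q := by
      rw [Finset.inter_filter, Finset.inter_eq_left.2 hU]
    simp only [this]

end ConstraintClass.P6Inst

/-! ### The ratios and the theorem. -/

theorem knapsackModel_ratio {ε : ℝ} (hε : 0 < ε) :
    ∃ k, knapsackModel.Ratio k (1 / ((1 + ε) * 3)) := by
  -- With `k = n + 1` the price steps have ratio `1 + 1 / k < 1 + ε`.
  obtain ⟨n, hn⟩ := exists_nat_one_div_lt hε
  refine ⟨n + 1, n.succ_pos, by positivity, ?_, Or.inl ?_⟩
  · rw [div_le_one (by positivity)]; linarith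
  · rw [div_mul_eq_mul_div, div_mul_eq_mul_div, div_le_one (by positivity)]
    push_cast
    linarith

/-- Without a budget the price grid is the only source of loss, so doubling the price in each step
already achieves `1 / 2`. -/
theorem groupModel_ratio {ε : ℝ} (hε : 0 < ε) : groupModel.Ratio 1 (1 / (2 + ε)) := by
  refine ⟨one_pos, by positivity, ?_, Or.inr ⟨fun _ => rfl, ?_⟩⟩
  · rw [div_le_one (by positivity)]; linarith
  · rw [div_mul_eq_mul_div, div_le_one (by positivity)]
    norm_num
    linarith

theorem div_add_one_le {α : ℝ} (h : 0 ≤ α) : α / (α + 1) ≤ α :=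
  div_le_self h (by linarith)

theorem mainTheorem4 (ε α β : ℝ) (hε : 0 < ε)
    (hα : α = 1 / ((1 + ε) * 3)) (hβ : β = 1 / (2 + ε)) :
    -- knapsack constraints
    ((∀ y : knapsackClass.P6Inst,
        MonotoneOnSubsets y.ground y.objective ∧ SubmodularOnSubsets y.ground y.objective ∧
        IsPartitionMatroid y.ground y.OnePerPosition ∧
        IsKnapsackConstraint y.ground y.PairBudget ∧
        ReducesTo y.objective y.Feasible y.KnapsackFeasible) ∧
      (knapsackClass.P6With ConstraintClass.P6Inst.KnapsackFeasible).HasApproxAlgorithm α ∧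
      knapsackClass.P6.HasApproxAlgorithm α ∧
      knapsackClass.P5.HasApproxAlgorithm α ∧
      knapsackClass.P2.HasApproxAlgorithm (α / (α + 1))) ∧
    -- group (partition matroid) constraints
    ((∀ y : groupClass.P6Inst,
        MonotoneOnSubsets y.ground y.objective ∧ SubmodularOnSubsets y.ground y.objective ∧
        IsPartitionMatroid y.ground y.OnePerPosition ∧
        IsPartitionMatroid y.ground y.PairQuota ∧
        ReducesTo y.objective y.Feasible y.GroupFeasible) ∧
      (groupClass.P6With ConstraintClass.P6Inst.GroupFeasible).HasApproxAlgorithm β ∧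
      groupClass.P6.HasApproxAlgorithm β ∧
      groupClass.P5.HasApproxAlgorithm β ∧
      groupClass.P2.HasApproxAlgorithm (β / (β + 1))) := by

  have hα0 : 0 ≤ α := by rw [hα]; positivity
  have hβ0 : 0 ≤ β := by rw [hβ]; positivity
  obtain ⟨k, hk⟩ := knapsackModel_ratio hε
  rw [← hα] at hk
  have hg := groupModel_ratio hε
  rw [← hβ] at hg
  refine ⟨⟨fun y => ⟨y.monotone_objective, y.submodular_objective,
      y.isPartitionMatroid_onePerPosition, y.isKnapsackConstraint_pairBudget,
      ConstraintClass.P6Inst.reducesTo_of_injOn (fun _ h => h.feasible)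
        fun _ h => h.knapsackFeasible⟩,
      knapsackModel.hasApproxAlgorithm_P6With hk (fun _ _ h => h.feasible)
        fun _ _ h => h.knapsackFeasible,
      knapsackModel.hasApproxAlgorithm_P6With hk (fun _ _ h => h) fun _ _ h _ => h,
      knapsackModel.hasApproxAlgorithm_P5 hk,
      knapsackModel.hasApproxAlgorithm_P2 (hk.mono (by positivity) (div_add_one_le hα0))⟩,
    ⟨fun y => ⟨y.monotone_objective, y.submodular_objective,
      y.isPartitionMatroid_onePerPosition, y.isPartitionMatroid_pairQuota,
      ConstraintClass.P6Inst.reducesTo_of_injOn (fun _ h => h.feasible)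
        fun _ h => h.groupFeasible⟩,
      groupModel.hasApproxAlgorithm_P6With hg (fun _ _ h => h.feasible)
        fun _ _ h => h.groupFeasible,
      groupModel.hasApproxAlgorithm_P6With hg (fun _ _ h => h) fun _ _ h _ => h,
      groupModel.hasApproxAlgorithm_P5 hg,
      groupModel.hasApproxAlgorithm_P2 (hg.mono (by positivity) (div_add_one_le hβ0))⟩⟩
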